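/- Call a relation $R\subseteq\{0,1\}^*\times\{0,1\}^*$ \emph{polynomially bounded} if there is a polynomial $p$ with $|y|\le p(|x|)$ for all $(x,y)\in R$. $\mathsf{FP}$ is the class of polynomially bounded relations $R$ for which there is a deterministic polynomial-time Turing machine $A$ with $(x,A(x))\in R$ for every $x$ for which some $y$ satisfies $(x,y)\in R$. $\mathsf{FBPP}$ is the class of polynomially bounded relations $R$ for which there is a polynomial-time randomized Turing machine $A$ such that, for every $x$ for which some $y$ satisfies $(x,y)\in R$ and for every real $\varepsilon>0$, $$\Pr\bigl[(x,A(x,0^{\lceil 1/\varepsilon\rceil}))\in R\bigr]\ge 1-\varepsilon ,$$ where the probability is over the (polynomially many) fair coin flips of $A$. For a string $y\in\{0,1\}^*$ let $$\operatorname{Kt}(y)=\min_{P:\,P()=y}\bigl(|P|+\log_2 t(P)\bigr)$$ be Levin's time-bounded Kolmogorov complexity: the minimum is over all programs $P\in\{0,1\}^*$ that output $y$ on blank input, $t(P)$ is the running time of $P$, and the programming language is fixed as follows. A program is a self-delimiting binary code of a finite list of instructions of a multi-stack machine (push a given symbol on a given stack; pop a given stack; jump to a given address if a given symbol is on top of a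 given stack; jump), with numbers written in unary, followed by arbitrary data bits. The data bits are initially on stack $0$, the output is the content of stack $1$ when the machine halts, and the running time is the number of executed instructions plus one. Let $$R=\Bigl\{(x,y)\in\{0,1\}^*\times\{0,1\}^* : |x|=|y|,\ \operatorname{Kt}(y)\ge \tfrac{|y|}{2}\Bigr\}.$$ \textbf{Theorem.} Unconditionally, $R\in\mathsf{FBPP}$ and $R\notin\mathsf{FP}$. In particular $\mathsf{FP}\ne\mathsf{FBPP}$. -/

import Mathlib

namespace RelComplexity

/-! ### Relational problems, FP and FBPP -/

/-- A relational problem: a relation `R ⊆ {0,1}* × {0,1}*`. -/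
abbrev Relation : Type := List Bool → List Bool → Prop

/-- `R` is polynomially bounded: there is a polynomial `p` with `|y| ≤ p(|x|)` whenever
`(x, y) ∈ R`. -/
def PolyBounded (R : Relation) : Prop :=
  ∃ p : Polynomial ℕ, ∀ x y, R x y → y.length ≤ p.eval x.length

/-- `FP`: the polynomially bounded relations `R` for which some deterministic polynomial-time
Turing machine outputs, on every `x` that has a solution, some `y` with `(x, y) ∈ R`. -/
def FP : Set Relation :=
  {R | PolyBounded R ∧ ∃ A : List Bool → List Bool,
    Nonempty (Turing.TM2ComputableInPolyTime (id : List Bool → List Bool) id A) ∧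
    ∀ x, (∃ y, R x y) → R x (A x)}

/-- The input of a randomized machine, written as the word `x # 0^m # r` over the alphabet
`{0, 1, #}` (with `none` for `#`): the instance `x`, the accuracy parameter `m` in unary, and the
random bits `r`. -/
def encodeInput (i : List Bool × ℕ × List Bool) : List (Option Bool) :=
  i.1.map some ++ none :: (List.replicate i.2.1 (some false) ++ none :: i.2.2.map some)

/-- The probability of the event `E` for `ℓ` independent fair coin flips. -/
noncomputable def coinProb (ℓ : ℕ) (E : List Bool → Prop) : ℝ :=
  (Set.ncard {r : Fin ℓ → Bool | E (List.ofFn r)} : ℝ) / 2 ^ ℓ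

/-- `FBPP`: the polynomially bounded relations `R` for which some polynomial-time randomized
machine `A` satisfies `Pr[(x, A(x, 0^{1/ε})) ∈ R] ≥ 1 - ε` for every `x` that has a solution and
every `ε > 0`. The machine runs in time polynomial in the length of its whole input, and its
random bits are `q(|x| + ⌈1/ε⌉)` independent fair coin flips, for a polynomial `q`. -/
def FBPP : Set Relation :=
  {R | PolyBounded R ∧ ∃ (q : Polynomial ℕ) (A : List Bool × ℕ × List Bool → List Bool),
    Nonempty (Turing.TM2ComputableInPolyTime encodeInput id A) ∧
    ∀ x, (∃ y, R x y) → ∀ ε : ℝ, 0 < ε →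
      1 - ε ≤ coinProb (q.eval (x.length + ⌈1 / ε⌉₊))
        (fun r => R x (A (x, ⌈1 / ε⌉₊, r)))}

/-! ### A programming language, and Levin's time-bounded Kolmogorov complexity -/

/-- The instructions of a machine with finitely many stacks over a finite alphabet.
Stacks, symbols and instruction addresses are named by natural numbers. -/
inductive Instr : Type
  /-- `push k a`: push the symbol `a` on stack `k`, go to the next instruction. -/
  | push (k a : ℕ)
  /-- `pop k`: remove the top of stack `k` (if any), go to the next instruction. -/
  | pop (k : ℕ)
  /-- `branch k a j`: if the top of stack `k` is the symbol `a`, go to instruction `j`,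
  otherwise (also if the stack is empty) to the next one. -/
  | branch (k a j : ℕ)
  /-- `goto j`: go to instruction `j`. -/
  | goto (j : ℕ)

/-- The self-delimiting code `1^a 0` of a natural number. -/
def encodeNat (a : ℕ) : List Bool := List.replicate a true ++ [false]

/-- The binary code of an instruction. -/
def Instr.encode : Instr → List Bool
  | .push k a => encodeNat 0 ++ encodeNat k ++ encodeNat a
  | .pop k => encodeNat 1 ++ encodeNat k
  | .branch k a j => encodeNat 2 ++ encodeNat k ++ encodeNat a ++ encodeNat j
  | .goto j => encodeNat 3 ++ encodeNat j

/-- The self-delimiting binary code of an instruction list. -/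
def encodeCode : List Instr → List Bool
  | [] => encodeNat 4
  | i :: M => i.encode ++ encodeCode M

/-- A configuration: the address of the current instruction and the contents of the stacks. -/
structure Config : Type where
  pc : ℕ
  stk : ℕ → List ℕ

/-- The effect of one instruction. -/
def Instr.exec (c : Config) : Instr → Config
  | .push k a => ⟨c.pc + 1, Function.update c.stk k (a :: c.stk k)⟩
  | .pop k => ⟨c.pc + 1, Function.update c.stk k (c.stk k).tail⟩
  | .branch k a j => ⟨if (c.stk k).head? = some a then j else c.pc + 1, c.stk⟩
  | .goto j => ⟨j, c.stk⟩

/-- The initial configuration: the data bits are on stack `0`, first bit on top, and all other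
stacks are empty. -/
def initConfig (d : List Bool) : Config :=
  ⟨0, Function.update (fun _ => []) 0 (d.map Bool.toNat)⟩

/-- `HaltsIn M c y t`: from configuration `c`, the code `M` halts after exactly `t` steps with
output `y` on stack `1`. The machine halts when the current address is that of no instruction;
noticing this is counted as a step, so that `t ≥ 1`. -/
inductive HaltsIn (M : List Instr) : Config → List Bool → ℕ → Prop
  | halt (c : Config) (y : List Bool) (hpc : M[c.pc]? = none)
      (hy : c.stk 1 = y.map Bool.toNat) : HaltsIn M c y 1
  | step (c : Config) (y : List Bool) (t : ℕ) (i : Instr) (hi : M[c.pc]? = some i)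
      (h : HaltsIn M (i.exec c) y t) : HaltsIn M c y (t + 1)

/-- `Prints P y t`: the program `P` (a bit string, without any input) outputs `y` in `t` steps.
A program is a self-delimiting code followed by data bits; a bit string that does not
start with a code outputs nothing. -/
def Prints (P y : List Bool) (t : ℕ) : Prop :=
  ∃ (M : List Instr) (d : List Bool), P = encodeCode M ++ d ∧ HaltsIn M (initConfig d) y t

/-- Levin's complexity `Kt(y)`: the minimum of `|P| + log₂ t` over all programs `P` that output
`y`, where `t` is the running time of `P`. -/
noncomputable def Kt (y : List Bool) : EReal :=
  ⨅ (P : List Bool) (t : ℕ) (_ : Prints P y t), (((P.length : ℝ) + Real.logb 2 t : ℝ) : EReal)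

/-- The relation `{(x, y) : |x| = |y|, Kt(y) ≥ |y| / 2}`. -/
def ktRelation : Relation := fun x y =>
  x.length = y.length ∧ (((y.length : ℝ) / 2 : ℝ) : EReal) ≤ Kt y

/-! A bit string is a program in at most one way, and its output and running time are unique. -/

theorem encodeNat_append_inj {a b : ℕ} {u v : List Bool}
    (h : encodeNat a ++ u = encodeNat b ++ v) : a = b ∧ u = v := by
  induction a generalizing b with
  | zero => cases b <;> simp_all [encodeNat, List.replicate_succ]
  | succ a ih =>
    cases b with
    | zero => simp [encodeNat, List.replicate_succ] at h
    | succ b =>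
      have := @ih b (by simpa [encodeNat, List.replicate_succ] using h)
      simpa using this

theorem Instr.encode_append_inj {i j : Instr} {u v : List Bool}
    (h : i.encode ++ u = j.encode ++ v) : i = j ∧ u = v := by
  cases i <;> cases j <;> simp only [Instr.encode, List.append_assoc] at h <;>
    have h0 := encodeNat_append_inj h <;> simp at h0
  case push.push =>
    have h1 := encodeNat_append_inj h0
    have h2 := encodeNat_append_inj h1.2
    exact ⟨by rw [h1.1, h2.1], h2.2⟩
  case pop.pop =>
    have h1 := encodeNat_append_inj h0
    exact ⟨by rw [h1.1], h1.2⟩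
  case branch.branch =>
    have h1 := encodeNat_append_inj h0
    have h2 := encodeNat_append_inj h1.2
    have h3 := encodeNat_append_inj h2.2
    exact ⟨by rw [h1.1, h2.1, h3.1], h3.2⟩
  case goto.goto =>
    have h1 := encodeNat_append_inj h0
    exact ⟨by rw [h1.1], h1.2⟩

theorem encodeCode_append_inj {M N : List Instr} {u v : List Bool}
    (h : encodeCode M ++ u = encodeCode N ++ v) : M = N ∧ u = v := by
  induction M generalizing N with
  | nil =>
    cases N with
    | nil => exact ⟨rfl, (encodeNat_append_inj h).2⟩
    | cons j N =>
      cases j <;> simp only [encodeCode, Instr.encode, List.append_assoc] at h <;>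
        exact absurd (encodeNat_append_inj h).1 (by decide)
  | cons i M ih =>
    cases N with
    | nil =>
      cases i <;> simp only [encodeCode, Instr.encode, List.append_assoc] at h <;>
        exact absurd (encodeNat_append_inj h).1 (by decide)
    | cons j N =>
      simp only [encodeCode, List.append_assoc] at h
      obtain ⟨h1, h2⟩ := Instr.encode_append_inj h
      obtain ⟨h3, h4⟩ := ih h2
      exact ⟨by rw [h1, h3], h4⟩

theorem HaltsIn.unique {M : List Instr} {c : Config} {y z : List Bool} {s t : ℕ}
    (h : HaltsIn M c y s) (h' : HaltsIn M c z t) : y = z ∧ s = t := by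
  induction h generalizing t with
  | halt c y hpc hy =>
    cases h' with
    | halt _ _ _ hz =>
      exact ⟨List.map_injective_iff.2 (by decide : Function.Injective Bool.toNat) (hy.symm.trans hz), rfl⟩
    | step _ _ t i hi _ => simp [hpc] at hi
  | step c y s i hi _ ih =>
    cases h' with
    | halt _ _ hpc _ => simp [hpc] at hi
    | step _ _ t j hj h =>
      obtain rfl : i = j := by simpa [hi] using hj
      obtain ⟨h1, h2⟩ := ih h
      exact ⟨h1, by rw [h2]⟩

theorem Prints.unique {P y z : List Bool} {s t : ℕ}
    (h : Prints P y s) (h' : Prints P z t) : y = z ∧ s = t := by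
  obtain ⟨M, d, rfl, h⟩ := h
  obtain ⟨N, e, he, h'⟩ := h'
  obtain ⟨rfl, rfl⟩ := encodeCode_append_inj he
  exact h.unique h'

end RelComplexity

/-!
Write `n` for the length of the input `x`, and call a string `y` of length `n` compressible if
`Kt y < n / 2`.

*Membership in `FBPP`.* A compressible string is printed by a program of length less than `n / 2`
within `2 ^ ⌊n / 2⌋` steps (`exists_prints_of_kt_lt`). There are at most `2 ^ (n - ⌊n / 2⌋)` such
programs, so a random string is compressible with probability at most `2 ^ (-⌊n / 2⌋)`
(`ncard_kt_lt_le`). This is good enough if `m = ⌈1 / ε⌉` is less than `2 ^ ⌊n / 2⌋`. Otherwise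
`2 ^ ⌊n / 2⌋ ≤ m`, and there is time for a deterministic search: for each of the first
`2 ^ (⌊n / 2⌋ + 1) + 1` candidates `y`, all programs of length at most `n / 2` are run for `m` steps,
until a candidate is found that none of them prints.

To see that this algorithm runs in polynomial time on a Turing machine, it is written in a language
`Cmd` on stacks of bits whose only loop repeats its body `L` times, where `L` is the number of random
bits. Every command of this language runs in polynomial time (`Cmd.computable`): it is translated to
a language `WCmd` with while loops, which has a big-step semantics with a cost and is compiled to
Turing machines. As `L` is fixed during the execution, the number of random bits is chosen so large
that all loops run to their end. The main part of the algorithm is a universal machine, whose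
correctness is `Cmd.eval_simulate`; on programs that do not halt in time its output does not matter,
except that it depends on the program and on `m` only (`Cmd.eval_simulate_eq_simOutput`), so that the
simulated programs have no more outputs than there are programs.

*Not in `FP`.* Let `A` be computed by a Turing machine in polynomial time. The machine is compiled to
a program of the given language that first expands `k` data bits to the input `1 ^ (3 * k)` and then
simulates the machine with constant slowdown (`exists_prints_of_computable`). The program has length
`c + k`, and so `Kt (A (1 ^ (3 * k))) ≤ c + k + O(log k)`, which is less than `3 * k / 2` for large
`k`. Since every `x` has a solution, `A` does not solve the relation (`ktRelation_notMem_FP`).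
-/

namespace RelComplexity

open Turing

/-! ### A while language on stacks, and its compilation to Turing machines -/

/-- Commands of a while language whose variables are stacks: stack `k` holds symbols from `Γ k`.
Tests look at the top of one stack (`none` if it is empty). -/
inductive WCmd {K : Type} (Γ : K → Type) : Type
  | skip
  | push (k : K) (a : Γ k)
  | pop (k : K)
  | seq (c d : WCmd Γ)
  | ite (k : K) (p : Option (Γ k) → Bool) (c d : WCmd Γ)
  | loop (k : K) (p : Option (Γ k) → Bool) (c : WCmd Γ)

namespace WCmd

variable {K : Type} {Γ : K → Type}

section Exec

variable [DecidableEq K]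

/-- `Exec c S S' t`: started on the stacks `S`, the command `c` terminates with stacks `S'`, at
cost `t`. -/
inductive Exec : WCmd Γ → (∀ k, List (Γ k)) → (∀ k, List (Γ k)) → ℕ → Prop
  | skip S : Exec skip S S 1
  | push k a S : Exec (push k a) S (Function.update S k (a :: S k)) 1
  | pop k S : Exec (pop k) S (Function.update S k (S k).tail) 1
  | seq {c d S S' S'' t t'} : Exec c S S' t → Exec d S' S'' t' → Exec (seq c d) S S'' (t + t' + 1)
  | ite_true {k p c d S S' t} : p (S k).head? = true → Exec c S S' t → Exec (ite k p c d) S S' (t + 1)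
  | ite_false {k p c d S S' t} :
      p (S k).head? = false → Exec d S S' t → Exec (ite k p c d) S S' (t + 1)
  | loop_false {k p c S} : p (S k).head? = false → Exec (loop k p c) S S 1
  | loop_true {k p c S S' S'' t t'} : p (S k).head? = true → Exec c S S' t →
      Exec (loop k p c) S' S'' t' → Exec (loop k p c) S S'' (t + t' + 1)

end Exec

/-- The continuations reached in the execution of a command `c` that is followed by `κ`. -/
def conts : WCmd Γ → List (WCmd Γ) → Set (List (WCmd Γ))
  | seq c d, κ => {seq c d :: κ} ∪ (conts c (d :: κ) ∪ conts d κ)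
  | ite k p c d, κ => {ite k p c d :: κ} ∪ (conts c κ ∪ conts d κ)
  | loop k p c, κ => {loop k p c :: κ} ∪ conts c (loop k p c :: κ)
  | c, κ => {c :: κ}

theorem conts_finite (c : WCmd Γ) (κ : List (WCmd Γ)) : (conts c κ).Finite := by
  induction c generalizing κ <;> simp_all [conts]

theorem self_mem_conts (c : WCmd Γ) (κ : List (WCmd Γ)) : c :: κ ∈ conts c κ := by
  cases c <;> simp [conts]

/-- The possible successors of a continuation. -/
def succs : List (WCmd Γ) → List (List (WCmd Γ))
  | [] => []
  | seq c d :: κ => [c :: d :: κ]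
  | ite _ _ c d :: κ => [c :: κ, d :: κ]
  | loop k p c :: κ => [c :: loop k p c :: κ, κ]
  | _ :: κ => [κ]

/-- Execution stays among the continuations reached from `c` until it gets to `κ`. -/
theorem conts_closed (c : WCmd Γ) {κ l l' : List (WCmd Γ)} (hl : l ∈ conts c κ)
    (hl' : l' ∈ succs l) : l' ∈ conts c κ ∨ l' = κ := by
  induction c generalizing κ with
  | skip | push | pop =>
    simp only [conts, Set.mem_singleton_iff] at hl
    subst hl
    simp_all [succs]
  | seq c d ihc ihd =>
    rcases hl with rfl | hl | hl
    · simp only [succs, List.mem_singleton] at hl'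
      subst hl'
      exact Or.inl (Or.inr (Or.inl (self_mem_conts _ _)))
    · rcases ihc hl with h | rfl
      · exact Or.inl (Or.inr (Or.inl h))
      · exact Or.inl (Or.inr (Or.inr (self_mem_conts _ _)))
    · exact (ihd hl).imp_left fun h => Or.inr (Or.inr h)
  | ite k p c d ihc ihd =>
    rcases hl with rfl | hl | hl
    · simp only [succs, List.mem_cons, List.not_mem_nil, or_false] at hl'
      rcases hl' with rfl | rfl
      · exact Or.inl (Or.inr (Or.inl (self_mem_conts _ _)))
      · exact Or.inl (Or.inr (Or.inr (self_mem_conts _ _)))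
    · exact (ihc hl).imp_left fun h => Or.inr (Or.inl h)
    · exact (ihd hl).imp_left fun h => Or.inr (Or.inr h)
  | loop k p c ih =>
    rcases hl with rfl | hl
    · simp only [succs, List.mem_cons, List.not_mem_nil, or_false] at hl'
      rcases hl' with rfl | rfl
      · exact Or.inl (Or.inr (self_mem_conts _ _))
      · exact Or.inr rfl
    · rcases ih hl with h | rfl
      · exact Or.inl (Or.inr h)
      · exact Or.inl (Or.inl rfl)

/-- The labels of the Turing machine for `c`: the continuations reached from `c`. -/
def labels (c : WCmd Γ) : Set (List (WCmd Γ)) := insert [] (conts c [])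

theorem labels_finite (c : WCmd Γ) : (labels c).Finite := (conts_finite c []).insert []

theorem labels_closed (c : WCmd Γ) {l l' : List (WCmd Γ)} (hl : l ∈ labels c)
    (hl' : l' ∈ succs l) : l' ∈ labels c := by
  rcases hl with rfl | hl
  · simp [succs] at hl'
  · rcases conts_closed c hl hl' with h | rfl
    · exact Or.inr h
    · exact Or.inl rfl

/-- A command that is reached will, when it has been executed, pass on to a label. -/
theorem labels_tail (c₀ c : WCmd Γ) {κ : List (WCmd Γ)} (h : c :: κ ∈ labels c₀) :
    κ ∈ labels c₀ := by
  induction c generalizing κ with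
  | skip | push | pop => exact labels_closed c₀ h (by simp [succs])
  | seq c d ihc ihd => exact ihd (ihc (labels_closed c₀ h (by simp [succs])))
  | ite k p c d ihc ihd => exact ihc (labels_closed c₀ h (by simp [succs]))
  | loop k p c ih => exact labels_closed c₀ h (by simp [succs])

open Classical in
/-- The label for a continuation; the junk value for lists that are not reached does not occur. -/
noncomputable def label (c₀ : WCmd Γ) (κ : List (WCmd Γ)) : labels c₀ :=
  if h : κ ∈ labels c₀ then ⟨κ, h⟩ else ⟨[], Or.inl rfl⟩

theorem label_val {c₀ : WCmd Γ} {κ : List (WCmd Γ)} (h : κ ∈ labels c₀) :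
    (label c₀ κ).1 = κ := by simp [label, h]

/-- The statement of the Turing machine for `c₀` at a continuation. The finite memory is a single
bit, used for the outcome of a test and `false` otherwise. -/
noncomputable def toStmt (c₀ : WCmd Γ) : List (WCmd Γ) → TM2.Stmt Γ (labels c₀) Bool
  | [] => .halt
  | skip :: κ => .goto fun _ => label c₀ κ
  | push k a :: κ => .push k (fun _ => a) (.goto fun _ => label c₀ κ)
  | pop k :: κ => .pop k (fun v _ => v) (.goto fun _ => label c₀ κ)
  | seq c d :: κ => .goto fun _ => label c₀ (c :: d :: κ)
  | ite k p c d :: κ => .peek k (fun _ o => p o) (.branch id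
      (.load (fun _ => false) (.goto fun _ => label c₀ (c :: κ)))
      (.load (fun _ => false) (.goto fun _ => label c₀ (d :: κ))))
  | loop k p c :: κ => .peek k (fun _ o => p o) (.branch id
      (.load (fun _ => false) (.goto fun _ => label c₀ (c :: loop k p c :: κ)))
      (.load (fun _ => false) (.goto fun _ => label c₀ κ)))

variable [DecidableEq K]

/-- Each rule of the big-step semantics accounts for one step of the Turing machine. -/
theorem Exec.iterate_step {c₀ c : WCmd Γ} {S S' : ∀ k, List (Γ k)} {t : ℕ} (h : Exec c S S' t)
    {κ : List (WCmd Γ)} (hκ : c :: κ ∈ labels c₀) :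
    (flip bind (TM2.step fun l : labels c₀ => toStmt c₀ l.1))^[t]
      (some ⟨some (label c₀ (c :: κ)), false, S⟩) = some ⟨some (label c₀ κ), false, S'⟩ := by
  induction h generalizing κ with
  | skip | push | pop =>
    simp [flip, label_val hκ, toStmt]
  | seq h h' ih ih' =>
    have h1 := labels_closed c₀ hκ (List.mem_singleton_self _)
    have h2 := labels_tail c₀ _ h1
    rw [Function.iterate_succ_apply, Nat.add_comm, Function.iterate_add_apply]
    have := ih h1
    simp only [flip, Option.bind_eq_bind, Option.bind_some, TM2.step, label_val hκ, toStmt,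
      TM2.stepAux] at this ih' ⊢
    rw [this, ih' h2]
  | @ite_true k p c d S S' t hp h ih =>
    have h1 : c :: κ ∈ labels c₀ := labels_closed c₀ hκ (by simp [succs])
    rw [Function.iterate_succ_apply]
    have := ih h1
    simpa [flip, label_val hκ, toStmt, hp] using this
  | @ite_false k p c d S S' t hp h ih =>
    have h1 : d :: κ ∈ labels c₀ := labels_closed c₀ hκ (by simp [succs])
    rw [Function.iterate_succ_apply]
    have := ih h1
    simpa [flip, label_val hκ, toStmt, hp] using this
  | loop_false hp => simp [flip, label_val hκ, toStmt, hp]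
  | @loop_true k p c S S' S'' t t' hp h h' ih ih' =>
    have h1 : c :: loop k p c :: κ ∈ labels c₀ := labels_closed c₀ hκ (by simp [succs])
    rw [Function.iterate_succ_apply, Nat.add_comm, Function.iterate_add_apply]
    have := ih h1
    simp only [flip, Option.bind_eq_bind, Option.bind_some, TM2.step, label_val hκ, toStmt,
      TM2.stepAux, hp, id, cond_true] at this ih' ⊢
    rw [this, ih' hκ]

/-- The Turing machine for a command. -/
noncomputable def toFinTM2 [Fintype K] (c : WCmd Γ) (k₀ k₁ : K) [Fintype (Γ k₀)] : FinTM2 where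
  K := K
  k₀ := k₀
  k₁ := k₁
  Γ := Γ
  Λ := labels c
  main := label c [c]
  ΛFin := (labels_finite c).fintype
  σ := Bool
  initialState := false
  m l := toStmt c l.1

/-- The stacks of `initList` and `haltList` are given by an update. -/
theorem dite_eq_update (k₀ : K) (s : List (Γ k₀)) :
    (fun k => if h : k = k₀ then (by rw [h]; exact s : List (Γ k)) else []) =
      Function.update (fun _ => []) k₀ s := by
  funext k
  by_cases hk : k = k₀
  · subst hk; simp
  · simp [hk]

/-- A function is computable in polynomial time if some command computes it in polynomial time,
from the input on stack `k₀` to the output on stack `k₁`, leaving all other stacks empty. -/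
theorem computableInPolyTime [Fintype K] (c : WCmd Γ) (k₀ k₁ : K) [Fintype (Γ k₀)]
    {α β αΓ βΓ : Type} (ea : α → List αΓ) (eb : β → List βΓ) (f : α → β)
    (e₀ : Γ k₀ ≃ αΓ) (e₁ : Γ k₁ ≃ βΓ) (p : Polynomial ℕ)
    (h : ∀ a, ∃ t ≤ p.eval (ea a).length,
      Exec c (Function.update (fun _ => []) k₀ ((ea a).map e₀.symm))
        (Function.update (fun _ => []) k₁ ((eb (f a)).map e₁.symm)) t) :
    Nonempty (TM2ComputableInPolyTime ea eb f) := by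
  have key : ∀ a, Nonempty (TM2OutputsInTime (toFinTM2 c k₀ k₁) ((ea a).map e₀.symm)
      (some ((eb (f a)).map e₁.symm)) ((p + 1).eval (ea a).length)) := by
    intro a
    obtain ⟨t, ht, hE⟩ := h a
    have := hE.iterate_step (c₀ := c) (κ := []) (Or.inr (self_mem_conts _ _))
    -- one more step halts at the empty continuation
    refine ⟨⟨⟨t + 1, ?_⟩, by simpa using ht⟩⟩
    rw [Function.iterate_succ_apply']
    have e1 : initList (toFinTM2 c k₀ k₁) ((ea a).map e₀.symm) =
        ⟨some (label c [c]), false, Function.update (fun _ => []) k₀ ((ea a).map e₀.symm)⟩ :=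
      congrArg (TM2.Cfg.mk _ _) (dite_eq_update k₀ _)
    have e2 : haltList (toFinTM2 c k₀ k₁) ((eb (f a)).map e₁.symm) =
        ⟨none, false, Function.update (fun _ => []) k₁ ((eb (f a)).map e₁.symm)⟩ :=
      congrArg (TM2.Cfg.mk _ _) (dite_eq_update k₁ _)
    rw [e1, Option.map_some, e2]
    erw [this]
    change some (TM2.stepAux (toStmt c (label c []).1) _ _) = _
    rw [label_val (Or.inl rfl)]
    rfl
  exact ⟨{ tm := toFinTM2 c k₀ k₁
           inputAlphabet := e₀
           outputAlphabet := e₁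
           time := p + 1
           outputsFun := fun a => (key a).some }⟩

end WCmd
end RelComplexity

namespace RelComplexity

open Turing

/-! ### A clocked language with built-in polynomial running time -/

/-- Commands of a language on stacks of bits. A test `ite v o c d` compares the top of the stack
`v` with `o` (`none` stands for the empty stack). The only loop is `rep c`, which runs `c` exactly
`L` times, for a number `L` that is fixed during the whole execution. -/
inductive Cmd (V : Type) : Type
  | skip
  | push (v : V) (b : Bool)
  | pop (v : V)
  | clear (v : V)
  | seq (c d : Cmd V)
  | ite (v : V) (o : Option Bool) (c d : Cmd V)
  | rep (c : Cmd V)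

namespace Cmd

variable {V : Type}

/-- The effect of a command on the stacks, for a given number `L` of repetitions of loops. -/
def eval [DecidableEq V] (L : ℕ) : Cmd V → (V → List Bool) → V → List Bool
  | skip, S => S
  | push v b, S => Function.update S v (b :: S v)
  | pop v, S => Function.update S v (S v).tail
  | clear v, S => Function.update S v []
  | seq c d, S => eval L d (eval L c S)
  | ite v o c d, S => if (S v).head? = o then eval L c S else eval L d S
  | rep c, S => (eval L c)^[L] S

/-- The nesting depth of loops. -/
def depth : Cmd V → ℕ
  | seq c d => max c.depth d.depth
  | ite _ _ c d => max c.depth d.depth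
  | rep c => c.depth + 1
  | _ => 0

/-- A polynomial bound, in the number of repetitions of loops, for the amortized running time. The
potential is twice the total length of the stacks: a `clear`, which takes two steps for each symbol,
has been paid for by the pushes, whose cost is therefore `3`. -/
noncomputable def cost : Cmd V → Polynomial ℕ
  | skip => 1
  | push _ _ => 3
  | pop _ => 1
  | clear _ => 1
  | seq c d => c.cost + d.cost + 1
  | ite _ _ c d => c.cost + d.cost + 1
  | rep c => Polynomial.X * (c.cost + 9) + 3

/-- The stacks of the while program for a command: an input stack, the stacks of the command, and
two counters for each nesting depth of loops. -/
abbrev Stk (V : Type) (D : ℕ) : Type := Option (V ⊕ Fin D × Bool)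

/-- The alphabets of the stacks: the input is a word over `{0, 1, #}`. -/
abbrev Alph {V : Type} {D : ℕ} : Stk V D → Type
  | none => Option Bool
  | some _ => Bool

/-- The total length of the stacks of a command. -/
def size [Fintype V] (S : V → List Bool) : ℕ := ∑ v, (S v).length

theorem size_update [Fintype V] [DecidableEq V] (S : V → List Bool) (v : V) (l : List Bool) :
    size (Function.update S v l) + (S v).length = size S + l.length := by
  unfold size
  rw [← Finset.add_sum_erase _ _ (Finset.mem_univ v), ← Finset.add_sum_erase _ (fun w => (S w).length)
    (Finset.mem_univ v)]
  have : ∑ w ∈ Finset.univ.erase v, (Function.update S v l w).length =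
      ∑ w ∈ Finset.univ.erase v, (S w).length :=
    Finset.sum_congr rfl fun w hw => by rw [Function.update_of_ne (Finset.ne_of_mem_erase hw)]
  rw [this]
  simp
  omega

section Comp

variable {D : ℕ}

/-- The stacks of the while program, given the input, the stacks of the command and the
counters. -/
def join (I : List (Option Bool)) (S : V → List Bool) (C : Fin D × Bool → List Bool) :
    ∀ k : Stk V D, List (Alph k)
  | none => I
  | some (.inl v) => S v
  | some (.inr i) => C i

/-- The while loop that runs `c` as long as stack `k` is not empty. -/
def whileNonempty (k : Stk V D) (c : WCmd (Alph (V := V) (D := D))) : WCmd (Alph (V := V) (D := D)) :=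
  .loop k Option.isSome c

/-- The while program for a command. A loop moves the content of a counter, which is `L` symbols,
to an auxiliary counter, and then back, so that it can be executed again. -/
def comp (D : ℕ) : Cmd V → WCmd (Alph (V := V) (D := D))
  | skip => .skip
  | push v b => .push (some (.inl v)) b
  | pop v => .pop (some (.inl v))
  | clear v => whileNonempty (some (.inl v)) (.pop (some (.inl v)))
  | seq c d => .seq (comp D c) (comp D d)
  | ite v o c d => .ite (some (.inl v)) (fun a : Option Bool => decide (a = o)) (comp D c) (comp D d)
  | rep c =>
    -- there are enough counters in all uses; the other case is irrelevant
    if h : c.depth < D then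
      .seq
        (whileNonempty (some (.inr (⟨c.depth, h⟩, false)))
          (.seq (.pop (some (.inr (⟨c.depth, h⟩, false))))
            (.seq (.push (some (.inr (⟨c.depth, h⟩, true))) true) (comp D c))))
        (whileNonempty (some (.inr (⟨c.depth, h⟩, true)))
          (.seq (.pop (some (.inr (⟨c.depth, h⟩, true))))
            (.push (some (.inr (⟨c.depth, h⟩, false))) true)))
    else .skip

variable [DecidableEq V]

theorem update_join_none (I I' : List (Option Bool)) (S : V → List Bool)
    (C : Fin D × Bool → List Bool) :
    Function.update (join I S C) none I' = join I' S C := by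
  funext k
  rcases k with _ | k | k <;> simp [Function.update, join]

theorem update_join_inl (I : List (Option Bool)) (S : V → List Bool)
    (C : Fin D × Bool → List Bool) (v : V) (l : List Bool) :
    Function.update (join I S C) (some (.inl v)) l = join I (Function.update S v l) C := by
  funext k
  rcases k with _ | k | k
  · simp [join]
  · by_cases h : k = v
    · subst h; simp [join]
    · simp [join, h]
  · simp [join]

theorem update_join_inr (I : List (Option Bool)) (S : V → List Bool)
    (C : Fin D × Bool → List Bool) (i : Fin D × Bool) (l : List Bool) :
    Function.update (join I S C) (some (.inr i)) l = join I S (Function.update C i l) := by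
  funext k
  rcases k with _ | k | k
  · simp [join]
  · simp [join]
  · by_cases h : k = i
    · subst h; simp [join]
    · simp [join, h]

theorem exec_pop_inl (I : List (Option Bool)) (S : V → List Bool)
    (C : Fin D × Bool → List Bool) (v : V) :
    WCmd.Exec (.pop (some (.inl v))) (join I S C) (join I (Function.update S v (S v).tail) C) 1 := by
  rw [← update_join_inl]; exact .pop _ _

theorem exec_push_inl (I : List (Option Bool)) (S : V → List Bool)
    (C : Fin D × Bool → List Bool) (v : V) (b : Bool) :
    WCmd.Exec (.push (some (.inl v)) b) (join I S C) (join I (Function.update S v (b :: S v)) C) 1 := by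
  rw [← update_join_inl]; exact .push _ _ _

theorem exec_pop_inr (I : List (Option Bool)) (S : V → List Bool)
    (C : Fin D × Bool → List Bool) (i : Fin D × Bool) :
    WCmd.Exec (.pop (some (.inr i))) (join I S C) (join I S (Function.update C i (C i).tail)) 1 := by
  rw [← update_join_inr]; exact .pop _ _

theorem exec_push_inr (I : List (Option Bool)) (S : V → List Bool)
    (C : Fin D × Bool → List Bool) (i : Fin D × Bool) (b : Bool) :
    WCmd.Exec (.push (some (.inr i)) b) (join I S C) (join I S (Function.update C i (b :: C i))) 1 := by
  rw [← update_join_inr]; exact .push _ _ _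

theorem exec_pop_none (a : Option Bool) (I : List (Option Bool)) (S : V → List Bool)
    (C : Fin D × Bool → List Bool) :
    WCmd.Exec (.pop none) (join (a :: I) S C) (join I S C) 1 := by
  rw [← update_join_none (a :: I) I]; exact .pop _ _

theorem exec_whileNonempty_nil {k : Stk V D} {c : WCmd (Alph (V := V) (D := D))}
    {T : ∀ k : Stk V D, List (Alph k)} (h : T k = []) : WCmd.Exec (whileNonempty k c) T T 1 :=
  .loop_false (by simp [h])

theorem exec_whileNonempty_cons {k : Stk V D} {c : WCmd (Alph (V := V) (D := D))}
    {T T' T'' : ∀ k : Stk V D, List (Alph k)} {t t' : ℕ} (h : T k ≠ []) (hc : WCmd.Exec c T T' t)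
    (hw : WCmd.Exec (whileNonempty k c) T' T'' t') :
    WCmd.Exec (whileNonempty k c) T T'' (t + t' + 1) :=
  .loop_true (by simpa [← List.isSome_head?] using h) hc hw

theorem exec_while_pop (k : Stk V D) (T : ∀ k : Stk V D, List (Alph k)) :
    WCmd.Exec (whileNonempty k (.pop k)) T (Function.update T k []) (2 * (T k).length + 1) := by
  generalize h : T k = l
  induction l generalizing T with
  | nil =>
    have : Function.update T k [] = T := by rw [← h, Function.update_eq_self]
    rw [this]
    exact exec_whileNonempty_nil h
  | cons a l ih =>
    have h1 := ih (Function.update T k (T k).tail) (by simp [h])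
    rw [Function.update_idem] at h1
    have := exec_whileNonempty_cons (by simp [h]) (.pop k T) h1
    convert this using 1
    rw [List.length_cons]; omega

/-- The first half of a loop: the counter `i` drives the iteration of the loop body. -/
theorem exec_loop {c : WCmd (Alph (V := V) (D := D))} {f : (V → List Bool) → V → List Bool}
    [Fintype V] {B L : ℕ} (i : Fin D)
    (hc : ∀ (S : V → List Bool) (C : Fin D × Bool → List Bool),
      (∀ j, j < i → C (j, false) = List.replicate L true ∧ C (j, true) = []) →
      ∃ t, WCmd.Exec c (join [] S C) (join [] (f S) C) t ∧ t + 2 * size (f S) ≤ 2 * size S + B)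
    (n : ℕ) (S : V → List Bool) (C : Fin D × Bool → List Bool)
    (hC : ∀ j, j < i → C (j, false) = List.replicate L true ∧ C (j, true) = [])
    (hi : C (i, false) = List.replicate n true) :
    ∃ t, WCmd.Exec (whileNonempty (some (.inr (i, false)))
        (.seq (.pop (some (.inr (i, false)))) (.seq (.push (some (.inr (i, true))) true) c)))
      (join [] S C) (join [] (f^[n] S) (Function.update (Function.update C (i, false) []) (i, true)
        (List.replicate n true ++ C (i, true)))) t ∧
      t + 2 * size (f^[n] S) ≤ 2 * size S + n * (B + 5) + 1 := by
  induction n generalizing S C with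
  | zero =>
    refine ⟨1, ?_, by simp [Nat.add_comm]⟩
    have h1 : Function.update (Function.update C (i, false) []) (i, true)
        (List.replicate 0 true ++ C (i, true)) = C := by
      have : Function.update C (i, false) [] = C := by
        conv_rhs => rw [← Function.update_eq_self (i, false) C, hi]
        rfl
      rw [this]
      exact Function.update_eq_self _ _
    rw [h1]
    exact exec_whileNonempty_nil hi
  | succ n ih =>
    set C1 := Function.update C (i, false) (C (i, false)).tail with hC1
    set C2 := Function.update C1 (i, true) (true :: C1 (i, true)) with hC2
    have hlt : ∀ j, j < i → C2 (j, false) = List.replicate L true ∧ C2 (j, true) = [] := by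
      intro j hj
      have := hC j hj
      simpa [hC2, hC1, hj.ne] using this
    obtain ⟨t, ht, htB⟩ := hc S C2 hlt
    obtain ⟨t', ht', htB'⟩ := ih (f S) C2 hlt (by simp [hC2, hC1, hi, List.replicate_succ])
    have e := exec_whileNonempty_cons (k := some (.inr (i, false)))
      (by simp [join, hi, List.replicate_succ])
      ((exec_pop_inr [] S C (i, false)).seq ((exec_push_inr [] S C1 (i, true) true).seq ht)) ht'
    refine ⟨1 + (1 + t + 1) + 1 + t' + 1, ?_, ?_⟩
    · convert e using 1
      rw [Function.iterate_succ_apply]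
      congr 1
      funext k
      by_cases h1 : k = (i, true)
      · subst h1
        simp [hC2, hC1, List.replicate_succ']
      · by_cases h2 : k = (i, false)
        · subst h2; simp
        · simp [h1, h2, hC2, hC1]
    · rw [Function.iterate_succ_apply]
      linarith

/-- The second half of a loop: the counter `i` is restored. -/
theorem exec_restore (i : Fin D) (n : ℕ) (S : V → List Bool) (C : Fin D × Bool → List Bool)
    (hi : C (i, true) = List.replicate n true) :
    WCmd.Exec (whileNonempty (some (.inr (i, true)))
        (.seq (.pop (some (.inr (i, true)))) (.push (some (.inr (i, false))) true)))
      (join [] S C) (join [] S (Function.update (Function.update C (i, true) []) (i, false)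
        (List.replicate n true ++ C (i, false)))) (4 * n + 1) := by
  induction n generalizing C with
  | zero =>
    have h1 : Function.update (Function.update C (i, true) []) (i, false)
        (List.replicate 0 true ++ C (i, false)) = C := by
      have : Function.update C (i, true) [] = C := by
        conv_rhs => rw [← Function.update_eq_self (i, true) C, hi]
        rfl
      rw [this]
      exact Function.update_eq_self _ _
    rw [h1]
    exact exec_whileNonempty_nil hi
  | succ n ih =>
    set C1 := Function.update C (i, true) (C (i, true)).tail with hC1
    set C2 := Function.update C1 (i, false) (true :: C1 (i, false)) with hC2
    have e := exec_whileNonempty_cons (k := some (.inr (i, true)))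
      (by simp [join, hi, List.replicate_succ])
      ((exec_pop_inr [] S C (i, true)).seq (exec_push_inr [] S C1 (i, false) true))
      (ih C2 (by simp [hC2, hC1, hi, List.replicate_succ]))
    convert e using 1
    · congr 1
      funext k
      by_cases h1 : k = (i, false)
      · subst h1
        simp [hC2, hC1, List.replicate_succ']
      · by_cases h2 : k = (i, true)
        · subst h2; simp
        · simp [h1, h2, hC2, hC1]
    · ring

/-- The while program for a command has the effect of the command, and its amortized running time is
at most `cost`. The counters used by the command are full at the beginning and at the end. -/
theorem exec_comp [Fintype V] (L : ℕ) (c : Cmd V) (hD : c.depth ≤ D) (S : V → List Bool)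
    (C : Fin D × Bool → List Bool)
    (hC : ∀ j : Fin D, j < c.depth → C (j, false) = List.replicate L true ∧ C (j, true) = []) :
    ∃ t, WCmd.Exec (comp D c) (join [] S C) (join [] (eval L c S) C) t ∧
      t + 2 * size (eval L c S) ≤ 2 * size S + c.cost.eval L := by
  induction c generalizing S C with
  | skip => exact ⟨1, .skip _, by simp [eval, cost]; omega⟩
  | push v b =>
    refine ⟨1, exec_push_inl _ _ _ _ _, ?_⟩
    have := size_update S v (b :: S v)
    simp only [List.length_cons] at this
    simp only [eval, cost, Polynomial.eval_ofNat]
    omega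
  | pop v =>
    refine ⟨1, exec_pop_inl _ _ _ _, ?_⟩
    have := size_update S v (S v).tail
    simp only [List.length_tail] at this
    simp only [eval, cost, Polynomial.eval_one]
    omega
  | clear v =>
    refine ⟨2 * (S v).length + 1, ?_, ?_⟩
    · have := exec_while_pop (some (.inl v)) (join [] S C)
      rwa [update_join_inl] at this
    · have := size_update S v []
      simp only [List.length_nil] at this
      simp only [eval, cost, Polynomial.eval_one]
      omega
  | seq c d ihc ihd =>
    simp only [depth, max_le_iff] at hD
    obtain ⟨t, ht, hb⟩ := ihc hD.1 S C fun j hj => hC j (lt_of_lt_of_le hj (le_max_left _ _))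
    obtain ⟨t', ht', hb'⟩ := ihd hD.2 (eval L c S) C
      fun j hj => hC j (lt_of_lt_of_le hj (le_max_right _ _))
    refine ⟨_, ht.seq ht', ?_⟩
    simp only [eval, cost, Polynomial.eval_add, Polynomial.eval_one]
    omega
  | ite v o c d ihc ihd =>
    simp only [depth, max_le_iff] at hD
    by_cases h : (S v).head? = o
    · obtain ⟨t, ht, hb⟩ := ihc hD.1 S C fun j hj => hC j (lt_of_lt_of_le hj (le_max_left _ _))
      simp only [eval, if_pos h, cost, Polynomial.eval_add, Polynomial.eval_one]
      exact ⟨_, .ite_true (decide_eq_true (p := (S v).head? = o) h) ht, by omega⟩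
    · obtain ⟨t, ht, hb⟩ := ihd hD.2 S C fun j hj => hC j (lt_of_lt_of_le hj (le_max_right _ _))
      simp only [eval, if_neg h, cost, Polynomial.eval_add, Polynomial.eval_one]
      exact ⟨_, .ite_false (decide_eq_false (p := (S v).head? = o) h) ht, by omega⟩
  | rep c ih =>
    have hD' : c.depth < D := hD
    obtain ⟨h0, h1⟩ := hC ⟨c.depth, hD'⟩ (Nat.lt_succ_self _)
    obtain ⟨t, ht, hb⟩ := exec_loop (L := L) ⟨c.depth, hD'⟩
      (fun S C h => ih hD'.le S C fun j hj => h j hj) L S C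
      (fun j hj => hC j (Nat.lt_succ_of_lt hj)) h0
    rw [h1, List.append_nil] at ht
    have h2 := exec_restore (⟨c.depth, hD'⟩ : Fin D) L ((eval L c)^[L] S)
      (Function.update (Function.update C ((⟨c.depth, hD'⟩ : Fin D), false) [])
        ((⟨c.depth, hD'⟩ : Fin D), true)
        (List.replicate L true)) (Function.update_self _ _ _)
    refine ⟨t + (4 * L + 1) + 1, ?_, ?_⟩
    · rw [comp, dif_pos hD']
      convert ht.seq h2 using 1
      change join [] ((eval L c)^[L] S) C = _
      congr 1
      funext k
      by_cases e1 : k = (⟨c.depth, hD'⟩, false)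
      · subst e1; simp [h0]
      · by_cases e2 : k = (⟨c.depth, hD'⟩, true)
        · subst e2; simp [h1]
        · simp [e1, e2]
    · simp only [eval, cost, Polynomial.eval_add, Polynomial.eval_mul, Polynomial.eval_X,
        Polynomial.eval_ofNat]
      linarith

end Comp
end Cmd
end RelComplexity

namespace RelComplexity

open Turing

/-! ### Commands compute functions in polynomial time -/

namespace Cmd

variable {V : Type}

section Input

variable {D : ℕ}

/-- The program that pushes one symbol on the counters listed in `l`. -/
def pushCounters (l : List (Fin D)) : WCmd (Alph (V := V) (D := D)) :=
  l.foldr (fun i c => .seq (.push (some (.inr (i, false))) true) c) .skip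

/-- The effect of `pushCounters` on the counters. -/
def addCounters (l : List (Fin D)) (C : Fin D × Bool → List Bool) : Fin D × Bool → List Bool :=
  fun i => if i.1 ∈ l ∧ i.2 = false then true :: C i else C i

/-- The program that reads a word over `{0, 1}` from the input to the stack `v`, and runs `c` after
each symbol. -/
def readWord (v : V) (c : WCmd (Alph (V := V) (D := D))) : WCmd (Alph (V := V) (D := D)) :=
  .loop none (fun a : Option (Option Bool) => a.join.isSome)
    (.seq (.ite none (fun a : Option (Option Bool) => decide (a = some (some true)))
      (.push (some (.inl v)) true) (.push (some (.inl v)) false)) (.seq (.pop none) c))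

/-- The program that empties the stacks listed in `l`. -/
def clearAll (l : List (Stk V D)) : WCmd (Alph (V := V) (D := D)) :=
  l.foldr (fun k c => .seq (whileNonempty k (.pop k)) c) .skip

variable [DecidableEq V]

theorem exec_pushCounters {l : List (Fin D)} (hl : l.Nodup) (I : List (Option Bool))
    (S : V → List Bool) (C : Fin D × Bool → List Bool) :
    WCmd.Exec (pushCounters l) (join I S C) (join I S (addCounters l C)) (2 * l.length + 1) := by
  induction l generalizing C with
  | nil =>
    have : addCounters [] C = C := by funext i; simp [addCounters]
    rw [this]; exact .skip _
  | cons i l ih =>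
    rw [List.nodup_cons] at hl
    have := (exec_push_inr I S C (i, false) true).seq (ih hl.2 _)
    have hC : addCounters (i :: l) C =
        addCounters l (Function.update C (i, false) (true :: C (i, false))) := by
      funext ⟨j, b⟩
      by_cases hj : j = i
      · subst hj; cases b <;> simp [addCounters, hl.1]
      · simp [addCounters, hj]
    have ht : 2 * (i :: l).length + 1 = 1 + (2 * l.length + 1) + 1 := by
      rw [List.length_cons]; ring
    rw [hC, ht]
    exact this

theorem iterate_addCounters (n : ℕ) :
    (addCounters (List.finRange D))^[n] (fun _ => []) =
      fun i => if i.2 = false then List.replicate n true else [] := by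
  induction n with
  | zero => funext i; simp
  | succ n ih =>
    rw [Function.iterate_succ_apply', ih]
    funext ⟨j, b⟩
    cases b <;> simp [addCounters, List.replicate_succ]

theorem exec_readWord {v : V} {c : WCmd (Alph (V := V) (D := D))}
    {g : (Fin D × Bool → List Bool) → Fin D × Bool → List Bool} {t : ℕ}
    (hc : ∀ I S C, WCmd.Exec c (join I S C) (join I S (g C)) t)
    (l : List Bool) {I : List (Option Bool)} (hI : I.head?.join = none) (S : V → List Bool)
    (C : Fin D × Bool → List Bool) :
    WCmd.Exec (readWord v c) (join (l.map some ++ I) S C)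
      (join I (Function.update S v (l.reverse ++ S v)) (g^[l.length] C))
      (l.length * (t + 6) + 1) := by
  induction l generalizing S C with
  | nil =>
    have : Function.update S v (([] : List Bool).reverse ++ S v) = S := by simp
    rw [this, List.length_nil, Nat.zero_mul]
    exact WCmd.Exec.loop_false (k := (none : Stk V D)) (S := join I S C)
      (p := fun a : Option (Option Bool) => a.join.isSome)
      (show I.head?.join.isSome = false by simp [hI])
  | cons b l ih =>
    have h1 : WCmd.Exec (.ite none (fun a : Option (Option Bool) => decide (a = some (some true)))
        (.push (some (.inl v)) true) (.push (some (.inl v)) false))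
        (join ((b :: l).map some ++ I) S C)
        (join ((b :: l).map some ++ I) (Function.update S v (b :: S v)) C) 2 := by
      cases b
      · exact .ite_false rfl (exec_push_inl _ _ _ _ _)
      · exact .ite_true rfl (exec_push_inl _ _ _ _ _)
    have h2 := h1.seq ((exec_pop_none (some b) (l.map some ++ I) _ C).seq (hc _ _ _))
    have hS : (b :: l).reverse ++ S v =
        l.reverse ++ Function.update S v (b :: S v) v := by simp
    have ht : (b :: l).length * (t + 6) + 1 =
        (2 + (1 + t + 1) + 1) + (l.length * (t + 6) + 1) + 1 := by
      rw [List.length_cons]; ring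
    have hU (u : List Bool) : Function.update S v u =
        Function.update (Function.update S v (b :: S v)) v u := (Function.update_idem ..).symm
    rw [hS, ht, hU]
    exact WCmd.Exec.loop_true (by rfl) h2 (ih _ _)

open Classical in
theorem exec_clearAll {l : List (Stk V D)} (hl : l.Nodup) (T : ∀ k : Stk V D, List (Alph k)) :
    WCmd.Exec (clearAll l) T (fun k => if k ∈ l then [] else T k)
      ((l.map fun k => 2 * (T k).length + 2).sum + 1) := by
  induction l generalizing T with
  | nil => simpa [clearAll] using WCmd.Exec.skip T
  | cons k l ih =>
    rw [List.nodup_cons] at hl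
    have := (exec_while_pop k T).seq (ih hl.2 _)
    have hT : (fun k' => if k' ∈ k :: l then [] else T k') =
        fun k' => if k' ∈ l then [] else Function.update T k [] k' := by
      funext k'
      by_cases h : k' = k
      · subst h; simp
      · simp [h]
    have ht : (l.map fun k' => 2 * (Function.update T k [] k').length + 2) =
        l.map fun k' => 2 * (T k').length + 2 :=
      List.map_congr_left fun k' hk' => by
        have : k' ≠ k := by rintro rfl; exact hl.1 hk'
        rw [Function.update_of_ne this]
    rw [ht] at this
    rw [hT]
    refine cast ?_ this
    rw [List.map_cons, List.sum_cons]
    congr 1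
    ring

end Input

/-- The initial stacks for an input `(x, 0^m, r)`: the words `x` and `r` are reversed. -/
def inputState [DecidableEq V] (vx vm vr : V) (i : List Bool × ℕ × List Bool) : V → List Bool :=
  Function.update (Function.update (Function.update (fun _ => []) vx i.1.reverse)
    vm (List.replicate i.2.1 false)) vr i.2.2.reverse

/-- The whole while program for a command: read the input, set the counters to the length of the
last component of the input, run the command, and empty all stacks but the output. -/
noncomputable def program [Fintype V] [DecidableEq V] (c : Cmd V) (vx vm vr vo : V) :
    WCmd (Alph (V := V) (D := c.depth)) :=
  .seq (.seq (readWord vx .skip) (.seq (.pop none) (.seq (readWord vm .skip)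
    (.seq (.pop none) (readWord vr (pushCounters (List.finRange c.depth)))))))
  (.seq (comp c.depth c)
    (clearAll ((Finset.univ.erase (some (.inl vo) : Stk V c.depth)).toList)))

theorem eval_mono_nat (p : Polynomial ℕ) {a b : ℕ} (h : a ≤ b) : p.eval a ≤ p.eval b := by
  rw [Polynomial.eval_eq_sum_range, Polynomial.eval_eq_sum_range]
  gcongr

theorem size_inputState [Fintype V] [DecidableEq V] (vx vm vr : V)
    (i : List Bool × ℕ × List Bool) :
    size (inputState vx vm vr i) ≤ i.1.length + i.2.1 + i.2.2.length := by
  have h1 := size_update (fun _ => []) vx i.1.reverse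
  have h2 := size_update (Function.update (fun _ => []) vx i.1.reverse) vm
    (List.replicate i.2.1 false)
  have h3 := size_update (Function.update (Function.update (fun _ => []) vx i.1.reverse) vm
    (List.replicate i.2.1 false)) vr i.2.2.reverse
  have h0 : size (fun _ : V => []) = 0 := by simp [size]
  simp only [List.length_reverse, List.length_replicate, List.length_nil] at h1 h2 h3
  unfold inputState
  omega

theorem exec_readInput [DecidableEq V] {D : ℕ} {vx vm vr : V} (hxm : vm ≠ vx) (hxr : vr ≠ vx)
    (hmr : vr ≠ vm) (i : List Bool × ℕ × List Bool) :
    WCmd.Exec (.seq (readWord vx .skip) (.seq (.pop none) (.seq (readWord vm .skip)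
        (.seq (.pop none) (readWord vr (pushCounters (List.finRange D)))))))
      (join (encodeInput i) (fun _ => []) (fun _ => []))
      (join [] (inputState vx vm vr i)
        (fun j : Fin D × Bool => if j.2 = false then List.replicate i.2.2.length true else []))
      (7 * i.1.length + 7 * i.2.1 + (2 * D + 7) * i.2.2.length + 9) := by
  obtain ⟨x, m, r⟩ := i
  have hskip : ∀ I S (C : Fin D × Bool → List Bool),
      WCmd.Exec (Γ := Alph) .skip (join (V := V) I S C) (join I S (id C)) 1 := fun _ _ _ => .skip _
  have h1 := exec_readWord (v := vx) hskip x
    (I := none :: (List.replicate m (some false) ++ none :: r.map some)) rfl (fun _ => [])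
    (fun _ => [])
  have h2 := exec_readWord (v := vm) hskip (List.replicate m false)
    (I := none :: r.map some) rfl (Function.update (fun _ => []) vx (x.reverse ++ []))
    (fun _ => [])
  have hpush : ∀ I S (C : Fin D × Bool → List Bool),
      WCmd.Exec (pushCounters (List.finRange D)) (join (V := V) I S C)
        (join I S (addCounters (List.finRange D) C)) (2 * D + 1) := fun I S C => by
    have := exec_pushCounters (List.nodup_finRange D) I S C
    rwa [List.length_finRange] at this
  have h3 := exec_readWord (v := vr) hpush r (I := []) rfl
    (Function.update (Function.update (fun _ => []) vx (x.reverse ++ [])) vm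
      (List.replicate m false)) (fun _ => [])
  simp only [Function.iterate_id, id, List.map_replicate, List.reverse_replicate, List.append_nil,
    ne_eq, hxm, hxr, hmr, not_false_eq_true, Function.update_of_ne, List.length_replicate,
    iterate_addCounters] at h1 h2 h3
  have := h1.seq ((exec_pop_none _ _ _ _).seq (h2.seq ((exec_pop_none _ _ _ _).seq h3)))
  refine cast ?_ this
  congr 1
  dsimp only
  ring

/-- The function computed by a command is computable in polynomial time, when the last component of
the input serves as the clock. -/
theorem computable [Fintype V] [DecidableEq V] (c : Cmd V) {vx vm vr vo : V} (hxm : vm ≠ vx)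
    (hxr : vr ≠ vx) (hmr : vr ≠ vm) :
    Nonempty (TM2ComputableInPolyTime encodeInput (id : List Bool → List Bool)
      fun i => eval i.2.2.length c (inputState vx vm vr i) vo) := by
  classical
  set D := c.depth with hD
  refine WCmd.computableInPolyTime (program c vx vm vr vo) none (some (.inl vo)) encodeInput id _
    (Equiv.refl _) (Equiv.refl _)
    (Polynomial.C (6 * D + 9) * Polynomial.X + c.cost +
      Polynomial.C (2 * Fintype.card (Stk V D) + 12)) fun i => ?_
  set L := i.2.2.length with hL
  set C : Fin D × Bool → List Bool :=
    fun j => if j.2 = false then List.replicate L true else [] with hC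
  obtain ⟨t, ht, hb⟩ := exec_comp L c le_rfl (inputState vx vm vr i) C
    fun j _ => by simp [hC]
  set S' := eval L c (inputState vx vm vr i) with hS'
  set l := (Finset.univ.erase (some (.inl vo) : Stk V D)).toList with hl
  have hnd : l.Nodup := Finset.nodup_toList _
  have hmem (k : Stk V D) : k ∈ l ↔ k ≠ some (.inl vo) := by
    rw [hl, Finset.mem_toList, Finset.mem_erase]
    simp
  have h3 := exec_clearAll hnd (join [] S' C)
  have hsum : (l.map fun k => 2 * (join [] S' C k).length + 2).sum ≤
      2 * size S' + 4 * D * L + 2 * Fintype.card (Stk V D) := by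
    have h1 : (l.map fun k => 2 * (join [] S' C k).length + 2).sum =
        ∑ k ∈ Finset.univ.erase (some (.inl vo) : Stk V D),
          (2 * (join [] S' C k).length + 2) := Finset.sum_map_toList _ _
    have h2 : ∑ k ∈ Finset.univ.erase (some (.inl vo) : Stk V D),
        (2 * (join [] S' C k).length + 2) ≤ ∑ k : Stk V D, (2 * (join [] S' C k).length + 2) :=
      Finset.sum_le_sum_of_subset (Finset.erase_subset _ _)
    have h4 : ∑ k : Stk V D, (join [] S' C k).length ≤ size S' + 2 * D * L := by
      rw [Fintype.sum_option, Fintype.sum_sum_type]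
      have : ∑ j : Fin D × Bool, (C j).length ≤ ∑ _j : Fin D × Bool, L :=
        Finset.sum_le_sum fun j _ => by
          simp only [hC]; split_ifs <;> simp
      simp only [Finset.sum_const, Finset.card_univ, Fintype.card_prod, Fintype.card_fin,
        Fintype.card_bool, smul_eq_mul] at this
      simp only [join, List.length_nil, size]
      linarith
    rw [Finset.sum_add_distrib (s := Finset.univ), ← Finset.mul_sum, Finset.sum_const,
      Finset.card_univ, smul_eq_mul] at h2
    rw [h1]
    linarith
  have hlen : (encodeInput i).length = i.1.length + i.2.1 + L + 2 := by
    simp [encodeInput, hL]; ring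
  have hE := (exec_readInput (D := D) hxm hxr hmr i).seq (ht.seq h3)
  have e1 : join (encodeInput i) (fun _ => []) (fun _ => []) =
      (Function.update (fun _ => []) none
        ((encodeInput i).map (Equiv.refl (Option Bool)).symm) :
        ∀ k : Stk V D, List (Alph k)) := by
    have : (fun _ => [] : ∀ k : Stk V D, List (Alph k)) =
        join [] (fun _ => []) (fun _ => []) := by
      funext k; rcases k with _ | k | k <;> rfl
    rw [this, update_join_none]
    simp
  have e2 : (fun k => if k ∈ l then [] else join [] S' C k) =
      (Function.update (fun _ => []) (some (.inl vo))
        ((S' vo).map (Equiv.refl Bool).symm) : ∀ k : Stk V D, List (Alph k)) := by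
    funext k
    by_cases hk : k = some (.inl vo)
    · subst hk
      simp [hmem, join]
    · simp [hmem, hk]
  rw [e1, e2] at hE
  refine ⟨_, ?_, hE⟩
  have hs := size_inputState vx vm vr i
  have hm := eval_mono_nat c.cost (show L ≤ (encodeInput i).length by omega)
  simp only [Polynomial.eval_add, Polynomial.eval_mul, Polynomial.eval_C, Polynomial.eval_X]
  rw [hlen] at hm ⊢
  nlinarith [Nat.zero_le (D * i.1.length), Nat.zero_le (D * i.2.1), Nat.zero_le D]

end Cmd
end RelComplexity

namespace RelComplexity

/-! ### Subroutines of the clocked language -/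

namespace Cmd

infixr:60 " ;; " => Cmd.seq

variable {V : Type}

/-- `c` may change the stack `v`. -/
def writes [DecidableEq V] (v : V) : Cmd V → Bool
  | skip => false
  | push w _ => w = v
  | pop w => w = v
  | clear w => w = v
  | seq c d => writes v c || writes v d
  | ite _ _ c d => writes v c || writes v d
  | rep c => writes v c

/-- All stacks that occur in `c` satisfy `A`. -/
def uses (A : V → Bool) : Cmd V → Bool
  | skip => true
  | push w _ => A w
  | pop w => A w
  | clear w => A w
  | seq c d => uses A c && uses A d
  | ite w _ c d => A w && (uses A c && uses A d)
  | rep c => uses A c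

variable [DecidableEq V] {L : ℕ}

theorem eval_seq (c d : Cmd V) (S : V → List Bool) :
    eval L (c ;; d) S = eval L d (eval L c S) := rfl

/-- Used for symbolic execution of a sequence of commands. -/
theorem eval_seq_eq {c : Cmd V} {S S' : V → List Bool} (h : eval L c S = S') (d : Cmd V) :
    eval L (c ;; d) S = eval L d S' := by rw [eval_seq, h]

theorem eval_push (v : V) (b : Bool) (S : V → List Bool) :
    eval L (push v b) S = Function.update S v (b :: S v) := rfl

theorem eval_pop (v : V) (S : V → List Bool) :
    eval L (pop v) S = Function.update S v (S v).tail := rfl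

theorem eval_clear (v : V) (S : V → List Bool) :
    eval L (clear v) S = Function.update S v [] := rfl

theorem eval_skip (S : V → List Bool) : eval L skip S = S := rfl

theorem eval_ite_pos {v : V} {o : Option Bool} {c d : Cmd V} {S : V → List Bool}
    (h : (S v).head? = o) : eval L (ite v o c d) S = eval L c S := if_pos h

theorem eval_ite_neg {v : V} {o : Option Bool} {c d : Cmd V} {S : V → List Bool}
    (h : (S v).head? ≠ o) : eval L (ite v o c d) S = eval L d S := if_neg h

/-- A command does not change the stacks that it does not write to. -/
theorem eval_of_not_writes {v : V} {c : Cmd V} (h : c.writes v = false) (S : V → List Bool) :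
    eval L c S v = S v := by
  induction c generalizing S with
  | skip => rfl
  | push w b | pop w | clear w =>
    simp only [writes, decide_eq_false_iff_not] at h
    simp [eval, Ne.symm h]
  | seq c d ihc ihd =>
    simp only [writes, Bool.or_eq_false_iff] at h
    rw [eval, ihd h.2, ihc h.1]
  | ite w o c d ihc ihd =>
    simp only [writes, Bool.or_eq_false_iff] at h
    rw [eval]
    split_ifs
    · exact ihc h.1 S
    · exact ihd h.2 S
  | rep c ih =>
    simp only [writes] at h
    have : ∀ n S, (eval L c)^[n] S v = S v := by
      intro n
      induction n with
      | zero => exact fun S => rfl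
      | succ n ihn => exact fun S => by rw [Function.iterate_succ_apply, ihn, ih h]
    exact this L S

/-- Noninterference: stacks that do not occur in a command do not influence the others. -/
theorem eval_congr {A : V → Bool} {c : Cmd V} (h : c.uses A = true) {S S' : V → List Bool}
    (hS : ∀ v, A v → S v = S' v) (v : V) (hv : A v) : eval L c S v = eval L c S' v := by
  induction c generalizing S S' v with
  | skip => exact hS v hv
  | push w b | pop w | clear w =>
    simp only [eval, Function.update_apply, hS w h]
    split_ifs
    · rfl
    · exact hS v hv
  | seq c d ihc ihd =>
    simp only [uses, Bool.and_eq_true] at h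
    exact ihd h.2 (fun v hv => ihc h.1 hS v hv) v hv
  | ite w o c d ihc ihd =>
    simp only [uses, Bool.and_eq_true] at h
    simp only [eval, hS w h.1]
    split_ifs
    · exact ihc h.2.1 hS v hv
    · exact ihd h.2.2 hS v hv
  | rep c ih =>
    simp only [uses] at h
    have : ∀ n, ∀ v, A v → (eval L c)^[n] S v = (eval L c)^[n] S' v := by
      intro n
      induction n with
      | zero => exact hS
      | succ n ihn =>
        intro v hv
        rw [Function.iterate_succ_apply', Function.iterate_succ_apply']
        exact ih h ihn v hv
    exact this L v hv

/-- The effect of a loop, whose body reaches a fixed point `F 0 S = S` after `n` iterations. The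
states from which `n` iterations are needed are described by `P n`. -/
theorem eval_rep_eq {c : Cmd V} {P : ℕ → (V → List Bool) → Prop}
    {F : ℕ → (V → List Bool) → V → List Bool}
    (h0 : ∀ S, P 0 S → eval L c S = S ∧ F 0 S = S)
    (hs : ∀ n S, P (n + 1) S → P n (eval L c S) ∧ F n (eval L c S) = F (n + 1) S)
    {n : ℕ} (hn : n ≤ L) {S : V → List Bool} (h : P n S) : eval L (rep c) S = F n S := by
  have key : ∀ n S, P n S → ∀ j, (eval L c)^[j + n] S = F n S := by
    intro n
    induction n with
    | zero => exact fun S h j => (Function.iterate_fixed (h0 S h).1 _).trans (h0 S h).2.symm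
    | succ n ih =>
      intro S h j
      rw [← Nat.add_assoc, Function.iterate_succ_apply, ih _ (hs n S h).1, (hs n S h).2]
  have := key n S h (L - n)
  rwa [Nat.sub_add_cancel hn] at this

/-- A loop whose body reaches a fixed point `S'` after at most `L` iterations. -/
theorem eval_rep_of_iterate {c : Cmd V} {S S' : V → List Bool} {n : ℕ} (hn : n ≤ L)
    (h : (eval L c)^[n] S = S') (h' : eval L c S' = S') : eval L (rep c) S = S' := by
  have := Function.iterate_add_apply (eval L c) (L - n) n S
  rw [Nat.sub_add_cancel hn, h, Function.iterate_fixed h'] at this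
  exact this

/-- An invariant `I n` of a loop, with a counter `n` that decreases to `0` within `L` iterations. -/
theorem eval_rep_invariant {c : Cmd V} {I : ℕ → (V → List Bool) → Prop}
    (h0 : ∀ S, I 0 S → I 0 (eval L c S)) (hs : ∀ n S, I (n + 1) S → I n (eval L c S))
    {n : ℕ} (hn : n ≤ L) {S : V → List Bool} (h : I n S) : I 0 (eval L (rep c) S) := by
  have key : ∀ n S, I n S → ∀ j, I 0 ((eval L c)^[j + n] S) := by
    intro n
    induction n with
    | zero =>
      intro S h j
      induction j with
      | zero => exact h
      | succ j ih =>
        rw [Nat.add_zero, Function.iterate_succ_apply']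
        exact h0 _ ih
    | succ n ih =>
      intro S h j
      rw [← Nat.add_assoc, Function.iterate_succ_apply]
      exact ih _ (hs n S h) j
  have := key n S h (L - n)
  rwa [Nat.sub_add_cancel hn] at this

/-- An update that changes nothing. -/
theorem update_eq_of_eq {S : V → List Bool} {a : V} {l : List Bool} (h : S a = l) :
    Function.update S a l = S := by
  rw [← h, Function.update_eq_self]

/-- Move the ones on top of `a` to `b`. -/
def shift (a b : V) : Cmd V := rep (ite a (some true) (pop a ;; push b true) skip)

/-- Move the unary number on top of `a` to `b`. -/
def moveNum (a b : V) : Cmd V := push b false ;; shift a b ;; pop a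

/-- Remove the unary number on top of `a`. -/
def dropNum (a : V) : Cmd V := rep (ite a (some true) (pop a) skip) ;; pop a

/-- Move the content of `a` to `b`, in reverse order. -/
def move (a b : V) : Cmd V :=
  rep (ite a none skip (ite a (some true) (push b true ;; pop a) (push b false ;; pop a)))

/-- Move the content of `a` to `b` and to `c`, in reverse order. -/
def moveBoth (a b c : V) : Cmd V :=
  rep (ite a none skip (ite a (some true) (push b true ;; push c true ;; pop a)
    (push b false ;; push c false ;; pop a)))

/-- Put a copy of `a` on top of `b`, using `t`. -/
def copy (a b t : V) : Cmd V := move a t ;; moveBoth t a b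

/-- Compare the unary number on top of `a` with the number of symbols on `k`, using `t`. The answer
is put on `e`: one symbol for equality, none otherwise. -/
def compareNum (a k t e : V) : Cmd V :=
  clear e ;;
  rep (ite a (some true) (ite k (some true) (pop a ;; pop k ;; push t true) skip) skip) ;;
  ite a (some true) skip (ite k none (push e true) skip) ;;
  rep (ite t none skip (pop t ;; push a true ;; push k true))

theorem eval_shift {a b : V} (hab : a ≠ b) {n : ℕ} {A : List Bool} (hA : A.head? ≠ some true)
    (hn : n ≤ L) {S : V → List Bool} (hS : S a = List.replicate n true ++ A) :
    eval L (shift a b) S =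
      Function.update (Function.update S a A) b (List.replicate n true ++ S b) := by
  refine eval_rep_eq (P := fun n S => S a = List.replicate n true ++ A)
    (F := fun n S => Function.update (Function.update S a A) b (List.replicate n true ++ S b))
    ?_ ?_ hn hS
  · intro S h
    simp only [List.replicate_zero, List.nil_append] at h
    refine ⟨by simp [eval, h, hA], ?_⟩
    simp [← h]
  · intro n S h
    have h1 : eval L (ite a (some true) (pop a ;; push b true) skip) S =
        Function.update (Function.update S a (List.replicate n true ++ A)) b (true :: S b) := by
      simp [eval, h, List.replicate_succ, hab.symm]
    rw [h1]
    refine ⟨by simp [hab], ?_⟩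
    funext v
    simp only [Function.update_apply]
    split_ifs <;> simp_all [List.replicate_succ']

theorem eval_moveNum {a b : V} (hab : a ≠ b) {n : ℕ} {A : List Bool} (hn : n ≤ L)
    {S : V → List Bool} (hS : S a = encodeNat n ++ A) :
    eval L (moveNum a b) S =
      Function.update (Function.update S a A) b (encodeNat n ++ S b) := by
  have := eval_shift (L := L) hab (n := n) (A := false :: A) (by simp) hn
    (S := Function.update S b (false :: S b)) (by simp [hab, hS, encodeNat])
  change eval L (pop a) (eval L (shift a b) (Function.update S b (false :: S b))) = _
  rw [this]
  funext v
  simp only [eval, Function.update_apply]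
  split_ifs <;> simp_all [encodeNat]

theorem eval_dropNum {a : V} {n : ℕ} {A : List Bool} (hn : n ≤ L)
    {S : V → List Bool} (hS : S a = encodeNat n ++ A) :
    eval L (dropNum a) S = Function.update S a A := by
  have : eval L (rep (ite a (some true) (pop a) skip)) S = Function.update S a (false :: A) := by
    refine eval_rep_eq (P := fun n S => S a = encodeNat n ++ A)
      (F := fun n S => Function.update S a (false :: A)) ?_ ?_ hn hS
    · intro S h
      simp only [encodeNat, List.replicate_zero, List.nil_append, List.cons_append] at h
      refine ⟨by simp [eval, h], ?_⟩
      simp [← h]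
    · intro n S h
      have h1 : eval L (ite a (some true) (pop a) skip) S =
          Function.update S a (encodeNat n ++ A) := by
        simp [eval, h, encodeNat, List.replicate_succ]
      rw [h1]
      exact ⟨by simp, by simp⟩
  rw [dropNum, eval, this]
  simp [eval]

theorem eval_move {a b : V} (hab : a ≠ b) {S : V → List Bool} (hn : (S a).length ≤ L) :
    eval L (move a b) S =
      Function.update (Function.update S a []) b ((S a).reverse ++ S b) := by
  refine eval_rep_eq (P := fun n S => (S a).length = n)
    (F := fun n S => Function.update (Function.update S a []) b ((S a).reverse ++ S b))
    ?_ ?_ hn rfl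
  · intro S h
    rw [List.length_eq_zero_iff] at h
    refine ⟨by simp [eval, h], ?_⟩
    simp [h, update_eq_of_eq h]
  · intro n S h
    obtain ⟨x, l, hl⟩ := List.exists_cons_of_length_eq_add_one h
    have h1 : eval L (ite a none skip (ite a (some true) (push b true ;; pop a)
        (push b false ;; pop a))) S =
        Function.update (Function.update S b (x :: S b)) a l := by
      cases x <;> simp [eval, hl, hab]
    rw [h1]
    refine ⟨by simpa [hl] using h, ?_⟩
    funext v
    rcases eq_or_ne v b with rfl | hb
    · simp [hl, hab.symm]
    · rcases eq_or_ne v a with rfl | ha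
      · simp [hab]
      · simp [hb, ha]

theorem eval_moveBoth {a b c : V} (hab : a ≠ b) (hac : a ≠ c) (hbc : b ≠ c) {S : V → List Bool}
    (hn : (S a).length ≤ L) :
    eval L (moveBoth a b c) S =
      Function.update (Function.update (Function.update S a []) b ((S a).reverse ++ S b)) c
        ((S a).reverse ++ S c) := by
  refine eval_rep_eq (P := fun n S => (S a).length = n)
    (F := fun n S => Function.update (Function.update (Function.update S a []) b
      ((S a).reverse ++ S b)) c ((S a).reverse ++ S c)) ?_ ?_ hn rfl
  · intro S h
    rw [List.length_eq_zero_iff] at h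
    refine ⟨by simp [eval, h], ?_⟩
    simp [h, update_eq_of_eq h]
  · intro n S h
    obtain ⟨x, l, hl⟩ := List.exists_cons_of_length_eq_add_one h
    have h1 : eval L (ite a none skip (ite a (some true) (push b true ;; push c true ;; pop a)
        (push b false ;; push c false ;; pop a))) S =
        Function.update (Function.update (Function.update S b (x :: S b)) c (x :: S c)) a l := by
      cases x <;> simp [eval, hl, hab, hac, hbc.symm]
    rw [h1]
    refine ⟨by simpa [hl] using h, ?_⟩
    funext v
    rcases eq_or_ne v c with rfl | hc
    · simp [hl, hac.symm]
    · rcases eq_or_ne v b with rfl | hb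
      · simp [hl, hab.symm, hbc]
      · rcases eq_or_ne v a with rfl | ha
        · simp [hab, hac]
        · simp [hb, ha, hc]

theorem eval_copy {a b t : V} (hab : a ≠ b) (hat : a ≠ t) (hbt : b ≠ t) {S : V → List Bool}
    (hn : (S a).length ≤ L) (ht : S t = []) :
    eval L (copy a b t) S = Function.update S b (S a ++ S b) := by
  rw [copy, eval, eval_move hat hn, eval_moveBoth hat.symm hbt.symm hab (by simpa [ht] using hn)]
  funext v
  simp only [Function.update_apply]
  split_ifs <;> simp_all

theorem eval_compareNum {a k t e : V} (hak : a ≠ k) (hat : a ≠ t) (hae : a ≠ e) (hkt : k ≠ t)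
    (hke : k ≠ e) (hte : t ≠ e) {n i : ℕ} {A : List Bool} (hn : n ≤ L) {S : V → List Bool}
    (ha : S a = encodeNat n ++ A) (hk : S k = List.replicate i true) (ht : S t = []) :
    eval L (compareNum a k t e) S = Function.update S e (if n = i then [true] else []) := by
  -- the two numbers are `p + j` and `q + j`, where `p = 0` or `q = 0`
  obtain ⟨p, q, j, rfl, rfl, hpq⟩ : ∃ p q j, n = p + j ∧ i = q + j ∧ (p = 0 ∨ q = 0) :=
    ⟨n - min n i, i - min n i, min n i, by omega, by omega, by omega⟩
  have h1 : ∀ S, S a = encodeNat (p + j) ++ A → S k = List.replicate (q + j) true →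
      eval L (rep (ite a (some true) (ite k (some true) (pop a ;; pop k ;; push t true) skip) skip)) S
      = Function.update (Function.update (Function.update S a (encodeNat p ++ A)) k
        (List.replicate q true)) t (List.replicate j true ++ S t) := by
    intro S ha hk
    refine eval_rep_eq (n := j) (P := fun j S => S a = encodeNat (p + j) ++ A ∧
        S k = List.replicate (q + j) true)
      (F := fun j S => Function.update (Function.update (Function.update S a (encodeNat p ++ A)) k
        (List.replicate q true)) t (List.replicate j true ++ S t)) ?_ ?_ (by omega) ⟨ha, hk⟩
    · rintro S ⟨ha, hk⟩
      rw [Nat.add_zero] at ha hk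
      refine ⟨?_, by simp [← ha, ← hk]⟩
      rcases hpq with rfl | rfl
      · simp [eval, ha, encodeNat]
      · simp [eval, hk]
    · rintro j S ⟨ha, hk⟩
      have e : eval L (ite a (some true) (ite k (some true) (pop a ;; pop k ;; push t true) skip)
          skip) S = Function.update (Function.update (Function.update S a (encodeNat (p + j) ++ A))
          k (List.replicate (q + j) true)) t (true :: S t) := by
        rw [← Nat.add_assoc] at ha hk
        simp [eval, ha, hk, encodeNat, List.replicate_succ, hak.symm, hat.symm, hkt.symm]
      rw [e]
      refine ⟨by simp [hak, hat, hkt], ?_⟩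
      funext v
      rcases eq_or_ne v t with rfl | n1
      · simp [List.replicate_succ']
      · rcases eq_or_ne v k with rfl | n2
        · simp [n1]
        · rcases eq_or_ne v a with rfl | n3 <;> simp [*]
  have h2 : ∀ S, S t = List.replicate j true →
      eval L (rep (ite t none skip (pop t ;; push a true ;; push k true))) S =
      Function.update (Function.update (Function.update S t []) a (List.replicate j true ++ S a)) k
        (List.replicate j true ++ S k) := by
    intro S ht
    refine eval_rep_eq (n := j) (P := fun j S => S t = List.replicate j true)
      (F := fun j S => Function.update (Function.update (Function.update S t []) a
        (List.replicate j true ++ S a)) k (List.replicate j true ++ S k)) ?_ ?_ (by omega) ht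
    · intro S ht
      rw [List.replicate_zero] at ht
      exact ⟨by simp [eval, ht], by simp [update_eq_of_eq ht]⟩
    · intro j S ht
      have e : eval L (ite t none skip (pop t ;; push a true ;; push k true)) S =
          Function.update (Function.update (Function.update S t (List.replicate j true)) a
            (true :: S a)) k (true :: S k) := by
        simp [eval, ht, List.replicate_succ, hat, hak.symm, hkt]
      rw [e]
      refine ⟨by simp [hat.symm, hkt.symm], ?_⟩
      funext v
      rcases eq_or_ne v k with rfl | n1
      · simp [List.replicate_succ']
      · rcases eq_or_ne v a with rfl | n2
        · simp [n1, List.replicate_succ']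
        · rcases eq_or_ne v t with rfl | n3 <;> simp [*]
  have h3 : ∀ S, S a = encodeNat p ++ A → S k = List.replicate q true → S e = [] →
      eval L (ite a (some true) skip (ite k none (push e true) skip)) S =
      Function.update S e (if p + j = q + j then [true] else []) := by
    intro S ha hk he
    rcases p with _ | p
    · rcases q with _ | q
      · simp [eval, ha, hk, encodeNat, he]
      · simp [eval, ha, hk, encodeNat, List.replicate_succ, ← he]
    · obtain rfl : q = 0 := by omega
      simp [eval, ha, encodeNat, List.replicate_succ, ← he]
  change eval L (rep _) (eval L (ite _ _ _ _) (eval L (rep _) (Function.update S e []))) = _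
  rw [h1 _ (by simp [hae, ha]) (by simp [hke, hk]), h3, h2]
  · funext v
    rcases eq_or_ne v e with rfl | n1
    · simp [hae.symm, hke.symm, hte.symm]
    · rcases eq_or_ne v k with rfl | n2
      · simp [hk, n1, hkt, Nat.add_comm q]
      · rcases eq_or_ne v a with rfl | n3
        · simp [hak, hat, n1, ha, encodeNat, Nat.add_comm p]
          rw [List.replicate_add, List.append_assoc]
        · rcases eq_or_ne v t with rfl | n4
          · simp [ht, n1, n2, n3]
          · simp [n1, n2, n3, n4]
  · simp [hte, ht]
  · simp [hak, hat]
  · simp [hkt]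
  · simp [hae.symm, hke.symm, hte.symm]

end Cmd
end RelComplexity

namespace RelComplexity

/-! ### A universal machine as a command -/

/-- The stacks of the algorithm: the input `x`, `m`, `r`; the output `y`; the counter `w` that
enumerates the programs; the program `p` that is simulated; the rest `f` of the program from
the current instruction on; the program counter `pc`; the memory `mem`, and the part `mem2` of it that
has been searched; the key `key` of the search; the output `out` of the program; the rest are
auxiliary. -/
inductive Var : Type
  | x | m | r | y | w | p | f | pc | j | mem | mem2 | key | t | e | out | g | u | z | bad
  deriving DecidableEq

instance : Fintype Var where
  elems := {.x, .m, .r, .y, .w, .p, .f, .pc, .j, .mem, .mem2, .key, .t, .e, .out, .g, .u, .z, .bad}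
  complete v := by cases v <;> decide

namespace Cmd

/-- The concatenation of the codes of the numbers in a list. -/
def encodeNats (l : List ℕ) : List Bool := l.flatMap encodeNat

/-- The memory of the simulation is a list of pairs `(k, a)`, where the pairs with first component
`k` are the content of stack `k`. This is its code. -/
def encodeMem (μ : List (ℕ × ℕ)) : List Bool := encodeNats (μ.flatMap fun e => [e.1, e.2])

/-- The content of stack `k`. -/
def stackOf (μ : List (ℕ × ℕ)) (k : ℕ) : List ℕ := (μ.filter fun e => e.1 = k).map Prod.snd

/-- Read an operation code from the stack `f`, and branch. -/
def dispatch (c₀ c₁ c₂ c₃ c₄ : Cmd Var) : Cmd Var :=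
  ite .f (some true) (pop .f ;; ite .f (some true) (pop .f ;; ite .f (some true) (pop .f ;;
    ite .f (some true) (pop .f ;; pop .f ;; c₄)
    (pop .f ;; c₃)) (pop .f ;; c₂)) (pop .f ;; c₁)) (pop .f ;; c₀)

/-- Remove an instruction from the stack `f`. The code of the empty instruction list is put back. -/
def skipInstr : Cmd Var :=
  dispatch (dropNum .f ;; dropNum .f) (dropNum .f) (dropNum .f ;; dropNum .f ;; dropNum .f)
    (dropNum .f)
    (push .f false ;; push .f true ;; push .f true ;; push .f true ;; push .f true)

/-- Copy the program to the stack `f`, and go to the current instruction. -/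
def fetch : Cmd Var :=
  clear .f ;; clear .j ;; copy .p .f .t ;; copy .pc .j .t ;; rep (ite .j none skip (pop .j ;; skipInstr))

/-- Search the memory for a pair with first component `key`, moving the pairs before it to `mem2`. A
symbol is put on `e` if it is found. -/
def scan : Cmd Var :=
  clear .e ;; rep (ite .e none (ite .mem none skip (compareNum .mem .key .t .e ;;
    ite .e none (moveNum .mem .mem2 ;; moveNum .mem .mem2) skip)) skip)

/-- Go back to the beginning of the memory. -/
def restore : Cmd Var := rep (ite .mem2 none skip (moveNum .mem2 .mem))

/-- Read an operand of the current instruction. -/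
def loadKey : Cmd Var := clear .key ;; shift .f .key ;; pop .f

/-- Put a new pair at the beginning of the memory. The detour via `g` preserves its order. -/
def execPush : Cmd Var :=
  moveNum .f .g ;; moveNum .f .g ;; moveNum .g .mem ;; moveNum .g .mem ;; push .pc true

/-- Remove the first pair that belongs to the given stack. -/
def execPop : Cmd Var :=
  loadKey ;; scan ;; ite .e none skip (dropNum .mem ;; dropNum .mem) ;; restore ;; push .pc true

/-- Set the program counter to the operand. -/
def execGoto : Cmd Var := clear .pc ;; shift .f .pc

/-- Look up the first pair that belongs to the given stack, and jump if its symbol is the given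
one. -/
def execBranch : Cmd Var :=
  loadKey ;; scan ;; loadKey ;;
  ite .e none skip (moveNum .mem .mem2 ;; compareNum .mem .key .t .e) ;; restore ;;
  ite .e none (push .pc true) execGoto

/-- Simulate one step. -/
def step : Cmd Var := fetch ;; dispatch execPush execPop execBranch execGoto skip

variable {L : ℕ}

theorem encodeNat_length (a : ℕ) : (encodeNat a).length = a + 1 := by simp [encodeNat]

theorem eval_dispatch_zero {c₀ c₁ c₂ c₃ c₄ : Cmd Var} {S : Var → List Bool} {A : List Bool}
    (h : S .f = encodeNat 0 ++ A) :
    eval L (dispatch c₀ c₁ c₂ c₃ c₄) S = eval L c₀ (Function.update S .f A) := by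
  simp [dispatch, eval, h, encodeNat]

theorem eval_dispatch_one {c₀ c₁ c₂ c₃ c₄ : Cmd Var} {S : Var → List Bool} {A : List Bool}
    (h : S .f = encodeNat 1 ++ A) :
    eval L (dispatch c₀ c₁ c₂ c₃ c₄) S = eval L c₁ (Function.update S .f A) := by
  simp [dispatch, eval, h, encodeNat, List.replicate_succ]

theorem eval_dispatch_two {c₀ c₁ c₂ c₃ c₄ : Cmd Var} {S : Var → List Bool} {A : List Bool}
    (h : S .f = encodeNat 2 ++ A) :
    eval L (dispatch c₀ c₁ c₂ c₃ c₄) S = eval L c₂ (Function.update S .f A) := by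
  simp [dispatch, eval, h, encodeNat, List.replicate_succ]

theorem eval_dispatch_three {c₀ c₁ c₂ c₃ c₄ : Cmd Var} {S : Var → List Bool} {A : List Bool}
    (h : S .f = encodeNat 3 ++ A) :
    eval L (dispatch c₀ c₁ c₂ c₃ c₄) S = eval L c₃ (Function.update S .f A) := by
  simp [dispatch, eval, h, encodeNat, List.replicate_succ]

theorem eval_dispatch_four {c₀ c₁ c₂ c₃ c₄ : Cmd Var} {S : Var → List Bool} {A : List Bool}
    (h : S .f = encodeNat 4 ++ A) :
    eval L (dispatch c₀ c₁ c₂ c₃ c₄) S = eval L c₄ (Function.update S .f A) := by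
  simp [dispatch, eval, h, encodeNat, List.replicate_succ]

theorem eval_skipInstr_cons {i : Instr} {A : List Bool} {S : Var → List Bool}
    (h : S .f = i.encode ++ A) (hL : (S .f).length ≤ L) :
    eval L skipInstr S = Function.update S .f A := by
  rw [h] at hL
  cases i with
  | push k a =>
    simp only [Instr.encode, List.append_assoc, List.length_append, encodeNat_length] at h hL
    rw [skipInstr, eval_dispatch_zero h,
      eval_seq_eq (eval_dropNum (n := k) (A := encodeNat a ++ A) (by omega) (by simp)),
      eval_dropNum (n := a) (A := A) (by omega) (by simp)]
    simp
  | pop k =>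
    simp only [Instr.encode, List.append_assoc, List.length_append, encodeNat_length] at h hL
    rw [skipInstr, eval_dispatch_one h, eval_dropNum (n := k) (A := A) (by omega) (by simp)]
    simp
  | branch k a j =>
    simp only [Instr.encode, List.append_assoc, List.length_append, encodeNat_length] at h hL
    rw [skipInstr, eval_dispatch_two h,
      eval_seq_eq (eval_dropNum (n := k) (A := encodeNat a ++ (encodeNat j ++ A)) (by omega)
        (by simp)),
      eval_seq_eq (eval_dropNum (n := a) (A := encodeNat j ++ A) (by omega) (by simp)),
      eval_dropNum (n := j) (A := A) (by omega) (by simp)]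
    simp
  | goto j =>
    simp only [Instr.encode, List.append_assoc, List.length_append, encodeNat_length] at h hL
    rw [skipInstr, eval_dispatch_three h, eval_dropNum (n := j) (A := A) (by omega) (by simp)]
    simp

theorem eval_skipInstr_nil {A : List Bool} {S : Var → List Bool}
    (h : S .f = encodeCode [] ++ A) : eval L skipInstr S = S := by
  rw [skipInstr, eval_dispatch_four h]
  refine (?_ : _ = Function.update S .f (encodeCode [] ++ A)).trans (update_eq_of_eq h)
  simp [eval, encodeCode, encodeNat, List.replicate_succ]

theorem length_encodeCode_drop (M : List Instr) (n : ℕ) :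
    (encodeCode (M.drop n)).length ≤ (encodeCode M).length := by
  induction M generalizing n with
  | nil => simp
  | cons i M ih =>
    cases n with
    | zero => simp
    | succ n =>
      refine (ih n).trans ?_
      simp [encodeCode]

theorem eval_skipInstr {M : List Instr} {A : List Bool} {S : Var → List Bool}
    (h : S .f = encodeCode M ++ A) (hL : (S .f).length ≤ L) :
    eval L skipInstr S = Function.update S .f (encodeCode (M.drop 1) ++ A) := by
  cases M with
  | nil => rw [eval_skipInstr_nil h]; exact (update_eq_of_eq h).symm
  | cons i M =>
    rw [encodeCode, List.append_assoc] at h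
    exact eval_skipInstr_cons h hL

/-- The stack `f` holds the instruction list from the current instruction on. -/
theorem eval_fetch {M : List Instr} {d : List Bool} {n : ℕ} {S : Var → List Bool}
    (hp : S .p = encodeCode M ++ d) (hL : (S .p).length ≤ L) (hpc : S .pc = List.replicate n true)
    (hn : n ≤ L) (ht : S .t = []) :
    eval L fetch S =
      Function.update (Function.update S .j []) .f (encodeCode (M.drop n) ++ d) := by
  have h1 : eval L fetch S = eval L (rep (ite .j none skip (pop .j ;; skipInstr)))
      (Function.update (Function.update S .j (List.replicate n true)) .f (encodeCode M ++ d)) := by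
    rw [fetch, eval_seq, eval_clear, eval_seq, eval_clear, eval_seq,
      eval_copy (by decide) (by decide) (by decide) (by simpa using hL) (by simpa using ht),
      eval_seq, eval_copy (by decide) (by decide) (by decide) (by simpa [hpc] using hn) (by simpa using ht)]
    congr 1
    funext v
    cases v <;> simp [hp, hpc]
  rw [h1]
  refine (eval_rep_eq (n := n) (P := fun k S => k ≤ n ∧ S .j = List.replicate k true ∧
      S .f = encodeCode (M.drop (n - k)) ++ d)
    (F := fun k S => Function.update (Function.update S .j []) .f (encodeCode (M.drop n) ++ d))
    ?_ ?_ hn (by simp)).trans ?_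
  · rintro S ⟨-, hj, hf⟩
    refine ⟨by simp [eval, hj], ?_⟩
    rw [List.replicate_zero] at hj
    rw [update_eq_of_eq hj, update_eq_of_eq (by simpa using hf)]
  · rintro k S ⟨hk, hj, hf⟩
    have hlen : (S .f).length ≤ L := by
      have := length_encodeCode_drop M (n - (k + 1))
      rw [hp, List.length_append] at hL
      rw [hf, List.length_append]
      omega
    have e : eval L (ite .j none skip (pop .j ;; skipInstr)) S =
        Function.update (Function.update S .j (List.replicate k true)) .f
          (encodeCode (M.drop (n - k)) ++ d) := by
      have : n - k = n - (k + 1) + 1 := by omega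
      simp only [eval, hj, List.replicate_succ, List.head?_cons, reduceCtorEq, if_false,
        List.tail_cons]
      rw [eval_skipInstr (M := M.drop (n - (k + 1))) (A := d) (by simpa using hf)
        (by simpa using hlen), List.drop_drop, this]
    rw [e]
    refine ⟨⟨by omega, by simp, by simp⟩, ?_⟩
    funext v
    cases v <;> simp
  · funext v
    cases v <;> simp

theorem encodeNats_cons (a : ℕ) (l : List ℕ) :
    encodeNats (a :: l) = encodeNat a ++ encodeNats l := rfl

theorem encodeNats_append (l l' : List ℕ) :
    encodeNats (l ++ l') = encodeNats l ++ encodeNats l' := List.flatMap_append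

theorem encodeMem_cons (k a : ℕ) (μ : List (ℕ × ℕ)) :
    encodeMem ((k, a) :: μ) = encodeNat k ++ (encodeNat a ++ encodeMem μ) := by
  simp [encodeMem, encodeNats]

theorem length_le_length_encodeNats (l : List ℕ) : l.length ≤ (encodeNats l).length := by
  induction l with
  | nil => simp
  | cons a l ih => rw [encodeNats_cons, List.length_append, encodeNat_length, List.length_cons]; omega

theorem length_le_length_encodeMem (μ : List (ℕ × ℕ)) : μ.length ≤ (encodeMem μ).length := by
  induction μ with
  | nil => simp
  | cons e μ ih =>
    rw [encodeMem_cons, List.length_append, List.length_append, encodeNat_length, encodeNat_length,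
      List.length_cons]
    omega

/-- Moving numbers from one stack to another reverses their order. -/
theorem eval_restore {l : List ℕ} {S : Var → List Bool} (h : S .mem2 = encodeNats l)
    (hL : (S .mem2).length ≤ L) :
    eval L restore S = Function.update (Function.update S .mem2 []) .mem
      (encodeNats l.reverse ++ S .mem) := by
  refine eval_rep_of_iterate (n := l.length)
    ((length_le_length_encodeNats l).trans (by rwa [h] at hL)) ?_ (by simp [eval])
  induction l generalizing S with
  | nil =>
    rw [encodeNats, List.flatMap_nil] at h
    rw [update_eq_of_eq h, update_eq_of_eq (by simp [encodeNats])]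
    rfl
  | cons a l ih =>
    have hlen : (encodeNats (a :: l)).length ≤ L := by rwa [h] at hL
    rw [encodeNats_cons] at h
    rw [encodeNats_cons, List.length_append, encodeNat_length] at hlen
    have e : eval L (ite .mem2 none skip (moveNum .mem2 .mem)) S =
        Function.update (Function.update S .mem2 (encodeNats l)) .mem (encodeNat a ++ S .mem) := by
      rw [eval_ite_neg (by simp [h, encodeNat]),
        eval_moveNum (n := a) (A := encodeNats l) (by decide) (by omega) h]
    rw [List.length_cons, Function.iterate_succ_apply, e, ih (by simp) (by simp; omega)]
    funext v
    cases v <;> simp [encodeNats_append, encodeNats_cons]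
    simp [encodeNats]

/-- The part of the memory before the first pair with first component `i`. -/
def memBefore (i : ℕ) : List (ℕ × ℕ) → List (ℕ × ℕ)
  | [] => []
  | e :: μ => if e.1 = i then [] else e :: memBefore i μ

/-- The part of the memory from the first pair with first component `i` on. -/
def memFrom (i : ℕ) : List (ℕ × ℕ) → List (ℕ × ℕ)
  | [] => []
  | e :: μ => if e.1 = i then e :: μ else memFrom i μ

/-- The search stops at the first pair with first component `i`. -/
theorem eval_scan {μ : List (ℕ × ℕ)} {i : ℕ} {S : Var → List Bool} (hm : S .mem = encodeMem μ)
    (hL : (S .mem).length ≤ L) (hk : S .key = List.replicate i true) (ht : S .t = []) :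
    eval L scan S = Function.update (Function.update (Function.update S .mem
        (encodeMem (memFrom i μ))) .mem2
        (encodeNats ((memBefore i μ).flatMap fun e => [e.1, e.2]).reverse ++ S .mem2))
        .e (if memFrom i μ = [] then [] else [true]) := by
  rw [scan, eval_seq, eval_clear]
  obtain ⟨n, hn, h⟩ : ∃ n ≤ μ.length, (eval L (ite .e none (ite .mem none skip
      (compareNum .mem .key .t .e ;; ite .e none (moveNum .mem .mem2 ;; moveNum .mem .mem2) skip))
      skip))^[n] (Function.update S .e []) = Function.update (Function.update (Function.update S .mem
        (encodeMem (memFrom i μ))) .mem2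
        (encodeNats ((memBefore i μ).flatMap fun e => [e.1, e.2]).reverse ++ S .mem2))
        .e (if memFrom i μ = [] then [] else [true]) := by
    induction μ generalizing S with
    | nil =>
      refine ⟨0, le_rfl, ?_⟩
      funext v
      cases v <;> simp [hm, encodeNats, memFrom, memBefore]
    | cons e μ ih =>
      obtain ⟨k, a⟩ := e
      rw [encodeMem_cons] at hm
      have hlen := hL
      rw [hm, List.length_append, List.length_append, encodeNat_length, encodeNat_length] at hlen
      have h1 := eval_compareNum (L := L) (a := Var.mem) (k := .key) (t := .t) (e := .e) (by decide)
        (by decide) (by decide) (by decide) (by decide) (by decide) (n := k) (by omega)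
        (S := Function.update S .e []) (i := i) hm hk ht
      by_cases hki : k = i
      · refine ⟨1, by simp, ?_⟩
        rw [Function.iterate_one, eval_ite_pos (by simp),
          eval_ite_neg (by simp [hm, encodeNat, List.head?_append]), eval_seq_eq h1,
          eval_ite_neg (by simp [hki]), eval_skip]
        funext v
        cases v <;> simp [hki, hm, encodeNats, encodeMem_cons, memFrom, memBefore]
      · obtain ⟨n, hn, hn'⟩ := ih (S := Function.update (Function.update S .mem (encodeMem μ)) .mem2
          (encodeNat a ++ (encodeNat k ++ S .mem2))) (by simp) (by simp; omega) (by simpa using hk)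
          (by simpa using ht)
        refine ⟨n + 1, by simpa using hn, ?_⟩
        have e : eval L (ite .e none (ite .mem none skip (compareNum .mem .key .t .e ;;
            ite .e none (moveNum .mem .mem2 ;; moveNum .mem .mem2) skip)) skip)
            (Function.update S .e []) = Function.update (Function.update (Function.update S .mem
              (encodeMem μ)) .mem2 (encodeNat a ++ (encodeNat k ++ S .mem2))) .e [] := by
          rw [eval_ite_pos (by simp), eval_ite_neg (by simp [hm, encodeNat, List.head?_append]),
            eval_seq_eq h1, eval_ite_pos (by simp [hki]),
            eval_seq_eq (eval_moveNum (n := k) (A := encodeNat a ++ encodeMem μ) (by decide)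
              (by omega) (by simpa using hm)),
            eval_moveNum (n := a) (A := encodeMem μ) (by decide) (by omega) (by simp)]
          funext v
          cases v <;> simp [hki]
        rw [Function.iterate_succ_apply, e, hn']
        funext v
        cases v <;> simp [hki, encodeNats_append, memFrom, memBefore]
        simp [encodeNats]
  refine eval_rep_of_iterate (hn.trans ((length_le_length_encodeMem μ).trans (by rwa [hm] at hL))) h
    ?_
  by_cases hd : memFrom i μ = []
  · rw [eval_ite_pos (by simp [hd]), eval_ite_pos (by simp [hd, encodeMem, encodeNats]), eval_skip]
  · rw [eval_ite_neg (by simp [hd]), eval_skip]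

theorem eval_loadKey {n : ℕ} {A : List Bool} {S : Var → List Bool} (hf : S .f = encodeNat n ++ A)
    (hL : n ≤ L) : eval L loadKey S =
      Function.update (Function.update S .f A) .key (List.replicate n true) := by
  rw [loadKey, eval_seq_eq (eval_clear _ _),
    eval_seq_eq (eval_shift (n := n) (A := false :: A) (by decide) (by simp) hL
      (by simpa [encodeNat] using hf)), eval_pop]
  funext v
  cases v <;> simp

end Cmd
end RelComplexity

namespace RelComplexity

/-! ### The effect of single instructions -/

namespace Cmd

variable {L : ℕ}

theorem memBefore_append_memFrom (i : ℕ) (μ : List (ℕ × ℕ)) :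
    memBefore i μ ++ memFrom i μ = μ := by
  induction μ with
  | nil => rfl
  | cons e μ ih => by_cases h : e.1 = i <;> simp [memBefore, memFrom, h, ih]

theorem memFrom_eq (i : ℕ) (μ : List (ℕ × ℕ)) :
    memFrom i μ = [] ∨ ∃ a ν, memFrom i μ = (i, a) :: ν := by
  induction μ with
  | nil => exact Or.inl rfl
  | cons e μ ih =>
    by_cases h : e.1 = i
    · subst h
      exact Or.inr ⟨e.2, μ, by simp [memFrom]⟩
    · simpa [memFrom, h] using ih

theorem stackOf_cons (k a : ℕ) (μ : List (ℕ × ℕ)) :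
    stackOf ((k, a) :: μ) = Function.update (stackOf μ) k (a :: stackOf μ k) := by
  funext j
  by_cases h : j = k
  · subst h; simp [stackOf]
  · simp [stackOf, h, Ne.symm h]

theorem stackOf_append (μ ν : List (ℕ × ℕ)) (j : ℕ) :
    stackOf (μ ++ ν) j = stackOf μ j ++ stackOf ν j := by simp [stackOf]

theorem stackOf_memBefore (i : ℕ) (μ : List (ℕ × ℕ)) : stackOf (memBefore i μ) i = [] := by
  induction μ with
  | nil => rfl
  | cons e μ ih =>
    by_cases h : e.1 = i
    · simp [memBefore, h, stackOf]
    · rw [memBefore, if_neg h]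
      obtain ⟨k, a⟩ := e
      rw [stackOf_cons, Function.update_of_ne (Ne.symm h), ih]

/-- The top of a stack is found by the search. -/
theorem head?_stackOf (i : ℕ) (μ : List (ℕ × ℕ)) :
    (stackOf μ i).head? = (memFrom i μ).head?.map Prod.snd := by
  conv_lhs => rw [← memBefore_append_memFrom i μ, stackOf_append, stackOf_memBefore, List.nil_append]
  rcases memFrom_eq i μ with h | ⟨a, ν, h⟩
  · rw [h]; rfl
  · rw [h, stackOf_cons]; simp

/-- A stack is popped by removing the pair that is found by the search. -/
theorem stackOf_tail (i : ℕ) (μ : List (ℕ × ℕ)) :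
    stackOf (memBefore i μ ++ (memFrom i μ).tail) =
      Function.update (stackOf μ) i (stackOf μ i).tail := by
  funext j
  conv_rhs => rw [← memBefore_append_memFrom i μ]
  rw [stackOf_append]
  rcases memFrom_eq i μ with h | ⟨a, ν, h⟩ <;> rw [h]
  · by_cases hj : j = i
    · subst hj
      rw [List.tail_nil, Function.update_self, stackOf_append, stackOf_memBefore]
      rfl
    · rw [List.tail_nil, Function.update_of_ne hj, stackOf_append]
  · by_cases hj : j = i
    · subst hj; simp [stackOf_append, stackOf_memBefore, stackOf_cons]
    · simp [hj, stackOf_append, stackOf_cons]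

theorem encodeMem_append (μ ν : List (ℕ × ℕ)) :
    encodeMem (μ ++ ν) = encodeMem μ ++ encodeMem ν := by
  simp [encodeMem, encodeNats]

theorem length_memFrom_add (i : ℕ) (μ : List (ℕ × ℕ)) :
    (encodeMem (memBefore i μ)).length + (encodeMem (memFrom i μ)).length = (encodeMem μ).length := by
  rw [← List.length_append, ← encodeMem_append, memBefore_append_memFrom]

theorem encodeNats_length_reverse (l : List ℕ) :
    (encodeNats l.reverse).length = (encodeNats l).length := by
  induction l with
  | nil => rfl
  | cons a l ih =>
    rw [List.reverse_cons, encodeNats_append, encodeNats_cons, List.length_append, ih,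
      List.length_append, encodeNats_cons, List.length_append]
    simp [encodeNats]; omega

/-- After a search, `restore` puts the pairs before the one found back in place, together with the
numbers `l` that have been moved since then. -/
theorem eval_restore_memBefore {i : ℕ} {μ : List (ℕ × ℕ)} {l : List ℕ} {S : Var → List Bool}
    (h : S .mem2 = encodeNats (l ++ ((memBefore i μ).flatMap fun e => [e.1, e.2]).reverse))
    (hL : (S .mem2).length ≤ L) : eval L restore S = Function.update (Function.update S .mem2 [])
      .mem (encodeMem (memBefore i μ) ++ (encodeNats l.reverse ++ S .mem)) := by
  rw [eval_restore h hL, List.reverse_append, List.reverse_reverse, encodeNats_append,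
    List.append_assoc]
  rfl

theorem eval_execPush {k a n : ℕ} {A : List Bool} {S : Var → List Bool}
    (hf : S .f = encodeNat k ++ (encodeNat a ++ A)) (hk : k ≤ L) (ha : a ≤ L)
    (hpc : S .pc = List.replicate n true) :
    eval L execPush S = Function.update (Function.update (Function.update S .f A) .mem
      (encodeNat k ++ (encodeNat a ++ S .mem))) .pc (List.replicate (n + 1) true) := by
  rw [execPush, eval_seq_eq (eval_moveNum (by decide) hk hf),
    eval_seq_eq (eval_moveNum (n := a) (A := A) (by decide) ha (by simp)),
    eval_seq_eq (eval_moveNum (n := a) (A := encodeNat k ++ S .g) (by decide) ha (by simp)),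
    eval_seq_eq (eval_moveNum (n := k) (A := S .g) (by decide) hk (by simp)), eval_push]
  funext v
  cases v <;> simp [hpc, List.replicate_succ]

theorem eval_execGoto {j : ℕ} {A : List Bool} {S : Var → List Bool}
    (hf : S .f = encodeNat j ++ A) (hj : j ≤ L) : eval L execGoto S =
      Function.update (Function.update S .f (false :: A)) .pc (List.replicate j true) := by
  rw [execGoto, eval_seq_eq (eval_clear _ _),
    eval_shift (n := j) (A := false :: A) (by decide) (by simp) hj
      (by simpa [encodeNat] using hf)]
  funext v
  cases v <;> simp

theorem eval_execPop {k n : ℕ} {A : List Bool} {μ : List (ℕ × ℕ)} {S : Var → List Bool}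
    (hf : S .f = encodeNat k ++ A) (hk : k ≤ L) (hpc : S .pc = List.replicate n true)
    (hm : S .mem = encodeMem μ) (hL : (encodeMem μ).length ≤ L) (hm2 : S .mem2 = [])
    (ht : S .t = []) :
    ∃ key e, eval L execPop S = Function.update (Function.update (Function.update (Function.update
      (Function.update S .f A) .mem (encodeMem (memBefore k μ ++ (memFrom k μ).tail)))
      .pc (List.replicate (n + 1) true)) .key key) .e e := by
  have hlen := length_memFrom_add k μ
  rw [execPop, eval_seq_eq (eval_loadKey hf hk),
    eval_seq_eq (eval_scan (μ := μ) (i := k) (by simpa using hm) (by simpa [hm] using hL)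
      (by simp) (by simpa using ht))]
  rcases memFrom_eq k μ with h | ⟨b, ν, h⟩
  · rw [eval_seq_eq (eval_ite_pos (by simp [h])), eval_skip,
      eval_seq_eq (eval_restore_memBefore (l := []) (i := k) (μ := μ) (by simp [hm2]) ?_),
      eval_push]
    · refine ⟨List.replicate k true, [], ?_⟩
      funext v
      cases v <;> simp [hpc, List.replicate_succ, h, encodeNats, encodeMem, hm2]
    · simp only [Function.update_self, ne_eq, reduceCtorEq, not_false_eq_true,
        Function.update_of_ne, hm2, List.append_nil, encodeNats_length_reverse]
      have : (encodeMem (memBefore k μ)).length ≤ L := by omega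
      exact this
  · have hb : k + 1 + (b + 1 + (encodeMem ν).length) ≤ L := by
      rw [h, encodeMem_cons, List.length_append, List.length_append, encodeNat_length,
        encodeNat_length] at hlen
      omega
    rw [eval_seq_eq (eval_ite_neg (by simp [h])),
      eval_seq_eq (eval_dropNum (n := k) (A := encodeNat b ++ encodeMem ν) (by omega)
        (by simp [h, encodeMem_cons])),
      eval_dropNum (n := b) (A := encodeMem ν) (by omega) (by simp),
      eval_seq_eq (eval_restore_memBefore (l := []) (i := k) (μ := μ) (by simp [hm2]) ?_),
      eval_push]
    · refine ⟨List.replicate k true, [true], ?_⟩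
      funext v
      cases v <;> simp [hpc, List.replicate_succ, h, encodeNats, encodeMem, hm2]
    · simp only [Function.update_self, ne_eq, reduceCtorEq, not_false_eq_true,
        Function.update_of_ne, hm2, List.append_nil, encodeNats_length_reverse]
      have : (encodeMem (memBefore k μ)).length ≤ L := by omega
      exact this

theorem eval_execBranch {k a j n : ℕ} {A : List Bool} {μ : List (ℕ × ℕ)} {S : Var → List Bool}
    (hf : S .f = encodeNat k ++ (encodeNat a ++ (encodeNat j ++ A))) (hk : k ≤ L) (ha : a ≤ L)
    (hj : j ≤ L) (hpc : S .pc = List.replicate n true)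
    (hm : S .mem = encodeMem μ) (hL : (encodeMem μ).length ≤ L) (hm2 : S .mem2 = [])
    (ht : S .t = []) :
    ∃ f key e, eval L execBranch S = Function.update (Function.update (Function.update
      (Function.update S .f f) .pc (List.replicate (if (stackOf μ k).head? = some a then j else n + 1)
        true)) .key key) .e e := by
  have hlen := length_memFrom_add k μ
  have hμ := memBefore_append_memFrom k μ
  rw [execBranch, eval_seq_eq (eval_loadKey hf hk),
    eval_seq_eq (eval_scan (μ := μ) (i := k) (by simpa using hm) (by simpa [hm] using hL)
      (by simp) (by simpa using ht)),
    eval_seq_eq (eval_loadKey (n := a) (A := encodeNat j ++ A) (by simp) ha), head?_stackOf]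
  rcases memFrom_eq k μ with h | ⟨b, ν, h⟩
  · rw [eval_seq_eq (eval_ite_pos (by simp [h])), eval_skip,
      eval_seq_eq (eval_restore_memBefore (l := []) (i := k) (μ := μ) (by simp [hm2]) ?_),
      eval_ite_pos (by simp [h]), eval_push]
    · refine ⟨encodeNat j ++ A, List.replicate a true, [], ?_⟩
      rw [h, List.append_nil] at hμ
      funext v
      cases v <;> simp [hpc, List.replicate_succ, h, encodeNats, hμ, hm, hm2]
      simp [encodeMem, encodeNats]
    · simp only [Function.update_self, ne_eq, reduceCtorEq, not_false_eq_true,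
        Function.update_of_ne, hm2, List.append_nil, encodeNats_length_reverse]
      have : (encodeMem (memBefore k μ)).length ≤ L := by omega
      exact this
  · have hb : (encodeMem (memBefore k μ)).length + (k + 1 + (b + 1 + (encodeMem ν).length)) ≤ L := by
      rw [h, encodeMem_cons, List.length_append, List.length_append, encodeNat_length,
        encodeNat_length] at hlen
      omega
    rw [h] at hμ
    rw [eval_seq_eq (eval_ite_neg (by simp [h])),
      eval_seq_eq (eval_moveNum (n := k) (A := encodeNat b ++ encodeMem ν) (by decide) (by omega)
        (by simp [h, encodeMem_cons])),
      eval_compareNum (n := b) (i := a) (A := encodeMem ν) (by decide) (by decide) (by decide)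
        (by decide) (by decide) (by decide) (by omega) (by simp) (by simp) (by simpa using ht),
      eval_seq_eq (eval_restore_memBefore (l := [k]) (i := k) (μ := μ)
        (by simp [hm2, encodeNats]) ?_)]
    · by_cases hba : b = a
      · subst hba
        rw [eval_ite_neg (by simp), eval_execGoto (j := j) (A := A) (by simp) hj]
        refine ⟨false :: A, List.replicate b true, [true], ?_⟩
        funext v
        cases v <;> simp [h, hm2, hm, encodeNats]
        conv_rhs => rw [← hμ, encodeMem_append, encodeMem_cons]
      · rw [eval_ite_pos (by simp [hba]), eval_push]
        refine ⟨encodeNat j ++ A, List.replicate a true, [], ?_⟩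
        funext v
        cases v <;> simp [h, hm2, hm, encodeNats, hpc, hba, List.replicate_succ]
        conv_rhs => rw [← hμ, encodeMem_append, encodeMem_cons]
    · simp only [Function.update_self, ne_eq, reduceCtorEq, not_false_eq_true,
        Function.update_of_ne, hm2, List.append_nil, encodeNats_length_reverse, List.length_append,
        encodeNat_length]
      have : k + 1 + (encodeMem (memBefore k μ)).length ≤ L := by omega
      exact this

end Cmd
end RelComplexity

namespace RelComplexity

/-! ### Simulation of programs -/

namespace Cmd

variable {L : ℕ}

/-- The stacks `S` represent the configuration `c` of the machine whose program is `P`; the memory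
has length at most `B`. -/
structure Sim (P : List Bool) (c : Config) (B : ℕ) (S : Var → List Bool) : Prop where
  prog : S .p = P
  pc : S .pc = List.replicate c.pc true
  pc_le : c.pc ≤ P.length
  mem : ∃ μ, S .mem = encodeMem μ ∧ stackOf μ = c.stk ∧ (encodeMem μ).length ≤ B
  mem2 : S .mem2 = []
  tmp : S .t = []

theorem length_le_length_encodeCode (M : List Instr) : M.length + 5 ≤ (encodeCode M).length := by
  induction M with
  | nil => simp [encodeCode, encodeNat]
  | cons i M ih =>
    rw [encodeCode, List.length_append, List.length_cons]
    have : 1 ≤ i.encode.length := by cases i <;> simp [Instr.encode, encodeNat]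
    omega

theorem Sim.step {M : List Instr} {d : List Bool} {c : Config} {B : ℕ} {S : Var → List Bool}
    (h : Sim (encodeCode M ++ d) c B S) (hP : (encodeCode M ++ d).length ≤ L) (hB : B ≤ L) :
    (M[c.pc]? = none → Sim (encodeCode M ++ d) c B (eval L step S)) ∧
    ∀ i, M[c.pc]? = some i →
      Sim (encodeCode M ++ d) (i.exec c) (B + (encodeCode M ++ d).length) (eval L step S) := by
  obtain ⟨μ, hm, hμ, hμB⟩ := h.mem
  have hfetch := eval_fetch (L := L) h.prog (by rwa [h.prog]) h.pc (h.pc_le.trans hP) h.tmp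
  constructor
  · intro hi
    rw [List.getElem?_eq_none_iff] at hi
    rw [List.drop_eq_nil_of_le hi] at hfetch
    rw [Cmd.step, eval_seq_eq hfetch, eval_dispatch_four (A := d) (by simp [encodeCode]), eval_skip]
    exact ⟨by simp [h.prog], by simp [h.pc], h.pc_le, ⟨μ, by simp [hm], hμ, hμB⟩, by simp [h.mem2],
      by simp [h.tmp]⟩
  · intro i hi
    obtain ⟨hlt, hi'⟩ := List.getElem?_eq_some_iff.1 hi
    have hdrop : M.drop c.pc = i :: M.drop (c.pc + 1) := by
      rw [List.drop_eq_getElem_cons hlt, hi']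
    have hlen := length_encodeCode_drop M c.pc
    have hM := length_le_length_encodeCode M
    rw [hdrop, encodeCode, List.append_assoc] at hfetch
    rw [hdrop, encodeCode, List.length_append] at hlen
    rw [List.length_append] at hP
    set A := encodeCode (M.drop (c.pc + 1)) ++ d with hA
    have hpc1 : c.pc + 1 ≤ (encodeCode M ++ d).length := by
      rw [List.length_append]; omega
    rw [Cmd.step, eval_seq_eq hfetch]
    cases i with
    | push k a =>
      simp only [Instr.encode, List.length_append, encodeNat_length] at hlen
      rw [eval_dispatch_zero (A := encodeNat k ++ (encodeNat a ++ A)) (by simp [Instr.encode]),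
        eval_execPush (k := k) (a := a) (n := c.pc) (A := A) (by simp) (by omega) (by omega)
          (by simp [h.pc])]
      refine ⟨by simp [h.prog], by simp [Instr.exec], hpc1, ⟨(k, a) :: μ, by simp [hm, encodeMem_cons],
        by rw [stackOf_cons, hμ]; rfl, ?_⟩, by simp [h.mem2], by simp [h.tmp]⟩
      rw [encodeMem_cons]
      simp only [List.length_append, encodeNat_length]
      omega
    | pop k =>
      simp only [Instr.encode, List.length_append, encodeNat_length] at hlen
      rw [eval_dispatch_one (A := encodeNat k ++ A) (by simp [Instr.encode])]
      obtain ⟨key, e, he⟩ := eval_execPop (L := L) (k := k) (n := c.pc) (A := A) (μ := μ)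
        (S := Function.update (Function.update (Function.update S .j []) .f
          ((Instr.pop k).encode ++ A)) .f (encodeNat k ++ A))
        (by simp) (by omega) (by simp [h.pc]) (by simp [hm]) (hμB.trans hB) (by simp [h.mem2])
        (by simp [h.tmp])
      rw [he]
      refine ⟨by simp [h.prog], by simp [Instr.exec], hpc1,
        ⟨memBefore k μ ++ (memFrom k μ).tail, by simp, by rw [stackOf_tail, hμ]; rfl, ?_⟩,
        by simp [h.mem2], by simp [h.tmp]⟩
      have h1 := length_memFrom_add k μ
      rcases memFrom_eq k μ with h | ⟨b, ν, h⟩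
      · rw [h] at h1 ⊢
        rw [encodeMem_append]
        simp only [List.length_append, List.tail_nil]
        omega
      · rw [h] at h1 ⊢
        rw [encodeMem_append]
        rw [encodeMem_cons] at h1
        simp only [List.length_append, List.tail_cons] at h1 ⊢
        omega
    | branch k a j =>
      simp only [Instr.encode, List.length_append, encodeNat_length] at hlen
      rw [eval_dispatch_two (A := encodeNat k ++ (encodeNat a ++ (encodeNat j ++ A)))
        (by simp [Instr.encode])]
      obtain ⟨f, key, e, he⟩ := eval_execBranch (L := L) (k := k) (a := a) (j := j) (n := c.pc)
        (A := A) (μ := μ)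
        (S := Function.update (Function.update (Function.update S .j []) .f
          ((Instr.branch k a j).encode ++ A)) .f (encodeNat k ++ (encodeNat a ++ (encodeNat j ++ A))))
        (by simp) (by omega) (by omega) (by omega) (by simp [h.pc]) (by simp [hm]) (hμB.trans hB)
        (by simp [h.mem2]) (by simp [h.tmp])
      rw [he]
      refine ⟨by simp [h.prog], by simp [Instr.exec, hμ], ?_,
        ⟨μ, by simp [hm], hμ, by omega⟩, by simp [h.mem2], by simp [h.tmp]⟩
      simp only [Instr.exec]
      split_ifs
      · rw [List.length_append]; omega
      · exact hpc1
    | goto j =>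
      simp only [Instr.encode, List.length_append, encodeNat_length] at hlen
      rw [eval_dispatch_three (A := encodeNat j ++ A) (by simp [Instr.encode]),
        eval_execGoto (j := j) (A := A) (by simp) (by omega)]
      exact ⟨by simp [h.prog], by simp [Instr.exec], by simp [Instr.exec]; omega,
        ⟨μ, by simp [hm], hμ, by omega⟩, by simp [h.mem2], by simp [h.tmp]⟩

/-- Simulate as many steps as there are symbols on the stack `u`. -/
def runSteps : Cmd Var := rep (ite .u none skip (pop .u ;; step))

theorem HaltsIn_pos {M : List Instr} {c : Config} {y : List Bool} {t : ℕ} (h : HaltsIn M c y t) :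
    1 ≤ t := by cases h <;> omega

theorem Sim.runSteps {M : List Instr} {d y : List Bool} {n B : ℕ} (hn : n ≤ L)
    (hP : (encodeCode M ++ d).length ≤ L) {c : Config} {t : ℕ} {S : Var → List Bool}
    (h : Sim (encodeCode M ++ d) c B S) (hB : B + n * (encodeCode M ++ d).length ≤ L)
    (hu : (S .u).length = n) (hc : HaltsIn M c y t) (ht : t ≤ n + 1) :
    ∃ c' B', B' ≤ L ∧ Sim (encodeCode M ++ d) c' B' (eval L runSteps S) ∧
      c'.stk 1 = y.map Bool.toNat := by
  refine (eval_rep_invariant (c := ite .u none skip (pop .u ;; Cmd.step)) (I := fun n S => ∃ c t B, Sim (encodeCode M ++ d) c B S ∧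
      B + n * (encodeCode M ++ d).length ≤ L ∧ (S .u).length = n ∧ HaltsIn M c y t ∧ t ≤ n + 1)
    ?_ ?_ hn ⟨c, t, B, h, hB, hu, hc, ht⟩).elim
    (p := fun c => ∃ t B, Sim (encodeCode M ++ d) c B (eval L Cmd.runSteps S) ∧
      B + 0 * (encodeCode M ++ d).length ≤ L ∧ (eval L Cmd.runSteps S .u).length = 0 ∧
      HaltsIn M c y t ∧ t ≤ 0 + 1) ?_
  · rintro S ⟨c, t, B, h, hB, hu, hc, ht⟩
    rw [List.length_eq_zero_iff] at hu
    rw [eval_ite_pos (by simp [hu]), eval_skip]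
    exact ⟨c, t, B, h, hB, by simp [hu], hc, ht⟩
  · rintro n S ⟨c, t, B, h, hB, hu, hc, ht⟩
    obtain ⟨b, l, hl⟩ := List.exists_cons_of_length_eq_add_one hu
    rw [eval_ite_neg (by simp [hl]), eval_seq_eq (eval_pop _ _), hl, List.tail_cons]
    have h' : Sim (encodeCode M ++ d) c B (Function.update S .u l) :=
      ⟨h.prog, h.pc, h.pc_le, h.mem, h.mem2, h.tmp⟩
    have hu' : (eval L Cmd.step (Function.update S .u l) .u).length = n := by
      rw [eval_of_not_writes (by decide)]
      simpa [hl] using hu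
    rw [Nat.add_mul] at hB
    obtain ⟨h1, h2⟩ := h'.step (L := L) hP (by omega)
    cases hc with
    | halt _ _ hpc hy =>
      exact ⟨c, 1, B, h1 hpc, by omega, hu', .halt c y hpc hy, by omega⟩
    | step _ _ t i hi hc =>
      exact ⟨_, t, _, h2 i hi, by omega, hu', hc, by omega⟩
  · rintro c ⟨t, B, h, hB, hu, hc, ht⟩
    refine ⟨c, B, by omega, h, ?_⟩
    cases hc with
    | halt _ _ hpc hy => exact hy
    | step _ _ t i hi hc => have := HaltsIn_pos hc; omega

/-- Read the content of stack `1` off the memory, in reverse order. -/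
def extract : Cmd Var :=
  rep (ite .mem none skip (ite .mem (some true)
    (pop .mem ;; ite .mem (some true) (dropNum .mem ;; dropNum .mem)
      (pop .mem ;; ite .mem (some true) (push .out true) (push .out false) ;; dropNum .mem))
    (dropNum .mem ;; dropNum .mem)))

/-- Initialize the memory with the data bits on the stack `f`. -/
def loadData : Cmd Var :=
  move .f .g ;; rep (ite .g none skip (ite .g (some true)
    (pop .g ;; push .mem false ;; push .mem true ;; push .mem false)
    (pop .g ;; push .mem false ;; push .mem false)))

/-- Empty all stacks that the simulation uses, except for its inputs `p` and `m`. -/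
def clearAux : Cmd Var :=
  clear .f ;; clear .pc ;; clear .j ;; clear .mem ;; clear .mem2 ;; clear .key ;; clear .t ;;
  clear .e ;; clear .out ;; clear .g ;; clear .u

/-- The simulation, started with empty auxiliary stacks. The five `pop`s remove the end mark of the
instruction list. -/
def simulateFrom : Cmd Var :=
  copy .p .f .t ;; copy .m .u .t ;; rep skipInstr ;; pop .f ;; pop .f ;; pop .f ;; pop .f ;;
  pop .f ;; loadData ;; runSteps ;; extract

/-- Simulate the program `p` for as many steps as there are symbols on the stack `m`. -/
def simulate : Cmd Var := clearAux ;; simulateFrom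

/-- The output is the content of stack `1`, in reverse order. -/
theorem eval_extract {μ : List (ℕ × ℕ)} {y : List Bool} {S : Var → List Bool}
    (hm : S .mem = encodeMem μ) (hL : (encodeMem μ).length ≤ L)
    (hy : stackOf μ 1 = y.map Bool.toNat) (ho : S .out = []) :
    eval L extract S .out = y.reverse := by
  have key := eval_rep_invariant (L := L) (c := ite .mem none skip (ite .mem (some true)
    (pop .mem ;; ite .mem (some true) (dropNum .mem ;; dropNum .mem)
      (pop .mem ;; ite .mem (some true) (push .out true) (push .out false) ;; dropNum .mem))
    (dropNum .mem ;; dropNum .mem)))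
    (I := fun n S => ∃ μ z, List.length μ = n ∧ S .mem = encodeMem μ ∧ (encodeMem μ).length ≤ L ∧
      stackOf μ 1 = z.map Bool.toNat ∧ z.reverse ++ S .out = y.reverse)
    ?_ ?_ ((length_le_length_encodeMem μ).trans hL) (S := S) ⟨μ, y, rfl, hm, hL, hy, by simp [ho]⟩
  · obtain ⟨μ, z, hμ, -, -, hz, h⟩ := key
    rw [List.length_eq_zero_iff] at hμ
    subst hμ
    obtain rfl : z = [] := by simpa [stackOf] using hz.symm
    rw [List.reverse_nil, List.nil_append] at h
    exact h
  · rintro S ⟨μ, z, hμ, hm, h⟩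
    have hμ' := List.length_eq_zero_iff.1 hμ
    subst hμ'
    rw [eval_ite_pos (by simp [hm, encodeMem, encodeNats]), eval_skip]
    exact ⟨[], z, hμ, hm, h⟩
  · rintro n S ⟨μ, z, hμ, hm, hL, hz, h⟩
    obtain ⟨⟨k, a⟩, μ, rfl⟩ := List.exists_cons_of_length_eq_add_one hμ
    rw [encodeMem_cons] at hm hL
    simp only [List.length_append, encodeNat_length] at hL
    rw [stackOf_cons] at hz
    rw [eval_ite_neg (by simp [hm, encodeNat, List.head?_append])]
    have hμ' : μ.length = n := by simpa using hμ
    rcases k with _ | _ | k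
    · rw [eval_ite_neg (by simp [hm, encodeNat]),
        eval_seq_eq (eval_dropNum (by omega) hm),
        eval_dropNum (n := a) (A := encodeMem μ) (by omega) (by simp)]
      exact ⟨μ, z, hμ', by simp, by omega, by simpa using hz, by simpa using h⟩
    · rw [eval_ite_pos (by simp [hm, encodeNat]), eval_seq_eq (eval_pop _ _),
        eval_ite_neg (by simp [hm, encodeNat]), eval_seq_eq (eval_pop _ _)]
      rcases z with _ | ⟨b, z⟩
      · simp at hz
      · simp only [zero_add, Function.update_self, List.map_cons, List.cons.injEq] at hz
        obtain ⟨rfl, hz⟩ := hz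
        have hlast : ∀ S' : Var → List Bool, S' .mem = encodeNat b.toNat ++ encodeMem μ →
            S' .out = b :: S .out → ∃ (ν : List (ℕ × ℕ)) (z : List Bool), List.length ν = n ∧
              eval L (dropNum .mem) S' .mem = encodeMem ν ∧ (encodeMem ν).length ≤ L ∧
              stackOf ν 1 = z.map Bool.toNat ∧
              z.reverse ++ eval L (dropNum .mem) S' .out = y.reverse := by
          intro S' h1 h2
          rw [eval_dropNum (n := b.toNat) (A := encodeMem μ) (by omega) h1]
          exact ⟨μ, z, hμ', by simp, by omega, hz, by simpa [h2] using h⟩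
        cases b
        · rw [eval_seq_eq (eval_ite_neg (by simp [hm, encodeNat])), eval_push]
          exact hlast _ (by simp [hm, encodeNat]) (by simp)
        · rw [eval_seq_eq (eval_ite_pos (by simp [hm, encodeNat])), eval_push]
          exact hlast _ (by simp [hm, encodeNat]) (by simp)
    · rw [eval_ite_pos (by simp [hm, encodeNat, List.replicate_succ]), eval_seq_eq (eval_pop _ _),
        eval_ite_pos (by simp [hm, encodeNat, List.replicate_succ]),
        eval_seq_eq (eval_dropNum (n := k + 1) (A := encodeNat a ++ encodeMem μ) (by omega)
          (by simp [hm, encodeNat, List.replicate_succ])),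
        eval_dropNum (n := a) (A := encodeMem μ) (by omega) (by simp)]
      exact ⟨μ, z, hμ', by simp, by omega, by simpa using hz, by simpa using h⟩

theorem eval_loadData {d : List Bool} {S : Var → List Bool} (hf : S .f = d) (hL : d.length ≤ L)
    (hg : S .g = []) (hm : S .mem = []) : eval L loadData S =
      Function.update (Function.update S .f []) .mem
        (encodeMem (d.map fun b => (0, b.toNat))) := by
  rw [loadData, eval_seq_eq (eval_move (by decide) (by rwa [hf])), hf, hg, List.append_nil]
  refine (eval_rep_of_iterate (n := d.reverse.length) (by simpa using hL)
    (S' := Function.update (Function.update S .f []) .mem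
      (encodeMem (d.reverse.reverse.map fun b => (0, b.toNat)))) ?_
    (by rw [eval_ite_pos (by simp [hg]), eval_skip])).trans (by rw [List.reverse_reverse])
  have key : ∀ (l : List Bool) (S : Var → List Bool), S .g = l → (eval L (ite .g none skip (ite .g (some true)
      (pop .g ;; push .mem false ;; push .mem true ;; push .mem false)
      (pop .g ;; push .mem false ;; push .mem false))))^[l.length] S =
      Function.update (Function.update S .g []) .mem
        (encodeMem (l.reverse.map fun b => (0, b.toNat)) ++ S .mem) := by
    intro l
    induction l with
    | nil =>
      intro S hg
      rw [update_eq_of_eq hg, update_eq_of_eq (by simp [encodeMem, encodeNats])]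
      rfl
    | cons b l ih =>
      intro S hg
      have e : eval L (ite .g none skip (ite .g (some true)
          (pop .g ;; push .mem false ;; push .mem true ;; push .mem false)
          (pop .g ;; push .mem false ;; push .mem false))) S =
          Function.update (Function.update S .g l) .mem (encodeMem [(0, b.toNat)] ++ S .mem) := by
        cases b <;> simp [eval, hg, encodeMem, encodeNats, encodeNat]
      rw [List.length_cons, Function.iterate_succ_apply, e, ih _ (by simp)]
      funext v
      cases v <;> simp [encodeMem_append]
  rw [key d.reverse _ (by simp)]
  funext v
  cases v <;> simp [hm, hg]

theorem stackOf_data (d : List Bool) :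
    stackOf (d.map fun b => (0, b.toNat)) = (initConfig d).stk := by
  funext k
  by_cases h : k = 0
  · subst h
    simp only [stackOf, initConfig, Function.update_self]
    induction d <;> simp_all
  · simp only [stackOf, initConfig, Function.update_of_ne h]
    simp only [List.map_eq_nil_iff, List.filter_eq_nil_iff, List.mem_map]
    rintro _ ⟨b, -, rfl⟩
    simp [Ne.symm h]

/-- The number of steps is not changed by the simulation. -/
theorem eval_simulate_steps {S : Var → List Bool} (hp : (S .p).length ≤ L)
    (hm : (S .m).length ≤ L) : eval L simulate S .m = S .m := by
  obtain ⟨S₁, hS₁⟩ : ∃ S₁, S₁ = eval L clearAux S := ⟨_, rfl⟩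
  have ep : S₁ .p = S .p := by subst hS₁; simp [clearAux, eval]
  have em : S₁ .m = S .m := by subst hS₁; simp [clearAux, eval]
  have et : S₁ .t = [] := by subst hS₁; simp [clearAux, eval]
  rw [simulate, eval_seq_eq hS₁.symm, simulateFrom,
    eval_seq_eq (eval_copy (by decide) (by decide) (by decide) (by rwa [ep]) et),
    eval_seq_eq (eval_copy (by decide) (by decide) (by decide) (by simpa [em] using hm)
      (by simpa using et)), eval_of_not_writes (by decide)]
  simp [em]

theorem length_encodeMem_data (d : List Bool) :
    (encodeMem (d.map fun b => (0, b.toNat))).length ≤ 3 * d.length := by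
  induction d with
  | nil => simp [encodeMem, encodeNats]
  | cons b d ih =>
    rw [List.map_cons, encodeMem_cons]
    simp only [List.length_append, encodeNat_length, List.length_cons]
    have := Bool.toNat_le b
    omega

/-- Skipping instructions leads to the data bits. -/
theorem eval_rep_skipInstr {M : List Instr} {d : List Bool} {S : Var → List Bool}
    (hf : S .f = encodeCode M ++ d) (hL : (S .f).length ≤ L) :
    eval L (rep skipInstr) S = Function.update S .f (encodeCode [] ++ d) := by
  have hM := length_le_length_encodeCode M
  refine eval_rep_of_iterate (n := M.length) (by rw [hf, List.length_append] at hL; omega) ?_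
    (eval_skipInstr_nil (A := d) (by simp))
  clear hM
  induction M generalizing S with
  | nil => exact (update_eq_of_eq hf).symm
  | cons i M ih =>
    rw [encodeCode, List.append_assoc] at hf
    rw [List.length_cons, Function.iterate_succ_apply, eval_skipInstr_cons hf hL, ih (by simp)]
    · simp
    · rw [hf, List.length_append] at hL
      simp only [Function.update_self]
      omega

/-- The simulation is correct for programs that halt in time, if loops are long enough: the memory
grows by less than the length of the program in each step. -/
theorem eval_simulate {P y : List Bool} {m t : ℕ} {S : Var → List Bool} (hP : S .p = P)
    (hm : (S .m).length = m) (hpr : Prints P y t) (ht : t ≤ m + 1)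
    (hL : (m + 3) * (P.length + 1) ≤ L) : eval L simulate S .out = y.reverse := by
  obtain ⟨M, d, rfl, hc⟩ := hpr
  have hPL : (encodeCode M ++ d).length ≤ L := by nlinarith
  have hmL : m ≤ L := by nlinarith
  have hd : d.length ≤ (encodeCode M ++ d).length := by simp
  obtain ⟨S₁, hS₁⟩ : ∃ S₁, S₁ = eval L clearAux S := ⟨_, rfl⟩
  have h1 : S₁ = fun v => if v ∈ [Var.f, .pc, .j, .mem, .mem2, .key, .t, .e, .out, .g, .u] then []
      else S v := by
    funext v
    subst hS₁
    cases v <;> simp [clearAux, eval]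
  have ep : S₁ .p = encodeCode M ++ d := by rw [h1, ← hP]; rfl
  have em : (S₁ .m).length = m := by rw [h1, ← hm]; rfl
  have et : S₁ .t = [] := by rw [h1]; rfl
  have ef : S₁ .f = [] := by rw [h1]; rfl
  have eg : S₁ .g = [] := by rw [h1]; rfl
  have eu : S₁ .u = [] := by rw [h1]; rfl
  have eo : S₁ .out = [] := by rw [h1]; rfl
  have epc : S₁ .pc = [] := by rw [h1]; rfl
  have emem : S₁ .mem = [] := by rw [h1]; rfl
  have emem2 : S₁ .mem2 = [] := by rw [h1]; rfl
  rw [simulate, eval_seq_eq hS₁.symm, simulateFrom,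
    eval_seq_eq (eval_copy (by decide) (by decide) (by decide) (by rwa [ep]) et), ep, ef,
    List.append_nil,
    eval_seq_eq (eval_copy (by decide) (by decide) (by decide) (by simpa [em] using hmL)
      (by simpa using et)),
    eval_seq_eq (eval_rep_skipInstr (M := M) (d := d) (by simp) (by simpa using hPL)),
    eval_seq_eq (eval_pop _ _), eval_seq_eq (eval_pop _ _), eval_seq_eq (eval_pop _ _),
    eval_seq_eq (eval_pop _ _), eval_seq_eq (eval_pop _ _),
    eval_seq_eq (eval_loadData (d := d) (by simp [encodeCode, encodeNat]) (hd.trans hPL)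
      (by simpa using eg) (by simpa using emem))]
  obtain ⟨S₂, hS₂⟩ : ∃ S₂, S₂ = Function.update (Function.update (Function.update S₁ .f []) .mem
    (encodeMem (d.map fun b => (0, b.toNat)))) .u (S₁ .m) := ⟨_, rfl⟩
  have hsim : Sim (encodeCode M ++ d) (initConfig d) (3 * d.length) S₂ := by
    subst hS₂
    exact ⟨by simp [ep], by simp [epc, initConfig], Nat.zero_le _,
      ⟨_, by simp, stackOf_data d, length_encodeMem_data d⟩, by simp [emem2], by simp [et]⟩
  obtain ⟨c', B', hB', hsim', hy⟩ := hsim.runSteps (n := m) hmL hPL (by nlinarith)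
    (by subst hS₂; simpa using em) hc ht
  obtain ⟨μ, hμ, hstk, hlen⟩ := hsim'.mem
  refine (congrArg (fun S => eval L (Cmd.runSteps ;; extract) S .out) (?_ : _ = S₂)).trans ?_
  · subst hS₂
    funext v
    cases v <;> simp [ep, eu, encodeCode, encodeNat, List.replicate_succ]
  · rw [eval_seq]
    refine eval_extract hμ (hlen.trans hB') (by rw [hstk]; exact hy) ?_
    rw [eval_of_not_writes (by decide)]
    subst hS₂
    simpa using eo

end Cmd
end RelComplexity

namespace RelComplexity

/-! ### The search for an incompressible string -/

/-- The successor of a binary number of fixed length, with the least significant bit first. The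
successor of the greatest number is `0`. -/
def inc : List Bool → List Bool
  | [] => []
  | true :: l => false :: inc l
  | false :: l => true :: l

/-- The value of a binary number with the least significant bit first. -/
def binVal : List Bool → ℕ
  | [] => 0
  | b :: l => b.toNat + 2 * binVal l

theorem length_inc (l : List Bool) : (inc l).length = l.length := by
  induction l with
  | nil => rfl
  | cons b l ih => cases b <;> simp [inc, ih]

theorem length_iterate_inc (i : ℕ) (l : List Bool) : (inc^[i] l).length = l.length := by
  induction i with
  | zero => rfl
  | succ i ih => rw [Function.iterate_succ_apply', length_inc, ih]

theorem binVal_lt (l : List Bool) : binVal l < 2 ^ l.length := by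
  induction l with
  | nil => simp [binVal]
  | cons b l ih =>
    have := Bool.toNat_le b
    rw [List.length_cons, pow_succ, binVal]
    omega

theorem binVal_inc (l : List Bool) : binVal (inc l) = (binVal l + 1) % 2 ^ l.length := by
  induction l with
  | nil => rfl
  | cons b l ih =>
    have := binVal_lt l
    cases b
    · rw [inc, binVal, binVal, List.length_cons, pow_succ, Nat.mod_eq_of_lt]
      · simp [Nat.add_comm]
      · simp; omega
    · rw [inc, binVal, binVal, ih, List.length_cons, pow_succ, Nat.mul_comm (2 ^ l.length),
        show true.toNat + 2 * binVal l + 1 = 2 * (binVal l + 1) by simp; omega, Nat.mul_mod_mul_left]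
      simp

theorem binVal_injective {l l' : List Bool} (h : l.length = l'.length)
    (h' : binVal l = binVal l') : l = l' := by
  induction l generalizing l' with
  | nil => exact (List.length_eq_zero_iff.1 h.symm).symm
  | cons b l ih =>
    cases l' with
    | nil => simp at h
    | cons b' l' =>
      simp only [binVal] at h'
      simp only [List.length_cons, Nat.add_right_cancel_iff] at h
      have hb : b = b' := by cases b <;> cases b' <;> simp at h' ⊢ <;> omega
      subst hb
      rw [ih h (by omega)]

theorem binVal_iterate_inc (i : ℕ) (l : List Bool) :
    binVal (inc^[i] l) = (binVal l + i) % 2 ^ l.length := by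
  induction i with
  | zero => exact (Nat.mod_eq_of_lt (binVal_lt l)).symm
  | succ i ih =>
    rw [Function.iterate_succ_apply', binVal_inc, ih, length_iterate_inc, Nat.mod_add_mod,
      Nat.add_assoc]

/-- Every binary number is reached from every other one of the same length. -/
theorem exists_iterate_inc {l l' : List Bool} (h : l.length = l'.length) :
    ∃ i < 2 ^ l.length, inc^[i] l = l' := by
  have h1 := binVal_lt l
  have h2 := binVal_lt l'
  rw [← h] at h2
  refine ⟨(binVal l' + (2 ^ l.length - binVal l)) % 2 ^ l.length,
    Nat.mod_lt _ (by positivity), binVal_injective ((length_iterate_inc _ _).trans h) ?_⟩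
  rw [binVal_iterate_inc, Nat.add_mod_mod,
    show binVal l + (binVal l' + (2 ^ l.length - binVal l)) = binVal l' + 2 ^ l.length by omega,
    Nat.add_mod_right, Nat.mod_eq_of_lt h2]

theorem iterate_inc_injOn (l : List Bool) :
    Set.InjOn (fun i => inc^[i] l) (Set.Iio (2 ^ l.length)) := by
  intro i hi j hj h
  have := congrArg binVal h
  simp only [binVal_iterate_inc] at this
  exact (Nat.ModEq.add_left_cancel' (binVal l) this).eq_of_lt_of_lt hi hj

/-- The strings of length less than `h` are coded by the strings of length `h`: remove the leading
zeros and the first one. -/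
def strip (w : List Bool) : List Bool := (w.dropWhile fun b => !b).tail

theorem length_strip_le (w : List Bool) : (strip w).length ≤ w.length :=
  (by simp [strip] : (strip w).length ≤ (w.dropWhile fun b => !b).length).trans (List.length_dropWhile_le _ _)

theorem exists_strip_eq {h : ℕ} {P : List Bool} (hP : P.length < h) :
    ∃ w : List Bool, w.length = h ∧ strip w = P := by
  refine ⟨List.replicate (h - P.length - 1) false ++ true :: P, by simp; omega, ?_⟩
  rw [strip, List.dropWhile_append_of_pos (by simp)]
  rfl

namespace Cmd

variable {L : ℕ} {V : Type}

/-- Add one to the binary number `a`, using `t`. -/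
def increment (a t : V) : Cmd V :=
  clear t ;; rep (ite a (some true) (pop a ;; push t false) skip) ;;
  ite a (some false) (pop a ;; push a true) skip ;; move t a

theorem eval_increment [DecidableEq V] {a t : V} (hat : a ≠ t) {S : V → List Bool}
    (hL : (S a).length ≤ L) : eval L (increment a t) S =
      Function.update (Function.update S t []) a (inc (S a)) := by
  obtain ⟨n, A, hA, hS⟩ : ∃ n A, List.head? A ≠ some true ∧ S a = List.replicate n true ++ A := by
    generalize S a = l
    induction l with
    | nil => exact ⟨0, [], by simp, rfl⟩
    | cons b l ih =>
      cases b
      · exact ⟨0, false :: l, by simp, rfl⟩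
      · obtain ⟨n, A, hA, rfl⟩ := ih
        exact ⟨n + 1, A, hA, rfl⟩
  have hn : n ≤ L := by rw [hS] at hL; simp at hL; omega
  have hloop : ∀ (S : V → List Bool), S a = List.replicate n true ++ A →
      eval L (rep (ite a (some true) (pop a ;; push t false) skip)) S =
        Function.update (Function.update S a A) t (List.replicate n false ++ S t) := by
    intro S hS
    refine eval_rep_eq (P := fun n S => S a = List.replicate n true ++ A)
      (F := fun n S => Function.update (Function.update S a A) t (List.replicate n false ++ S t))
      ?_ ?_ hn hS
    · intro S h
      simp only [List.replicate_zero, List.nil_append] at h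
      refine ⟨by simp [eval, h, hA], ?_⟩
      simp [← h]
    · intro n S h
      have h1 : eval L (ite a (some true) (pop a ;; push t false) skip) S =
          Function.update (Function.update S a (List.replicate n true ++ A)) t (false :: S t) := by
        simp [eval, h, List.replicate_succ, hat.symm]
      rw [h1]
      refine ⟨by simp [hat], ?_⟩
      funext v
      rcases eq_or_ne v t with rfl | n1
      · simp [List.replicate_succ']
      · rcases eq_or_ne v a with rfl | n2 <;> simp [*]
  have hinc : inc (S a) = List.replicate n false ++ inc A := by
    rw [hS]
    clear hS hloop hn
    induction n with
    | zero => rfl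
    | succ n ih => rw [List.replicate_succ, List.cons_append, inc, ih]; rfl
  rw [hinc, increment, eval_seq_eq (eval_clear _ _), eval_seq_eq (hloop _ (by simpa [hat] using hS))]
  have hite : ∀ S : V → List Bool, S a = A →
      eval L (ite a (some false) (pop a ;; push a true) skip) S = Function.update S a (inc A) := by
    intro S h
    rcases A with _ | ⟨_ | _, A⟩
    · rw [eval_ite_neg (by simp [h]), eval_skip]; exact (update_eq_of_eq h).symm
    · simp [eval, h, inc]
    · simp at hA
  rw [eval_seq_eq (hite _ (by simp [hat])), eval_move hat.symm (by simpa [hat.symm] using hn)]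
  funext v
  rcases eq_or_ne v a with rfl | n1
  · simp [hat.symm]
  · rcases eq_or_ne v t with rfl | n2 <;> simp [*]

/-- Replace the content of the stack `a` by its image under `strip`. -/
def stripCmd (a : V) : Cmd V := rep (ite a (some false) (pop a) skip) ;; pop a

theorem eval_stripCmd [DecidableEq V] {a : V} {S : V → List Bool} (hL : (S a).length ≤ L) :
    eval L (stripCmd a) S = Function.update S a (strip (S a)) := by
  have h : eval L (rep (ite a (some false) (pop a) skip)) S =
      Function.update S a ((S a).dropWhile fun b => !b) := by
    obtain ⟨n, hn, h⟩ : ∃ n ≤ (S a).length, (eval L (ite a (some false) (pop a) skip))^[n] S =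
        Function.update S a ((S a).dropWhile fun b => !b) := by
      generalize hl : S a = l
      induction l generalizing S with
      | nil => exact ⟨0, le_rfl, (update_eq_of_eq hl).symm⟩
      | cons b l ih =>
        cases b
        · obtain ⟨n, hn, h⟩ := ih (S := Function.update S a l)
            (by simp [hl] at hL ⊢; omega) (by simp)
          refine ⟨n + 1, by simpa using hn, ?_⟩
          rw [Function.iterate_succ_apply, eval_ite_pos (by simp [hl]), eval_pop, hl,
            List.tail_cons, h]
          simp
        · exact ⟨0, Nat.zero_le _, (update_eq_of_eq hl).symm⟩
    refine eval_rep_of_iterate (hn.trans hL) h ?_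
    refine eval_ite_neg ?_
    have := List.head?_dropWhile_not (fun b : Bool => !b) (S a)
    simp only [Function.update_self]
    intro h
    simp [h] at this
  rw [stripCmd, eval_seq_eq h, eval_pop]
  simp [strip]


/-- Put a symbol on `e` if the contents of `a` and `b` are equal. Both may be changed. -/
def testEq (a b e : V) : Cmd V :=
  rep (ite a none skip (ite a (some true) (ite b (some true) (pop a ;; pop b) skip)
    (ite b (some false) (pop a ;; pop b) skip))) ;;
  ite a none (ite b none (push e true) skip) skip

theorem eval_testEq [DecidableEq V] {a b e : V} (hab : a ≠ b) (hae : a ≠ e) (hbe : b ≠ e)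
    {S : V → List Bool} (hL : (S a).length ≤ L) :
    ∃ A B, eval L (testEq a b e) S = Function.update (Function.update (Function.update S a A) b B) e
      (if S a = S b then true :: S e else S e) := by
  obtain ⟨A, B, h, hAB⟩ : ∃ A B, eval L (rep (ite a none skip (ite a (some true)
      (ite b (some true) (pop a ;; pop b) skip) (ite b (some false) (pop a ;; pop b) skip)))) S =
      Function.update (Function.update S a A) b B ∧ (S a = S b ↔ A = [] ∧ B = []) := by
    obtain ⟨n, hn, A, B, h, hAB, hfix⟩ : ∃ n ≤ (S a).length, ∃ A B, (eval L (ite a none skip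
        (ite a (some true) (ite b (some true) (pop a ;; pop b) skip)
        (ite b (some false) (pop a ;; pop b) skip))))^[n] S =
        Function.update (Function.update S a A) b B ∧ (S a = S b ↔ A = [] ∧ B = []) ∧
        (A = [] ∨ A.head? ≠ B.head?) := by
      generalize hl : S a = l
      induction l generalizing S with
      | nil =>
        refine ⟨0, le_rfl, [], S b, ?_, by simp [eq_comm], .inl rfl⟩
        rw [update_eq_of_eq hl, update_eq_of_eq rfl]
        rfl
      | cons x l ih =>
        by_cases hx : (S b).head? = some x
        · obtain ⟨l', hl'⟩ : ∃ l', S b = x :: l' := by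
            rcases h : S b with _ | ⟨x', l'⟩
            · simp [h] at hx
            · rw [h] at hx; exact ⟨l', by simpa using hx⟩
          obtain ⟨n, hn, A, B, h, h1, h2⟩ := ih (S := Function.update (Function.update S a l) b l')
            (by simp [hl, hab] at hL ⊢; omega) (by simp [hab])
          refine ⟨n + 1, by simpa using hn, A, B, ?_, by simpa [hl'] using h1, h2⟩
          have e : eval L (ite a none skip (ite a (some true)
              (ite b (some true) (pop a ;; pop b) skip)
              (ite b (some false) (pop a ;; pop b) skip))) S =
              Function.update (Function.update S a l) b l' := by
            cases x <;> simp [eval, hl, hl', hab.symm]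
          rw [Function.iterate_succ_apply, e, h]
          funext v
          rcases eq_or_ne v b with rfl | n1
          · simp
          · rcases eq_or_ne v a with rfl | n2 <;> simp [*]
        · refine ⟨0, Nat.zero_le _, x :: l, S b, ?_, ?_, .inr (by simpa using Ne.symm hx)⟩
          · rw [update_eq_of_eq hl, update_eq_of_eq rfl]
            rfl
          · constructor
            · intro h; simp [← h] at hx
            · simp
    refine ⟨A, B, eval_rep_of_iterate (hn.trans hL) h ?_, hAB⟩
    rcases A with _ | ⟨_ | _, A⟩
    · exact eval_ite_pos (by simp [hab])
    · simp only [eval]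
      rw [if_neg (by simp [hab]), if_neg (by simp [hab]), if_neg (by simpa [eq_comm] using hfix)]
    · simp only [eval]
      rw [if_neg (by simp [hab]), if_pos (by simp [hab]), if_neg (by simpa [eq_comm] using hfix)]
  refine ⟨A, B, ?_⟩
  rw [testEq, eval_seq_eq h]
  split_ifs with hS
  · obtain ⟨rfl, rfl⟩ := hAB.1 hS
    rw [eval_ite_pos (by simp [hab]), eval_ite_pos (by simp), eval_push]
    simp [hae.symm, hbe.symm]
  · rw [update_eq_of_eq (a := e) (by simp [hae.symm, hbe.symm])]
    by_cases hA : A = []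
    · rw [eval_ite_pos (by simp [hab, hA]), eval_ite_neg, eval_skip]
      simpa using fun hB => hS (hAB.2 ⟨hA, hB⟩)
    · rw [eval_ite_neg (by simp [hab, hA]), eval_skip]

end Cmd
end RelComplexity

namespace RelComplexity

/-! ### The algorithm -/

namespace Cmd

variable {L : ℕ}

/-- Replace the unary number `g` by its half. -/
def halve : Cmd Var :=
  rep (ite .g none skip (pop .g ;; ite .g none skip (pop .g ;; push .z false))) ;; move .z .g

/-- Compute the length `h = ⌊|x| / 2⌋ + 1` of the counter `w`, and `⌊m / 2 ^ (h - 1)⌋`. -/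
def setup : Cmd Var :=
  copy .x .u .t ;; copy .m .g .t ;; push .w false ;;
  rep (ite .u none skip (pop .u ;; ite .u none skip (pop .u ;; push .w false ;; halve)))

/-- Run the program with number `w`, and go to the next number. A symbol is put on the stack `bad`
if the program has output `y`. -/
def tryProgram : Cmd Var :=
  clear .p ;; clear .t ;; copy .w .p .t ;; stripCmd .p ;; simulate ;;
  clear .t ;; clear .z ;; moveBoth .y .t .z ;; move .t .y ;; testEq .z .out .bad ;;
  increment .w .t

/-- Go to the next string `y` if this one is the output of a program. -/
def tryNext : Cmd Var :=
  clear .bad ;; rep tryProgram ;; ite .bad none skip (increment .y .t)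

/-- Output as many random bits as there are symbols on the stack `x`. -/
def randomOutput : Cmd Var :=
  rep (ite .x none skip (pop .x ;; ite .r (some true) (pop .r ;; push .y true)
    (pop .r ;; push .y false)))

/-- Search for a string that is not the output of a program, starting from `0 ^ n`. -/
def bruteForce : Cmd Var := rep (ite .x none skip (pop .x ;; push .y false)) ;; rep tryNext

/-- The algorithm: output random bits if their error probability is small enough, and search
through all strings otherwise. -/
def main : Cmd Var := setup ;; ite .g none randomOutput bruteForce

theorem eval_halve {n : ℕ} {S : Var → List Bool} (hg : S .g = List.replicate n false)
    (hz : S .z = []) (hL : n ≤ L) :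
    eval L halve S = Function.update S .g (List.replicate (n / 2) false) := by
  have key : ∀ (n : ℕ) (S : Var → List Bool), S .g = List.replicate n false → ∃ k ≤ n,
      (eval L (ite .g none skip (pop .g ;; ite .g none skip (pop .g ;; push .z false))))^[k] S =
        Function.update (Function.update S .g []) .z (List.replicate (n / 2) false ++ S .z) := by
    intro n
    induction n using Nat.twoStepInduction with
    | zero =>
      intro S h
      refine ⟨0, le_rfl, ?_⟩
      rw [List.replicate_zero] at h
      rw [update_eq_of_eq h, update_eq_of_eq (by simp)]
      rfl
    | one =>
      intro S h
      refine ⟨1, le_rfl, ?_⟩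
      rw [Function.iterate_one, eval_ite_neg (by simp [h]), eval_seq_eq (eval_pop _ _),
        eval_ite_pos (by simp [h]), eval_skip, h, update_eq_of_eq (a := Var.z) (by simp)]
      rfl
    | more n ih _ =>
      intro S h
      obtain ⟨k, hk, ih⟩ := ih (Function.update (Function.update S .g (List.replicate n false)) .z
        (false :: S .z)) (by simp)
      refine ⟨k + 1, by omega, ?_⟩
      have e : eval L (ite .g none skip (pop .g ;; ite .g none skip (pop .g ;; push .z false))) S =
          Function.update (Function.update S .g (List.replicate n false)) .z (false :: S .z) := by
        simp [eval, h, List.replicate_succ]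
      rw [Function.iterate_succ_apply, e, ih]
      funext v
      cases v <;> simp [Nat.add_div_right, List.replicate_succ']
  obtain ⟨k, hk, h⟩ := key n S hg
  rw [halve, eval_seq_eq (eval_rep_of_iterate (hk.trans hL) h (eval_ite_pos (by simp))),
    eval_move (by decide) (by simp [hz]; omega)]
  funext v
  cases v <;> simp [hz]

theorem eval_setup {n m : ℕ} {x r : List Bool} (hx : x.length = n) (hn : n ≤ L) (hm : m ≤ L) :
    eval L setup (inputState .x .m .r (x, m, r)) =
      Function.update (Function.update (inputState .x .m .r (x, m, r)) .w
        (List.replicate (n / 2 + 1) false)) .g (List.replicate (m / 2 ^ (n / 2)) false) := by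
  obtain ⟨S, hS⟩ : ∃ S, S = inputState Var.x .m .r (x, m, r) := ⟨_, rfl⟩
  have e : ∀ v, S v = if v = .x then x.reverse else if v = .m then List.replicate m false else
      if v = .r then r.reverse else [] := by
    subst hS
    intro v
    cases v <;> rfl
  rw [← hS]
  have key : ∀ (n : ℕ) (l : List Bool) (m : ℕ) (S : Var → List Bool), List.length l = n → S .u = l → S .g = List.replicate m false → S .z = [] →
      m ≤ L → ∃ k ≤ n,
      (eval L (ite .u none skip (pop .u ;; ite .u none skip (pop .u ;; push .w false ;; halve))))^[k]
        S = Function.update (Function.update (Function.update S .u [])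
          .w (List.replicate (n / 2) false ++ S .w))
          .g (List.replicate (m / 2 ^ (n / 2)) false) := by
    intro n
    induction n using Nat.twoStepInduction with
    | zero =>
      intro l m S hl hu hg hz hm
      rw [List.length_eq_zero_iff] at hl
      refine ⟨0, le_rfl, ?_⟩
      rw [update_eq_of_eq (hu.trans hl), update_eq_of_eq (a := Var.w) (by simp),
        update_eq_of_eq (a := Var.g) (hg.trans (by simp))]
      rfl
    | one =>
      intro l m S hl hu hg hz hm
      obtain ⟨b, rfl⟩ := List.length_eq_one_iff.1 hl
      refine ⟨1, le_rfl, ?_⟩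
      rw [Function.iterate_one, eval_ite_neg (by simp [hu]), eval_seq_eq (eval_pop _ _),
        eval_ite_pos (by simp [hu]), eval_skip, hu, update_eq_of_eq (a := Var.w) (by simp),
        update_eq_of_eq (a := Var.g) (by simp [hg])]
      rfl
    | more n ih _ =>
      intro l m S hl hu hg hz hm
      rcases l with _ | ⟨b, _ | ⟨b', l⟩⟩
      iterate 2 simp at hl
      obtain ⟨k, hk, ih⟩ := ih l (m / 2) (Function.update (Function.update (Function.update S .u l)
        .w (false :: S .w)) .g (List.replicate (m / 2) false)) (by simpa using hl) (by simp)
        (by simp) (by simpa using hz) ((Nat.div_le_self m 2).trans hm)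
      refine ⟨k + 1, by omega, ?_⟩
      rw [Function.iterate_succ_apply, eval_ite_neg (by simp [hu]), eval_seq_eq (eval_pop _ _),
        eval_ite_neg (by simp [hu]), eval_seq_eq (eval_pop _ _), eval_seq_eq (eval_push _ _ _),
        eval_halve (n := m) (by simpa using hg) (by simpa using hz) hm]
      refine (congrArg _ (?_ : _ = Function.update (Function.update (Function.update S .u l)
        .w (false :: S .w)) .g (List.replicate (m / 2) false))).trans (ih.trans ?_)
      · funext v
        cases v <;> simp [hu]
      · have : m / 2 / 2 ^ (n / 2) = m / 2 ^ (n / 2 + 1) := by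
          rw [Nat.div_div_eq_div_mul, pow_succ']
        funext v
        cases v <;> simp [Nat.add_div_right, List.replicate_succ', this]
  rw [setup, eval_seq_eq (eval_copy (by decide) (by decide) (by decide) (by simp [e, hx, hn])
      (by simp [e])), eval_seq_eq (eval_copy (by decide) (by decide) (by decide) (by simp [e, hm])
      (by simp [e])), eval_seq_eq (eval_push _ _ _)]
  obtain ⟨S₁, hS₁⟩ : ∃ S₁, S₁ = Function.update (Function.update (Function.update S .u x.reverse) .g
    (List.replicate m false)) .w [false] := ⟨_, rfl⟩
  refine (congrArg _ (?_ : _ = S₁)).trans ?_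
  · subst hS₁
    funext v
    cases v <;> simp [e]
  · obtain ⟨k, hk, h⟩ := key n x.reverse m S₁ (by simpa using hx) (by simp [hS₁]) (by simp [hS₁])
      (by simp [hS₁, e]) hm
    rw [eval_rep_of_iterate (hk.trans hn) h (eval_ite_pos (by simp)), hS₁]
    funext v
    cases v <;> simp [e, List.replicate_succ']

theorem eval_randomOutput {n : ℕ} {S : Var → List Bool} (hx : (S .x).length = n) (hL : n ≤ L)
    (hr : n ≤ (S .r).length) :
    eval L randomOutput S .y = ((S .r).take n).reverse ++ S .y := by
  obtain ⟨z, hz⟩ : ∃ z, z = ((S .r).take n).reverse ++ S .y := ⟨_, rfl⟩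
  rw [← hz]
  refine (eval_rep_invariant (I := fun n (S : Var → List Bool) => (S .x).length = n ∧ n ≤ (S .r).length ∧
    z = ((S .r).take n).reverse ++ S .y) ?_ ?_ hL ⟨hx, hr, hz⟩).2.2.symm
  · rintro S ⟨hx, h⟩
    rw [eval_ite_pos (by simp [List.length_eq_zero_iff.1 hx]), eval_skip]
    exact ⟨hx, h⟩
  · rintro n S ⟨hx, hr, hz⟩
    obtain ⟨a, l, hl⟩ := List.exists_cons_of_length_eq_add_one hx
    rcases hr' : S .r with _ | ⟨b, l'⟩
    · simp [hr'] at hr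
    rw [hr'] at hr hz
    cases b <;> simp [eval, hl, hr'] at hx hr hz ⊢ <;> exact ⟨hx, hr, hz⟩

/-- The output of the simulation of the program `P`, for as many steps as there are symbols in `m`. -/
def simOutput (L : ℕ) (P : List Bool) (m : List Bool) : List Bool :=
  eval L simulate (fun v => if v = .p then P else if v = .m then m else []) .out

/-- The output of the simulation depends only on the program and on the number of steps. -/
theorem eval_simulate_eq_simOutput (S : Var → List Bool) :
    eval L simulate S .out = simOutput L (S .p) (S .m) := by
  rw [simOutput, simulate, eval_seq, eval_seq]
  refine eval_congr (A := fun v => v ∉ [Var.x, .r, .y, .w, .z, .bad]) (by decide) (fun v hv => ?_) _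
    (by decide)
  cases v <;> first | (exfalso; revert hv; decide) | simp [clearAux, eval]

/-- In one iteration, the output of one program is compared with `y`. -/
theorem eval_tryProgram {S : Var → List Bool} (hw : (S .w).length ≤ L) (hy : (S .y).length ≤ L)
    (hm : (S .m).length ≤ L) : eval L tryProgram S .w = inc (S .w) ∧ eval L tryProgram S .y = S .y ∧
    eval L tryProgram S .m = S .m ∧ eval L tryProgram S .bad =
      if simOutput L (strip (S .w)) (S .m) = (S .y).reverse then true :: S .bad else S .bad := by
  obtain ⟨S₁, hS₁⟩ : ∃ S₁, S₁ = Function.update (Function.update S .t []) .p (strip (S .w)) :=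
    ⟨_, rfl⟩
  obtain ⟨S₂, hS₂⟩ : ∃ S₂, S₂ = eval L simulate S₁ := ⟨_, rfl⟩
  have h : eval L tryProgram S = eval L (clear .t ;; clear .z ;; moveBoth .y .t .z ;; move .t .y ;;
      testEq .z .out .bad ;; increment .w .t) S₂ := by
    have : Function.update (Function.update (Function.update (Function.update S .p []) .t []) .p
        (S .w)) .p (strip (S .w)) = S₁ := by
      subst hS₁
      funext v
      cases v <;> simp
    rw [tryProgram, eval_seq_eq (eval_clear _ _), eval_seq_eq (eval_clear _ _),
      eval_seq_eq (eval_copy (by decide) (by decide) (by decide) (by simpa using hw) (by simp)),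
      eval_seq_eq (eval_stripCmd (by simpa using hw)), hS₂, ← this]
    simp [eval_seq]
  have ew : S₂ .w = S .w := by rw [hS₂, eval_of_not_writes (by decide), hS₁]; simp
  have ey : S₂ .y = S .y := by rw [hS₂, eval_of_not_writes (by decide), hS₁]; simp
  have em : S₂ .m = S .m := by
    rw [hS₂, eval_simulate_steps] <;> simp only [hS₁, Function.update_self]
    · simp
    · exact (length_strip_le _).trans hw
    · simpa using hm
  have eb : S₂ .bad = S .bad := by rw [hS₂, eval_of_not_writes (by decide), hS₁]; simp
  have eo : S₂ .out = simOutput L (strip (S .w)) (S .m) := by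
    rw [hS₂, eval_simulate_eq_simOutput, hS₁]; simp
  obtain ⟨A, B, hAB⟩ := eval_testEq (L := L) (a := Var.z) (b := .out) (e := .bad) (by decide)
    (by decide) (by decide) (S := Function.update (Function.update S₂ .t []) .z (S .y).reverse)
    (by simpa using hy)
  have h' : eval L tryProgram S = Function.update (Function.update (Function.update (Function.update
      (Function.update (Function.update S₂ .t []) .z A) .out B) .bad
      (if (S .y).reverse = simOutput L (strip (S .w)) (S .m) then true :: S .bad else S .bad))
        .t []) .w (inc (S .w)) := by
    rw [h, eval_seq_eq (eval_clear _ _), eval_seq_eq (eval_clear _ _),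
      eval_seq_eq (eval_moveBoth (by decide) (by decide) (by decide) (by simpa [ey] using hy)),
      eval_seq_eq (eval_move (by decide) (by simpa [ey] using hy))]
    refine (congrArg _ (?_ : _ = Function.update (Function.update S₂ .t []) .z
      (S .y).reverse)).trans ?_
    · funext v
      cases v <;> simp [ey]
    · rw [eval_seq_eq hAB, eval_increment (by decide) (by simpa [ew] using hw)]
      simp [eo, ew, eb]
  rw [h']
  simp [ey, em, eq_comm]

end Cmd
end RelComplexity

namespace RelComplexity

/-! ### Correctness of the algorithm -/

namespace Cmd

variable {L : ℕ}

/-- `y` is the output of the simulation of a bit string of length less than `h`. For bit strings that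
are no programs, or that do not halt in time, this output has no meaning, but it exists. -/
def IsOutput (L h : ℕ) (m y : List Bool) : Prop :=
  ∃ w : List Bool, w.length = h ∧ simOutput L (strip w) m = y.reverse

/-- The numbers of all programs are tried, since the counter `w` is cyclic and the loop runs at least
`2 ^ |w|` times. -/
theorem eval_rep_tryProgram {S : Var → List Bool} (hw : (S .w).length ≤ L)
    (hw' : 2 ^ (S .w).length ≤ L) (hy : (S .y).length ≤ L) (hm : (S .m).length ≤ L)
    (hb : S .bad = []) :
    (eval L (rep tryProgram) S .w).length = (S .w).length ∧ eval L (rep tryProgram) S .y = S .y ∧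
    eval L (rep tryProgram) S .m = S .m ∧
    (eval L (rep tryProgram) S .bad ≠ [] ↔ IsOutput L (S .w).length (S .m) (S .y)) := by
  have key : ∀ n, (eval L tryProgram)^[n] S .w = inc^[n] (S .w) ∧
      (eval L tryProgram)^[n] S .y = S .y ∧ (eval L tryProgram)^[n] S .m = S .m ∧
      ((eval L tryProgram)^[n] S .bad ≠ [] ↔
        ∃ i < n, simOutput L (strip (inc^[i] (S .w))) (S .m) = (S .y).reverse) := by
    intro n
    induction n with
    | zero => simp [hb]
    | succ n ih =>
      obtain ⟨h1, h2, h3, h4⟩ := ih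
      obtain ⟨e1, e2, e3, e4⟩ := eval_tryProgram (L := L) (S := (eval L tryProgram)^[n] S)
        (by rwa [h1, length_iterate_inc]) (by rwa [h2]) (by rwa [h3])
      rw [h1] at e1
      rw [h1, h2, h3] at e4
      rw [Function.iterate_succ_apply', Function.iterate_succ_apply']
      refine ⟨e1, e2.trans h2, e3.trans h3, ?_⟩
      simp only [Nat.lt_succ_iff_lt_or_eq, or_and_right, exists_or, exists_eq_left, ← h4]
      rw [e4]
      split_ifs with h <;> simp [h]
  obtain ⟨h1, h2, h3, h4⟩ := key L
  refine ⟨(congrArg _ h1).trans (length_iterate_inc _ _), h2, h3, h4.trans ?_⟩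
  constructor
  · rintro ⟨i, -, h⟩
    exact ⟨_, length_iterate_inc _ _, h⟩
  · rintro ⟨w, hl, h⟩
    obtain ⟨i, hi, rfl⟩ := exists_iterate_inc hl.symm
    exact ⟨i, hi.trans_le hw', h⟩

/-- A string that is no output is found among the first `2 ^ h + 1` candidates, since there are only
`2 ^ h` outputs. -/
theorem exists_not_isOutput {h : ℕ} (m y : List Bool) (hy : h < y.length) :
    ∃ i ≤ 2 ^ h, ¬ IsOutput L h m (inc^[i] y) := by
  classical
  by_contra! hcon
  choose! w hw hw' using hcon
  have hfin : Fintype.card (Fin (2 ^ h + 1)) ≤ Fintype.card (List.Vector Bool h) := by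
    refine Fintype.card_le_of_injective (fun i => ⟨w i, hw i (Nat.le_of_lt_succ i.2)⟩) ?_
    intro i j hij
    have h1 : w i = w j := congrArg Subtype.val hij
    have h2 : inc^[(i : ℕ)] y = inc^[(j : ℕ)] y := by
      rw [← List.reverse_inj, ← hw' i (Nat.le_of_lt_succ i.2), h1, hw' j (Nat.le_of_lt_succ j.2)]
    have h3 : 2 ^ h < 2 ^ y.length := Nat.pow_lt_pow_right (by norm_num) hy
    exact Fin.ext (iterate_inc_injOn y (by have := i.2; simp; omega) (by have := j.2; simp; omega) h2)
  simp at hfin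

theorem eval_tryNext {S : Var → List Bool} (hw : (S .w).length ≤ L)
    (hw' : 2 ^ (S .w).length ≤ L) (hy : (S .y).length ≤ L) (hm : (S .m).length ≤ L) :
    (eval L tryNext S .w).length = (S .w).length ∧ eval L tryNext S .m = S .m ∧
    ((IsOutput L (S .w).length (S .m) (S .y) ∧ eval L tryNext S .y = inc (S .y)) ∨
    (¬ IsOutput L (S .w).length (S .m) (S .y) ∧ eval L tryNext S .y = S .y)) := by
  obtain ⟨h1, h2, h3, h4⟩ := eval_rep_tryProgram (L := L) (S := Function.update S .bad [])
    (by simpa using hw) (by simpa using hw') (by simpa using hy) (by simpa using hm) (by simp)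
  simp only [ne_eq, reduceCtorEq, not_false_eq_true, Function.update_of_ne] at h1 h2 h3 h4
  rw [tryNext, eval_seq_eq (eval_clear _ _), eval_seq]
  generalize eval L (rep tryProgram) (Function.update S .bad []) = S' at *
  by_cases hb : S' .bad = []
  · rw [eval_ite_pos (by simp [hb]), eval_skip]
    exact ⟨h1, h3, .inr ⟨fun h => h4.2 h hb, h2⟩⟩
  · rw [eval_ite_neg (by simpa using hb), eval_increment (by decide) (by simpa [h2] using hy)]
    exact ⟨by simp [h1], by simp [h3], .inl ⟨h4.1 hb, by simp [h2]⟩⟩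

theorem eval_bruteForce {S : Var → List Bool} {n : ℕ} (hx : (S .x).length = n) (hy : S .y = [])
    (hn : n ≤ L) (hw : (S .w).length ≤ L) (hw' : 2 ^ (S .w).length ≤ L) (hm : (S .m).length ≤ L) :
    (eval L bruteForce S .y).length = n ∧
    ((S .w).length < n → ¬ IsOutput L (S .w).length (S .m) (eval L bruteForce S .y)) := by
  have h0 : eval L (rep (ite .x none skip (pop .x ;; push .y false))) S =
      Function.update (Function.update S .x []) .y (List.replicate n false ++ S .y) := by
    refine eval_rep_eq (P := fun n (S : Var → List Bool) => (S .x).length = n)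
      (F := fun n (S : Var → List Bool) => Function.update (Function.update S .x []) .y
        (List.replicate n false ++ S .y)) ?_ ?_ hn hx
    · intro S h
      rw [List.length_eq_zero_iff] at h
      refine ⟨by simp [eval, h], ?_⟩
      rw [update_eq_of_eq h, update_eq_of_eq (by simp)]
    · intro n S h
      obtain ⟨b, l, hl⟩ := List.exists_cons_of_length_eq_add_one h
      have e : eval L (ite .x none skip (pop .x ;; push .y false)) S =
          Function.update (Function.update S .x l) .y (false :: S .y) := by
        simp [eval, hl]
      rw [e]
      refine ⟨by simpa [hl] using h, ?_⟩
      funext v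
      cases v <;> simp [List.replicate_succ']
  rw [bruteForce, eval_seq_eq h0, hy, List.append_nil]
  obtain ⟨S₁, hS₁⟩ : ∃ S₁, S₁ = Function.update (Function.update S .x []) .y
    (List.replicate n false) := ⟨_, rfl⟩
  have ew : S₁ .w = S .w := by subst hS₁; simp
  have em : S₁ .m = S .m := by subst hS₁; simp
  have ey : S₁ .y = List.replicate n false := by subst hS₁; simp
  rw [← hS₁]
  constructor
  · refine (eval_rep_invariant (I := fun _ (S' : Var → List Bool) => (S' .y).length = n ∧
      (S' .w).length = (S .w).length ∧ S' .m = S .m) ?_ ?_ (Nat.zero_le L) (S := S₁)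
      ⟨by simp [ey], by rw [ew], em⟩).1
    all_goals
      intros
      rename_i S' h
      obtain ⟨h1, h2, h3⟩ := h
      obtain ⟨e1, e2, e3⟩ := eval_tryNext (L := L) (S := S') (by omega) (by rwa [h2]) (by omega)
        (by rwa [h3])
      refine ⟨?_, e1.trans h2, e2.trans h3⟩
      rcases e3 with ⟨-, e3⟩ | ⟨-, e3⟩ <;> rw [e3]
      · rw [length_inc, h1]
      · exact h1
  · intro hwn
    obtain ⟨i, hi, hi'⟩ := exists_not_isOutput (L := L) (h := (S .w).length) (S .m)
      (List.replicate n false) (by simpa using hwn)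
    -- the invariant: at most `i` more iterations are needed
    have := eval_rep_invariant (L := L) (c := tryNext)
      (I := fun i (S' : Var → List Bool) => (S' .y).length = n ∧
      (S' .w).length = (S .w).length ∧ S' .m = S .m ∧
      ∃ j ≤ i, ¬ IsOutput L (S .w).length (S .m) (inc^[j] (S' .y))) ?_ ?_ (hi.trans hw') (S := S₁)
      ⟨by simp [ey], by rw [ew], em, i, le_rfl, by rwa [ey]⟩
    · obtain ⟨-, -, -, j, hj, h⟩ := this
      obtain rfl : j = 0 := by omega
      exact h
    all_goals
      intros
      rename_i S' h
      obtain ⟨h1, h2, h3, j, hj, h⟩ := h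
      obtain ⟨e1, e2, e3⟩ := eval_tryNext (L := L) (S := S') (by omega) (by rwa [h2]) (by omega)
        (by rwa [h3])
      refine ⟨?_, e1.trans h2, e2.trans h3, ?_⟩
      · rcases e3 with ⟨-, e3⟩ | ⟨-, e3⟩ <;> rw [e3]
        · rw [length_inc, h1]
        · exact h1
      rw [h2, h3] at e3
      rcases e3 with ⟨hb, e3⟩ | ⟨hb, e3⟩ <;> rw [e3]
      · rcases j with _ | j
        · exact absurd hb h
        · exact ⟨j, by omega, by rwa [Function.iterate_succ_apply] at h⟩
      · exact ⟨0, Nat.zero_le _, hb⟩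

/-- For small `m`, the algorithm outputs the last random bits. -/
theorem eval_main_random {x r : List Bool} {m : ℕ} (hm : m < 2 ^ (x.length / 2))
    (hL : (m + 3) * (x.length + 1) ≤ r.length) :
    eval r.length main (inputState .x .m .r (x, m, r)) .y = r.drop (r.length - x.length) := by
  rw [main, eval_seq_eq (eval_setup rfl (by nlinarith) (by nlinarith)),
    eval_ite_pos (by simp [Nat.div_eq_of_lt hm]),
    eval_randomOutput (n := x.length) (by simp [inputState]) (by nlinarith)
      (by simp [inputState]; nlinarith)]
  simp [inputState, List.take_reverse]

/-- For large `m`, the algorithm outputs a string that no short program prints within `m + 1` steps.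
For `n ≤ 2` there may be no such string, as then `2 ^ (⌊n / 2⌋ + 1) ≥ 2 ^ n`. -/
theorem eval_main_search {x r : List Bool} {m : ℕ} (hm : 2 ^ (x.length / 2) ≤ m)
    (hL : (m + 3) * (x.length + 1) ≤ r.length) {y : List Bool}
    (hy : eval r.length main (inputState .x .m .r (x, m, r)) .y = y) :
    y.length = x.length ∧ (2 < x.length → ∀ P t, P.length ≤ x.length / 2 → t ≤ m + 1 →
      ¬ Prints P y t) := by
  rw [main, eval_seq_eq (eval_setup rfl (by nlinarith) (by nlinarith)), eval_ite_neg (by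
    have : m / 2 ^ (x.length / 2) ≠ 0 := by
      rw [Nat.div_ne_zero_iff]
      exact ⟨by positivity, hm⟩
    simpa [List.head?_eq_none_iff] using this)] at hy
  have hw : 2 ^ (x.length / 2 + 1) ≤ r.length := by
    rcases Nat.eq_zero_or_pos x.length with h | h
    · simp only [h, Nat.zero_div, zero_add, pow_one, mul_one] at hL ⊢
      omega
    · rw [pow_succ]
      nlinarith
  have h := eval_bruteForce (L := r.length) (n := x.length) (S := Function.update (Function.update
    (inputState .x .m .r (x, m, r)) .w (List.replicate (x.length / 2 + 1) false)) .g
    (List.replicate (m / 2 ^ (x.length / 2)) false)) (by simp [inputState]) (by simp [inputState])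
    (by nlinarith) (by simp; exact Nat.lt_two_pow_self.le.trans hw) (by simpa using hw)
    (by simp [inputState]; nlinarith)
  rw [hy] at h
  refine ⟨h.1, fun hx P t hP ht hpr => h.2 (by simp; omega) ?_⟩
  obtain ⟨w, hw1, hw2⟩ := exists_strip_eq (Nat.lt_succ_of_le hP)
  refine ⟨w, by simpa using hw1, ?_⟩
  rw [hw2]
  exact eval_simulate (P := P) (m := m) (by simp) (by simp [inputState]) hpr ht
    (le_trans (Nat.mul_le_mul le_rfl (by omega)) hL)

end Cmd

/-- The randomized algorithm runs in polynomial time. -/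
theorem exists_computable_main : Nonempty (Turing.TM2ComputableInPolyTime encodeInput id fun i =>
    Cmd.eval i.2.2.length Cmd.main (Cmd.inputState .x .m .r i) .y) :=
  Cmd.computable Cmd.main (by decide) (by decide) (by decide)

/-! ### Membership in `FBPP` -/

theorem Prints.five_le_length {P y : List Bool} {t : ℕ} (h : Prints P y t) : 5 ≤ P.length := by
  obtain ⟨M, d, rfl, -⟩ := h
  have := Cmd.length_le_length_encodeCode M
  rw [List.length_append]
  omega

theorem Prints.time_pos {P y : List Bool} {t : ℕ} (h : Prints P y t) : 1 ≤ t := by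
  obtain ⟨M, d, -, h⟩ := h
  exact Cmd.HaltsIn_pos h

/-- A string of complexity less than half its length `n` is printed by a program of length less than
`n / 2` in less than `2 ^ ⌊n / 2⌋` steps. -/
theorem exists_prints_of_kt_lt {y : List Bool} (h : Kt y < (((y.length : ℝ) / 2 : ℝ) : EReal)) :
    ∃ P t, Prints P y t ∧ 2 * P.length < y.length ∧ t < 2 ^ (y.length / 2) := by
  simp only [Kt, iInf_lt_iff, EReal.coe_lt_coe_iff] at h
  obtain ⟨P, t, hP, h⟩ := h
  have ht : (1 : ℝ) ≤ t := by exact_mod_cast hP.time_pos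
  have h5 : (5 : ℝ) ≤ P.length := by exact_mod_cast hP.five_le_length
  have hlog : 0 ≤ Real.logb 2 t := Real.logb_nonneg (by norm_num) ht
  refine ⟨P, t, hP, ?_, ?_⟩
  · have : 2 * (P.length : ℝ) < y.length := by linarith
    exact_mod_cast this
  · have h1 : (y.length : ℝ) ≤ 2 * (y.length / 2 : ℕ) + 1 := by
      have : y.length ≤ 2 * (y.length / 2) + 1 := by omega
      exact_mod_cast this
    have h2 : Real.logb 2 t < (y.length / 2 : ℕ) := by linarith
    rw [Real.logb_lt_iff_lt_rpow (by norm_num) (by linarith), Real.rpow_natCast] at h2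
    exact_mod_cast h2

/-- The search finds a solution. The bound on the length of programs excludes the small cases in which
it may fail. -/
theorem ktRelation_main {x r : List Bool} {m : ℕ} (hm : 2 ^ (x.length / 2) ≤ m)
    (hL : (m + 3) * (x.length + 1) ≤ r.length) :
    ktRelation x (Cmd.eval r.length Cmd.main (Cmd.inputState .x .m .r (x, m, r)) .y) := by
  obtain ⟨h1, h2⟩ := Cmd.eval_main_search hm hL rfl
  refine ⟨h1.symm, ?_⟩
  by_contra! h
  obtain ⟨P, t, hP, hPy, ht⟩ := exists_prints_of_kt_lt h
  rw [h1] at hPy ht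
  have := hP.five_le_length
  exact h2 (by omega) P t (by omega) (by omega) hP

/-- There are strings of high complexity of every length: the search finds them. -/
theorem exists_ktRelation (x : List Bool) : ∃ y, ktRelation x y :=
  ⟨_, ktRelation_main (x := x)
    (r := List.replicate ((2 ^ (x.length / 2) + 3) * (x.length + 1)) true) le_rfl (by simp)⟩

/-- The error probability is the proportion of the bad coin flips. -/
theorem one_sub_le_coinProb {ℓ : ℕ} {E : List Bool → Prop} {ε : ℝ}
    (h : (Set.ncard {r : Fin ℓ → Bool | ¬ E (List.ofFn r)} : ℝ) ≤ ε * 2 ^ ℓ) :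
    1 - ε ≤ coinProb ℓ E := by
  have h1 := Set.ncard_add_ncard_compl {r : Fin ℓ → Bool | E (List.ofFn r)}
  rw [Set.compl_ofPred, Nat.card_eq_fintype_card, Fintype.card_fun, Fintype.card_bool,
    Fintype.card_fin] at h1
  have h2 : (Set.ncard {r : Fin ℓ → Bool | E (List.ofFn r)} : ℝ) +
      Set.ncard {r : Fin ℓ → Bool | ¬ E (List.ofFn r)} = 2 ^ ℓ := by exact_mod_cast h1
  rw [coinProb, le_div_iff₀ (by positivity)]
  linarith

/-- Few strings have a suffix of length `n` of low complexity: such a string is determined by the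
rest of it and the number of a program. -/
theorem ncard_kt_lt_le {n ℓ : ℕ} (h : n ≤ ℓ) :
    Set.ncard {r : Fin ℓ → Bool | Kt ((List.ofFn r).drop (ℓ - n)) < (((n : ℝ) / 2 : ℝ) : EReal)} ≤
      2 ^ (ℓ - n / 2) := by
  classical
  have hex : ∀ r : Fin ℓ → Bool, Kt ((List.ofFn r).drop (ℓ - n)) < (((n : ℝ) / 2 : ℝ) : EReal) →
      ∃ w : List Bool, w.length = n - n / 2 ∧
        ∃ t, Prints (strip w) ((List.ofFn r).drop (ℓ - n)) t := by
    intro r hr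
    have hl : ((List.ofFn r).drop (ℓ - n)).length = n := by simp; omega
    obtain ⟨P, t, hP, hPn, -⟩ := exists_prints_of_kt_lt (by rwa [hl])
    -- `|P| < n / 2` means `|P| < ⌈n / 2⌉ = n - ⌊n / 2⌋`
    obtain ⟨w, hw, rfl⟩ := exists_strip_eq (h := n - n / 2) (P := P) (by omega)
    exact ⟨w, hw, t, hP⟩
  choose! w hw t ht using hex
  have hcard : Nat.card (List.Vector Bool (ℓ - n / 2)) = 2 ^ (ℓ - n / 2) := by
    simp
  rw [← hcard, ← Nat.card_coe_set_eq]
  refine Nat.card_le_card_of_injective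
    (fun r => ⟨(List.ofFn r.1).take (ℓ - n) ++ w r.1, ?_⟩) ?_
  · rw [List.length_append, hw r.1 r.2]
    simp
    omega
  · rintro ⟨r, hr⟩ ⟨r', hr'⟩ hrr
    obtain ⟨h1, h2⟩ := List.append_inj (congrArg Subtype.val hrr) (by simp)
    have h3 := ht r' hr'
    have h4 := ht r hr
    simp only at h1 h2
    rw [h2] at h4
    refine Subtype.ext (List.ofFn_injective ?_)
    rw [← List.take_append_drop (ℓ - n) (List.ofFn r), h1, (h4.unique h3).1,
      List.take_append_drop]

theorem polyBounded_ktRelation : PolyBounded ktRelation :=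
  ⟨.X, fun x y h => by simp [h.1]⟩

theorem ktRelation_mem_FBPP : ktRelation ∈ FBPP := by
  refine ⟨polyBounded_ktRelation, (.X + 3) ^ 2, _, exists_computable_main, ?_⟩
  intro x _ ε hε
  obtain ⟨m, hm⟩ : ∃ m, m = ⌈1 / ε⌉₊ := ⟨_, rfl⟩
  obtain ⟨n, hn⟩ : ∃ n, n = x.length := ⟨_, rfl⟩
  obtain ⟨ℓ, hℓ⟩ : ∃ ℓ, ℓ = (((.X + 3) ^ 2 : Polynomial ℕ)).eval (n + m) := ⟨_, rfl⟩
  -- the polynomial is chosen for this bound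
  have hL : (m + 3) * (n + 1) ≤ ℓ := by
    simp only [Polynomial.eval_pow, Polynomial.eval_add, Polynomial.eval_X,
      Polynomial.eval_ofNat] at hℓ
    rw [hℓ]
    nlinarith
  rw [← hm, ← hn, ← hℓ]
  refine one_sub_le_coinProb ?_
  by_cases h : 2 ^ (n / 2) ≤ m
  · -- the search never fails
    have h0 : {r : Fin ℓ → Bool | ¬ ktRelation x (Cmd.eval (List.ofFn r).length Cmd.main
        (Cmd.inputState .x .m .r (x, m, List.ofFn r)) .y)} = ∅ := by
      refine Set.eq_empty_of_forall_notMem fun r hr => hr ?_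
      exact ktRelation_main (hn ▸ h) (by simpa [← hn] using hL)
    rw [h0, Set.ncard_empty, Nat.cast_zero]
    positivity
  · -- the output is random
    rw [not_le] at h
    have hnℓ : n ≤ ℓ := by nlinarith
    have hm1 : 1 / ε ≤ m := hm ▸ Nat.le_ceil _
    have key : Set.ncard {r : Fin ℓ → Bool | ¬ ktRelation x (Cmd.eval (List.ofFn r).length Cmd.main
        (Cmd.inputState .x .m .r (x, m, List.ofFn r)) .y)} ≤ 2 ^ (ℓ - n / 2) := by
      refine le_trans (Set.ncard_le_ncard ?_) (ncard_kt_lt_le hnℓ)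
      intro r hr
      simp only [Set.mem_ofPred_eq] at hr ⊢
      rw [Cmd.eval_main_random (hn ▸ h) (by simpa [← hn] using hL), List.length_ofFn, ← hn] at hr
      have hl : ((List.ofFn r).drop (ℓ - n)).length = n := by simp; omega
      rw [ktRelation, hl, not_and, not_le] at hr
      exact hr hn.symm
    refine (Nat.cast_le.2 key).trans ?_
    push_cast
    rw [pow_sub₀ _ (by norm_num) (by omega), mul_comm]
    refine mul_le_mul_of_nonneg_right ?_ (by positivity)
    rw [inv_le_comm₀ (by positivity) hε]
    rw [one_div] at hm1
    exact hm1.trans (by exact_mod_cast h.le)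

/-! ### Programs from flow graphs -/

/-- The action at a node of a flow graph with nodes in `N`: push or pop, and go to a node; go to a
node that depends on the top symbol of a stack (`none` if it is empty); or halt. -/
inductive Act (N : Type) : Type
  | push (k a : ℕ) (n : N)
  | pop (k : ℕ) (n : N)
  | switch (k : ℕ) (f : Option ℕ → N)
  | halt

namespace Act

variable {N : Type}

/-- The code of an action, which has `B + 2` instructions: symbols are less than `B`, the code of
node `n` is at the address `addr n`, and jumps to the address `fin` halt the program. -/
def block (B : ℕ) (addr : N → ℕ) (fin : ℕ) : Act N → List Instr
  | push k a n => .push k a :: .goto (addr n) :: List.replicate B (.goto 0)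
  | pop k n => .pop k :: .goto (addr n) :: List.replicate B (.goto 0)
  | switch k f => (List.range B).map (fun a => .branch k a (addr (f (some a)))) ++
      [.goto (addr (f none)), .goto 0]
  | halt => List.replicate (B + 2) (.goto fin)

theorem length_block (B : ℕ) (addr : N → ℕ) (fin : ℕ) (a : Act N) :
    (block B addr fin a).length = B + 2 := by
  cases a <;> simp [block]

open Classical in
/-- The address of a node. -/
noncomputable def addr (B : ℕ) (l : List N) (n : N) : ℕ := (B + 2) * l.idxOf n

/-- The code of the part of a flow graph with nodes in the list `l`. Jumps to other nodes lead out of the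
code. -/
noncomputable def compile (B : ℕ) (act : N → Act N) (l : List N) : List Instr :=
  l.flatMap fun n => (act n).block B (addr B l) ((B + 2) * l.length)

/-- Blocks of equal length are found by multiplication. -/
theorem getElem?_flatMap_of_length_eq [DecidableEq N] {α : Type} {W : ℕ} {f : N → List α}
    (hf : ∀ n, (f n).length = W) {l : List N} {n : N} (hn : n ∈ l) {j : ℕ} (hj : j < W) :
    (l.flatMap f)[W * l.idxOf n + j]? = (f n)[j]? := by
  induction l with
  | nil => simp at hn
  | cons a l ih =>
    rw [List.flatMap_cons]
    by_cases h : a = n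
    · subst h
      rw [List.idxOf_cons_self, Nat.mul_zero, Nat.zero_add, List.getElem?_append_left (by rwa [hf])]
    · rw [List.idxOf_cons_ne _ h, Nat.mul_succ, Nat.add_right_comm, List.getElem?_append_right
        (by rw [hf]; omega), hf, Nat.add_sub_cancel]
      exact ih (by simpa [Ne.symm h] using hn)

theorem getElem?_compile {B : ℕ} {act : N → Act N} {l : List N} {n : N} (hn : n ∈ l) {j : ℕ}
    (hj : j < B + 2) : (compile B act l)[addr B l n + j]? =
      ((act n).block B (addr B l) ((B + 2) * l.length))[j]? := by
  classical
  rw [compile, addr]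
  convert getElem?_flatMap_of_length_eq (fun n => length_block B (addr B l) ((B + 2) * l.length)
    (act n)) hn hj

/-- The code of the flow graph, started at the node `n` on the stacks `S`, halts within `T` steps
with output `y`. -/
def HaltsFrom (B : ℕ) (act : N → Act N) (l : List N) (y : List Bool) (n : N) (S : ℕ → List ℕ)
    (T : ℕ) : Prop :=
  ∃ t ≤ T, HaltsIn (compile B act l) ⟨addr B l n, S⟩ y t

variable {B : ℕ} {act : N → Act N} {l : List N} {y : List Bool} {n : N} {S : ℕ → List ℕ} {T : ℕ}

theorem HaltsFrom.mono {T' : ℕ} (h : HaltsFrom B act l y n S T) (hT : T ≤ T') :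
    HaltsFrom B act l y n S T' := by
  obtain ⟨t, ht, h⟩ := h
  exact ⟨t, ht.trans hT, h⟩

theorem HaltsFrom.push {k a : ℕ} {n' : N} (hn : n ∈ l) (ha : act n = .push k a n')
    (h : HaltsFrom B act l y n' (Function.update S k (a :: S k)) T) :
    HaltsFrom B act l y n S (T + (B + 2)) := by
  obtain ⟨t, ht, h⟩ := h
  refine ⟨t + 1 + 1, by omega, .step _ _ _ (.push k a) ?_ (.step _ _ _ (.goto (addr B l n')) ?_ h)⟩
  · exact (getElem?_compile (j := 0) hn (by omega)).trans (by rw [ha]; rfl)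
  · exact (getElem?_compile (j := 1) hn (by omega)).trans (by rw [ha]; rfl)

theorem HaltsFrom.pop {k : ℕ} {n' : N} (hn : n ∈ l) (ha : act n = .pop k n')
    (h : HaltsFrom B act l y n' (Function.update S k (S k).tail) T) :
    HaltsFrom B act l y n S (T + (B + 2)) := by
  obtain ⟨t, ht, h⟩ := h
  refine ⟨t + 1 + 1, by omega, .step _ _ _ (.pop k) ?_ (.step _ _ _ (.goto (addr B l n')) ?_ h)⟩
  · exact (getElem?_compile (j := 0) hn (by omega)).trans (by rw [ha]; rfl)
  · exact (getElem?_compile (j := 1) hn (by omega)).trans (by rw [ha]; rfl)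

/-- The branches to the symbols `0, …, B - 1` are tried one after the other. -/
theorem HaltsFrom.switch {k : ℕ} {f : Option ℕ → N} (hn : n ∈ l) (ha : act n = .switch k f)
    (hS : ∀ a, (S k).head? = some a → a < B) (h : HaltsFrom B act l y (f (S k).head?) S T) :
    HaltsFrom B act l y n S (T + (B + 2)) := by
  obtain ⟨t, ht, h⟩ := h
  -- at the `j`-th instruction of the block, after `j` symbols have been excluded
  have key : ∀ i j, i + j = B → (∀ a, (S k).head? = some a → j ≤ a) →
      ∃ t' ≤ t + 1 + i, HaltsIn (compile B act l) ⟨addr B l n + j, S⟩ y t' := by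
    intro i
    induction i with
    | zero =>
      intro j hj hS'
      have h0 : (S k).head? = none := by
        by_contra hne
        obtain ⟨a, ha⟩ := Option.ne_none_iff_exists'.1 hne
        have := hS a ha
        have := hS' a ha
        omega
      refine ⟨t + 1, by omega, .step _ _ _ (.goto (addr B l (f none))) ?_ (by rwa [h0] at h)⟩
      rw [getElem?_compile hn (by omega), ha, block,
        List.getElem?_append_right (by simp; omega)]
      simp [show j = B by omega]
    | succ i ih =>
      intro j hj hS'
      have hi : (compile B act l)[addr B l n + j]? =
          some (.branch k j (addr B l (f (some j)))) := by
        rw [getElem?_compile hn (by omega), ha, block,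
          List.getElem?_append_left (by simp; omega)]
        rw [List.getElem?_map, List.getElem?_range (by omega)]
        rfl
      by_cases h0 : (S k).head? = some j
      · refine ⟨t + 1, by omega, .step _ _ _ _ hi ?_⟩
        rw [h0] at h
        simpa [Instr.exec, h0] using h
      · obtain ⟨t', ht', h'⟩ := ih (j + 1) (by omega) fun a ha => by
          have := hS' a ha
          have : a ≠ j := by rintro rfl; exact h0 ha
          omega
        refine ⟨t' + 1, by omega, .step _ _ _ _ hi ?_⟩
        simpa [Instr.exec, h0, Nat.add_assoc] using h'
  obtain ⟨t', ht', h'⟩ := key B 0 (by omega) (by simp)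
  exact ⟨t', by omega, h'⟩

theorem HaltsFrom.halt (hn : n ∈ l) (ha : act n = .halt) (hS : S 1 = y.map Bool.toNat) :
    HaltsFrom B act l y n S (B + 2) := by
  refine ⟨2, by omega, .step _ _ _ (.goto ((B + 2) * l.length)) ?_ (.halt _ _ ?_ hS)⟩
  · exact (getElem?_compile (j := 0) hn (by omega)).trans (by rw [ha]; simp [block])
  · simp only [Instr.exec, List.getElem?_eq_none_iff]
    simp [compile, List.length_flatMap, length_block, Nat.mul_comm]

/-- A loop that moves the content of stack `i` to stack `j`. -/
theorem HaltsFrom.move {i j : ℕ} (hij : i ≠ j) {dec : ℕ → Bool} {test exit : N} {popN pushN : Bool → N}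
    {f : Option ℕ → N} (htest : test ∈ l) (hpop : ∀ b, popN b ∈ l) (hpush : ∀ b, pushN b ∈ l)
    (h1 : act test = .switch i f) (hf : f none = exit) (hf' : ∀ a, f (some a) = popN (dec a))
    (h2 : ∀ b, act (popN b) = .pop i (pushN b)) (h3 : ∀ b, act (pushN b) = .push j b.toNat test)
    {u : List ℕ} (hu : ∀ a ∈ u, a < B) (hS : S i = u)
    (h : HaltsFrom B act l y exit (Function.update (Function.update S i []) j
      ((u.map fun a => (dec a).toNat).reverse ++ S j)) T) :
    HaltsFrom B act l y test S (T + (3 * u.length + 1) * (B + 2)) := by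
  induction u generalizing S with
  | nil =>
    refine (HaltsFrom.switch htest h1 (by simp [hS]) (T := T) ?_).mono (by simp)
    rw [hS, List.head?_nil, hf]
    have e : Function.update S i [] = S := by rw [← hS, Function.update_eq_self]
    simpa [e] using h
  | cons a u ih =>
    have := HaltsFrom.switch htest h1 (S := S) (by simpa [hS] using hu a (by simp)) (T :=
      T + (3 * u.length + 1) * (B + 2) + (B + 2) + (B + 2)) (y := y) ?_
    · exact this.mono (by rw [List.length_cons]; ring_nf; rfl)
    rw [hS, List.head?_cons, hf']
    refine HaltsFrom.pop (hpop _) (h2 _) (HaltsFrom.push (hpush _) (h3 _) (ih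
      (fun b hb => hu b (by simp [hb])) (by simp [hij, hS]) ?_))
    convert h using 1
    funext v
    rcases eq_or_ne v j with rfl | hj
    · simp [hij.symm]
    · rcases eq_or_ne v i with rfl | hi <;> simp [*]

end Act
end RelComplexity

namespace RelComplexity

open Turing

/-! ### Turing machines as flow graphs -/

/-- The nodes of the flow graph of a Turing machine: execute a statement in a state; pop a stack
before that; produce the input; copy the output to stack `0` (`false`), and from there to stack `1`
(`true`). -/
inductive Node {K : Type} (Γ : K → Type) (Λ σ : Type) : Type
  | run (q : TM2.Stmt Γ Λ σ) (v : σ)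
  | popThen (k : K) (q : TM2.Stmt Γ Λ σ) (v : σ)
  | input (i : Fin 5)
  | test (s : Bool)
  | popOut (s b : Bool)
  | pushOut (s b : Bool)
  | exit

/-- A Turing machine with start label `main`, initial state `v₀`, input symbol `one` on the stack
`k₀`, and output stack `k₁` whose symbols stand for bits, together with the numbers `st k` of its
stacks and the numbers `enc k a` of their symbols. The numbers `0` and `1` are reserved for the stacks
that hold the data bits and the output. As the alphabets may be infinite, only finitely many symbols,
which include all that occur in a computation, have numbers less than `B` that `dec` inverts. -/
structure Coding {K : Type} (Γ : K → Type) (Λ σ : Type) where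
  m : Λ → TM2.Stmt Γ Λ σ
  main : Λ
  v₀ : σ
  k₀ : K
  one : Γ k₀
  k₁ : K
  out : Γ k₁ → Bool
  st : K → ℕ
  st_injective : Function.Injective st
  two_le_st : ∀ k, 2 ≤ st k
  enc : ∀ k, Γ k → ℕ
  dec : ∀ k, ℕ → Option (Γ k)
  B : ℕ
  two_le : 2 ≤ B

namespace Coding

variable {K : Type} {Γ : K → Type} {Λ σ : Type} (C : Coding Γ Λ σ)

/-- The flow graph of a Turing machine. The input consists of three symbols for every symbol on
stack `0`. -/
def act : Node Γ Λ σ → Act (Node Γ Λ σ)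
  | .run (.push k f q) v => .push (C.st k) (C.enc k (f v)) (.run q v)
  | .run (.peek k f q) v => .switch (C.st k) fun o => .run q (f v (o.bind (C.dec k)))
  | .run (.pop k f q) v => .switch (C.st k) fun o => .popThen k q (f v (o.bind (C.dec k)))
  | .run (.load a q) v => .switch 0 fun _ => .run q (a v)
  | .run (.branch f q₁ q₂) v => .switch 0 fun _ => .run (cond (f v) q₁ q₂) v
  | .run (.goto f) v => .switch 0 fun _ => .run (C.m (f v)) v
  | .run .halt _ => .switch 0 fun _ => .test false
  | .popThen k q v => .pop (C.st k) (.run q v)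
  | .input 0 => .switch 0 fun o => o.elim (.run (C.m C.main) C.v₀) fun _ => .input 1
  | .input 1 => .pop 0 (.input 2)
  | .input 2 => .push (C.st C.k₀) (C.enc C.k₀ C.one) (.input 3)
  | .input 3 => .push (C.st C.k₀) (C.enc C.k₀ C.one) (.input 4)
  | .input 4 => .push (C.st C.k₀) (C.enc C.k₀ C.one) (.input 0)
  | .test false => .switch (C.st C.k₁) fun o =>
      o.elim (.test true) fun a => .popOut false ((C.dec C.k₁ a).elim false C.out)
  | .test true => .switch 0 fun o => o.elim .exit fun a => .popOut true (a == 1)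
  | .popOut false b => .pop (C.st C.k₁) (.pushOut false b)
  | .popOut true b => .pop 0 (.pushOut true b)
  | .pushOut false b => .push 0 b.toNat (.test false)
  | .pushOut true b => .push 1 b.toNat (.test true)
  | .exit => .halt

/-- The symbol `a` is represented by its number. -/
def Ok (k : K) (a : Γ k) : Prop := C.enc k a < C.B ∧ C.dec k (C.enc k a) = some a

/-- All symbols that a statement may push are represented by their numbers. -/
def PushOk : TM2.Stmt Γ Λ σ → Prop
  | .push k f q => (∀ v, C.Ok k (f v)) ∧ PushOk q
  | .peek _ _ q => PushOk q
  | .pop _ _ q => PushOk q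
  | .load _ q => PushOk q
  | .branch _ q₁ q₂ => PushOk q₁ ∧ PushOk q₂
  | .goto _ => True
  | .halt => True

/-- The stacks `s` represent the stacks `S` of the Turing machine; stacks `0` and `1` are empty. -/
structure Rep (S : ∀ k, List (Γ k)) (s : ℕ → List ℕ) : Prop where
  stk : ∀ k, s (C.st k) = (S k).map (C.enc k)
  zero : s 0 = []
  one : s 1 = []

/-- From a node and stacks of the Turing machine, the output `y` is reached in time `T`. -/
def Halts (l : List (Node Γ Λ σ)) (y : List Bool) (n : Node Γ Λ σ) (S : ∀ k, List (Γ k)) (T : ℕ) :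
    Prop :=
  ∀ s, C.Rep S s → Act.HaltsFrom C.B C.act l y n s T

/-- The node of a configuration of the Turing machine. Having halted is represented by the statement
`halt`. -/
def cfgNode (c : TM2.Cfg Γ Λ σ) : Node Γ Λ σ :=
  match c.l with
  | some l => .run (C.m l) c.var
  | none => .run .halt c.var

variable {C} {l : List (Node Γ Λ σ)} {y : List Bool}

theorem Rep.update [DecidableEq K] {S : ∀ k, List (Γ k)} {s : ℕ → List ℕ} (h : C.Rep S s) (k : K)
    {L : List (Γ k)} {L' : List ℕ} (hL : L' = L.map (C.enc k)) :
    C.Rep (Function.update S k L) (Function.update s (C.st k) L') := by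
  subst hL
  have := C.two_le_st k
  refine ⟨fun k' => ?_, ?_, ?_⟩
  · rcases eq_or_ne k' k with rfl | hk
    · simp
    · rw [Function.update_of_ne (C.st_injective.ne hk), Function.update_of_ne hk, h.stk]
  · rw [Function.update_of_ne (by omega), h.zero]
  · rw [Function.update_of_ne (by omega), h.one]

theorem Halts.mono {n : Node Γ Λ σ} {S : ∀ k, List (Γ k)} {T T' : ℕ} (h : C.Halts l y n S T)
    (hT : T ≤ T') : C.Halts l y n S T' := fun s hs => (h s hs).mono hT

/-- The simulation of a statement takes constant time `D`. The proof goes backwards: a halting run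
from the end of the statement is extended to the beginning. -/
theorem exists_halts_stepAux [DecidableEq K] {q : TM2.Stmt Γ Λ σ} (hq : C.PushOk q)
    (hl : ∀ q' ∈ TM2.stmts₁ q, ∀ v, .run q' v ∈ l ∧ ∀ k, .popThen k q' v ∈ l) :
    ∃ D, ∀ (y : List Bool) (v : σ) (S : ∀ k, List (Γ k)), (∀ k, ∀ a ∈ S k, C.Ok k a) →
      (∀ k, ∀ a ∈ (TM2.stepAux q v S).stk k, C.Ok k a) ∧
      ∀ T, C.Halts l y (C.cfgNode (TM2.stepAux q v S)) (TM2.stepAux q v S).stk T →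
        C.Halts l y (.run q v) S (T + D) := by
  have htop : ∀ (S : ∀ k, List (Γ k)) (s : ℕ → List ℕ) (k : K), (∀ k, ∀ a ∈ S k, C.Ok k a) →
      C.Rep S s → (∀ a, (s (C.st k)).head? = some a → a < C.B) ∧
        (s (C.st k)).head?.bind (C.dec k) = (S k).head? := by
    intro S s k hS hs
    rw [hs.stk]
    have := hS k
    rcases h : S k with _ | ⟨a, L⟩
    · simp
    · rw [h] at this
      have := this a (by simp)
      simp [this.1, this.2]
  have hzero : ∀ (S : ∀ k, List (Γ k)) (s : ℕ → List ℕ), C.Rep S s →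
      ∀ a, (s 0).head? = some a → a < C.B := by
    intro S s hs a ha
    simp [hs.zero] at ha
  have hself := fun v => (hl q TM2.stmts₁_self v).1
  induction q with
  | push k f q ih =>
    obtain ⟨D, ih⟩ := ih hq.2 (fun q' hq' => hl q' (by simp [TM2.stmts₁, hq']))
      fun v => (hl q (by simp [TM2.stmts₁, TM2.stmts₁_self]) v).1
    refine ⟨D + (C.B + 2), fun y v S hS => ?_⟩
    obtain ⟨h1, h2⟩ := ih y v (Function.update S k (f v :: S k)) (by
      intro k'
      rcases eq_or_ne k' k with rfl | hk
      · simpa using ⟨hq.1 v, hS k'⟩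
      · simpa [hk] using hS k')
    refine ⟨h1, fun T hT s hs => ?_⟩
    have := Act.HaltsFrom.push (B := C.B) (act := C.act) (y := y) (S := s) (hself v) rfl
      (h2 T hT _ (hs.update k (L' := C.enc k (f v) :: s (C.st k)) (by simp [hs.stk])))
    exact this.mono (by omega)
  | peek k f q ih =>
    obtain ⟨D, ih⟩ := ih hq (fun q' hq' => hl q' (by simp [TM2.stmts₁, hq']))
      fun v => (hl q (by simp [TM2.stmts₁, TM2.stmts₁_self]) v).1
    refine ⟨D + (C.B + 2), fun y v S hS => ?_⟩
    obtain ⟨h1, h2⟩ := ih y (f v (S k).head?) S hS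
    refine ⟨h1, fun T hT s hs => ?_⟩
    have := Act.HaltsFrom.switch (B := C.B) (act := C.act) (y := y) (S := s) (T := T + D) (hself v) rfl (htop S s k hS hs).1
      (by rw [(htop S s k hS hs).2]; exact h2 T hT s hs)
    exact this.mono (by omega)
  | pop k f q ih =>
    have hq' := hl q (by simp [TM2.stmts₁, TM2.stmts₁_self])
    obtain ⟨D, ih⟩ := ih hq (fun q' hq' => hl q' (by simp [TM2.stmts₁, hq'])) fun v => (hq' v).1
    refine ⟨D + (C.B + 2) + (C.B + 2), fun y v S hS => ?_⟩
    obtain ⟨h1, h2⟩ := ih y (f v (S k).head?) (Function.update S k (S k).tail) (by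
      intro k'
      rcases eq_or_ne k' k with rfl | hk
      · simpa using fun a ha => hS k' a (List.mem_of_mem_tail ha)
      · simpa [hk] using hS k')
    refine ⟨h1, fun T hT s hs => ?_⟩
    have := Act.HaltsFrom.switch (B := C.B) (act := C.act) (y := y) (S := s) (T := T + D + (C.B + 2)) (hself v) rfl (htop S s k hS hs).1
      (by
        rw [(htop S s k hS hs).2]
        exact Act.HaltsFrom.pop ((hq' _).2 k) rfl
          (h2 T hT _ (hs.update k (by rw [hs.stk, List.map_tail]))))
    exact this.mono (by omega)
  | load a q ih =>
    obtain ⟨D, ih⟩ := ih hq (fun q' hq' => hl q' (by simp [TM2.stmts₁, hq']))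
      fun v => (hl q (by simp [TM2.stmts₁, TM2.stmts₁_self]) v).1
    refine ⟨D + (C.B + 2), fun y v S hS => ?_⟩
    obtain ⟨h1, h2⟩ := ih y (a v) S hS
    refine ⟨h1, fun T hT s hs => ?_⟩
    exact (Act.HaltsFrom.switch (T := T + D) (hself v) rfl (hzero S s hs) (h2 T hT s hs)).mono
      (by omega)
  | branch f q₁ q₂ ih₁ ih₂ =>
    obtain ⟨D₁, ih₁⟩ := ih₁ hq.1 (fun q' hq' => hl q' (by simp [TM2.stmts₁, hq']))
      fun v => (hl q₁ (by simp [TM2.stmts₁, TM2.stmts₁_self]) v).1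
    obtain ⟨D₂, ih₂⟩ := ih₂ hq.2 (fun q' hq' => hl q' (by simp [TM2.stmts₁, hq']))
      fun v => (hl q₂ (by simp [TM2.stmts₁, TM2.stmts₁_self]) v).1
    refine ⟨D₁ + D₂ + (C.B + 2), fun y v S hS => ?_⟩
    rw [TM2.stepAux]
    cases hf : f v
    · obtain ⟨h1, h2⟩ := ih₂ y v S hS
      refine ⟨h1, fun T hT s hs => ?_⟩
      exact (Act.HaltsFrom.switch (T := T + D₂) (hself v) rfl (hzero S s hs)
        (by rw [hf]; exact h2 T hT s hs)).mono (by omega)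
    · obtain ⟨h1, h2⟩ := ih₁ y v S hS
      refine ⟨h1, fun T hT s hs => ?_⟩
      exact (Act.HaltsFrom.switch (T := T + D₁) (hself v) rfl (hzero S s hs)
        (by rw [hf]; exact h2 T hT s hs)).mono (by omega)
  | goto f =>
    exact ⟨C.B + 2, fun y v S hS => ⟨hS, fun T hT s hs =>
      Act.HaltsFrom.switch (hself v) rfl (hzero S s hs) (hT s hs)⟩⟩
  | halt =>
    exact ⟨0, fun y v S hS => ⟨hS, fun T hT => hT⟩⟩

/-- The simulation of `n` steps of the Turing machine. -/
theorem halts_of_evals [DecidableEq K] {D : ℕ} (hD : ∀ (i : Λ) (v : σ) (S : ∀ k, List (Γ k)),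
      (∀ k, ∀ a ∈ S k, C.Ok k a) → (∀ k, ∀ a ∈ (TM2.stepAux (C.m i) v S).stk k, C.Ok k a) ∧
      ∀ T, C.Halts l y (C.cfgNode (TM2.stepAux (C.m i) v S)) (TM2.stepAux (C.m i) v S).stk T →
        C.Halts l y (.run (C.m i) v) S (T + D)) {n : ℕ} {c c' : TM2.Cfg Γ Λ σ}
    (h : (flip bind (TM2.step C.m))^[n] (some c) = some c') (hc : ∀ k, ∀ a ∈ c.stk k, C.Ok k a)
    {T : ℕ} (hT : C.Halts l y (C.cfgNode c') c'.stk T) :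
    C.Halts l y (C.cfgNode c) c.stk (T + n * D) := by
  induction n generalizing c with
  | zero =>
    obtain rfl : c = c' := by simpa using h
    exact hT.mono (by omega)
  | succ n ih =>
    rw [Function.iterate_succ_apply] at h
    obtain ⟨i, v, S⟩ := c
    rcases i with _ | i
    · exfalso
      have : ∀ n, (flip bind (TM2.step C.m))^[n] none = none := by
        intro n
        induction n with
        | zero => rfl
        | succ n ih => rw [Function.iterate_succ_apply]; exact ih
      exact absurd ((this n).symm.trans h) (by simp)
    · obtain ⟨h1, h2⟩ := hD i v S hc
      refine (h2 _ (ih h h1)).mono ?_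
      rw [Nat.succ_mul]
      omega

/-- The output is moved from stack `k₁` to stack `0`, and from there to stack `1`, so that its order is
preserved. -/
theorem halts_exit (hrun : ∀ v, .run .halt v ∈ l) (htest : ∀ s, .test s ∈ l)
    (hpop : ∀ s b, .popOut s b ∈ l) (hpush : ∀ s b, .pushOut s b ∈ l) (hexit : .exit ∈ l)
    (hok : ∀ a, C.Ok C.k₁ a) {S : ∀ k, List (Γ k)} (hS : (S C.k₁).map C.out = y) (v : σ) :
    C.Halts l y (.run .halt v) S ((6 * y.length + 4) * (C.B + 2)) := by
  intro s hs
  have h2 := C.two_le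
  have hk := C.two_le_st C.k₁
  have h1 : Act.HaltsFrom C.B C.act l y (.test true)
      (Function.update (Function.update s (C.st C.k₁) []) 0 (y.reverse.map Bool.toNat))
      ((C.B + 2) + (3 * y.length + 1) * (C.B + 2)) := by
    have := Act.HaltsFrom.move (B := C.B) (act := C.act) (l := l) (y := y) (i := 0) (j := 1)
      (by decide) (dec := fun a => a == 1) (test := .test true) (exit := .exit)
      (T := C.B + 2) (htest _) (hpop true) (hpush true) rfl rfl (fun a => rfl) (fun b => rfl)
      (fun b => rfl) (u := y.reverse.map Bool.toNat)
      (S := Function.update (Function.update s (C.st C.k₁) []) 0 (y.reverse.map Bool.toNat))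
      (by
        intro a ha
        obtain ⟨b, -, rfl⟩ := List.mem_map.1 ha
        exact (Bool.toNat_lt b).trans_le h2) (by simp) (Act.HaltsFrom.halt hexit rfl (by
          rw [Function.update_self, Function.update_of_ne (by decide),
            Function.update_of_ne (by omega), hs.one, List.append_nil, ← List.map_reverse,
            List.map_reverse, List.map_map, ← List.map_reverse, List.reverse_reverse]
          refine List.map_congr_left fun b _ => ?_
          cases b <;> rfl))
    simpa using this
  have h3 := Act.HaltsFrom.move (B := C.B) (act := C.act) (l := l) (y := y) (i := C.st C.k₁)
      (j := 0) (by omega) (dec := fun a => (C.dec C.k₁ a).elim false C.out) (test := .test false)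
      (exit := .test true) (htest _) (hpop false) (hpush false) rfl rfl (fun a => rfl)
      (fun b => rfl) (fun b => rfl) (u := (S C.k₁).map (C.enc C.k₁)) (S := s)
      (by
        intro a ha
        obtain ⟨b, -, rfl⟩ := List.mem_map.1 ha
        exact (hok b).1) (hs.stk _) (by
          convert h1 using 2
          rw [hs.zero, List.append_nil, ← hS, List.map_reverse, List.map_map, List.map_map]
          refine congrArg _ (List.map_congr_left fun b _ => ?_)
          simp [(hok b).2])
  refine (Act.HaltsFrom.switch (hrun v) rfl (by simp [hs.zero]) h3).mono ?_
  rw [List.length_map, ← List.length_map C.out, hS]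
  apply le_of_eq
  ring

/-- For each of the `k` data bits, three input symbols are pushed on stack `k₀`. -/
theorem halts_input [DecidableEq K] (hinput : ∀ i, .input i ∈ l) {k j T : ℕ}
    {s : ℕ → List ℕ} (h0 : s 0 = List.replicate k 1) (h1 : s 1 = [])
    (hk : ∀ i, s (C.st i) =
      (Function.update (fun _ => []) C.k₀ (List.replicate j C.one) i).map (C.enc i))
    (h : C.Halts l y (.run (C.m C.main) C.v₀)
      (Function.update (fun _ => []) C.k₀ (List.replicate (j + 3 * k) C.one)) T) :
    Act.HaltsFrom C.B C.act l y (.input 0) s (T + (5 * k + 1) * (C.B + 2)) := by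
  have h2 := C.two_le
  induction k generalizing j s with
  | zero =>
    refine (Act.HaltsFrom.switch (T := T) (hinput 0) rfl (by simp [h0]) ?_).mono (by simp)
    rw [h0]
    exact h s ⟨hk, h0, h1⟩
  | succ k ih =>
    have hst := C.two_le_st C.k₀
    have := Act.HaltsFrom.switch (B := C.B) (act := C.act) (y := y) (S := s)
      (T := T + (5 * k + 1) * (C.B + 2) + (C.B + 2) + (C.B + 2) + (C.B + 2) + (C.B + 2)) (hinput 0) rfl (by simp [h0, List.replicate_succ]; omega)
      (by
        rw [h0, List.replicate_succ, List.head?_cons]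
        exact Act.HaltsFrom.pop (hinput 1) rfl (Act.HaltsFrom.push (hinput 2) rfl
          (Act.HaltsFrom.push (hinput 3) rfl (Act.HaltsFrom.push (hinput 4) rfl
            (ih (j := j + 3) (by
              rw [Function.update_of_ne (by omega), Function.update_of_ne (by omega),
                Function.update_of_ne (by omega), Function.update_self, h0, List.replicate_succ,
                List.tail_cons])
              (by
                rw [Function.update_of_ne (by omega), Function.update_of_ne (by omega),
                  Function.update_of_ne (by omega), Function.update_of_ne (by omega), h1])
              (by
                intro i
                rcases eq_or_ne i C.k₀ with rfl | hi
                · have := hk C.k₀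
                  simp only [Function.update_self, List.map_replicate] at this ⊢
                  rw [Function.update_of_ne (by omega), this]
                  rfl
                · have := hk i
                  have hi' := C.st_injective.ne hi
                  have := C.two_le_st i
                  rw [Function.update_of_ne hi', Function.update_of_ne hi',
                    Function.update_of_ne hi', Function.update_of_ne (by omega), hk i]
                  simp [hi])
              (by rwa [show j + 3 + 3 * k = j + 3 * (k + 1) by ring]))))))
    exact this.mono (le_of_eq (by ring))

end Coding
end RelComplexity

namespace RelComplexity

open Turing

/-- The symbols that a statement may push. -/
def pushed {K : Type} {Γ : K → Type} {Λ σ : Type} : TM2.Stmt Γ Λ σ → Set (Σ k, Γ k)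
  | .push k f q => Set.range (fun v => ⟨k, f v⟩) ∪ pushed q
  | .peek _ _ q => pushed q
  | .pop _ _ q => pushed q
  | .load _ q => pushed q
  | .branch _ q₁ q₂ => pushed q₁ ∪ pushed q₂
  | .goto _ => ∅
  | .halt => ∅

theorem pushed_finite {K : Type} {Γ : K → Type} {Λ σ : Type} [Finite σ] (q : TM2.Stmt Γ Λ σ) :
    (pushed q).Finite := by
  induction q with
  | push k f q ih => exact (Set.finite_range _).union ih
  | peek _ _ q ih | pop _ _ q ih | load _ q ih => exact ih
  | branch _ q₁ q₂ ih₁ ih₂ => exact ih₁.union ih₂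
  | goto _ | halt => exact Set.finite_empty

theorem Coding.pushOk_of_pushed {K : Type} {Γ : K → Type} {Λ σ : Type} {C : Coding Γ Λ σ}
    {q : TM2.Stmt Γ Λ σ} (h : ∀ k a, ⟨k, a⟩ ∈ pushed q → C.Ok k a) : C.PushOk q := by
  induction q with
  | push k f q ih => exact ⟨fun v => h _ _ (.inl ⟨v, rfl⟩), ih fun k a ha => h k a (.inr ha)⟩
  | peek _ _ q ih | pop _ _ q ih | load _ q ih => exact ih h
  | branch _ q₁ q₂ ih₁ ih₂ =>
    exact ⟨ih₁ fun k a ha => h k a (.inl ha), ih₂ fun k a ha => h k a (.inr ha)⟩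
  | goto _ | halt => trivial

/-- Finitely many symbols can be numbered. -/
theorem exists_enc_dec {K : Type} {Γ : K → Type} {G : Set (Σ k, Γ k)} (hG : G.Finite) :
    ∃ (B : ℕ) (enc : ∀ k, Γ k → ℕ) (dec : ∀ k, ℕ → Option (Γ k)), 2 ≤ B ∧
      ∀ k a, ⟨k, a⟩ ∈ G → enc k a < B ∧ dec k (enc k a) = some a := by
  classical
  have := hG.to_subtype
  obtain ⟨n, ⟨e⟩⟩ := Finite.exists_equiv_fin G
  refine ⟨n + 2, fun k a => if h : ⟨k, a⟩ ∈ G then e ⟨_, h⟩ else 0,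
    fun k i => if h : ∃ a, ∃ hG : ⟨k, a⟩ ∈ G, (e ⟨_, hG⟩ : ℕ) = i then some h.choose else none,
    by omega, fun k a ha => ⟨?_, ?_⟩⟩
  · simp only [dif_pos ha]
    have := (e ⟨_, ha⟩).2
    omega
  · have h : ∃ a', ∃ hG : ⟨k, a'⟩ ∈ G, (e ⟨_, hG⟩ : ℕ) = e ⟨_, ha⟩ := ⟨a, ha, rfl⟩
    simp only [dif_pos ha]
    rw [dif_pos h]
    obtain ⟨h1, h2⟩ := h.choose_spec
    have := congrArg Subtype.val (e.injective (Fin.ext h2))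
    simpa using this

open Classical in
/-- The nodes of the flow graph of a Turing machine with finitely many labels and states. The list
begins with the start node, which therefore has the address `0`. -/
noncomputable def Coding.nodes {K : Type} {Γ : K → Type} {Λ σ : Type} [Fintype K] [Fintype Λ]
    [Fintype σ] (C : Coding Γ Λ σ) : List (Node Γ Λ σ) :=
  [.input 0, .input 1, .input 2, .input 3, .input 4, .test false, .test true, .exit] ++
    ([false, true].flatMap fun s => [false, true].flatMap fun b => [.popOut s b, .pushOut s b]) ++
    (insert .halt (Finset.univ.biUnion fun i => TM2.stmts₁ (C.m i))).toList.flatMap fun q =>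
      Finset.univ.toList.flatMap fun v =>
        .run q v :: Finset.univ.toList.map fun k => .popThen k q v

/-- Halting computations of a Turing machine are carried out by a program of constant length, with
constant slowdown. -/
theorem Coding.exists_prints {K : Type} {Γ : K → Type} {Λ σ : Type} [DecidableEq K] [Fintype K]
    [Fintype Λ] [Fintype σ] (C : Coding Γ Λ σ) (hm : ∀ i, C.PushOk (C.m i)) (h₀ : C.Ok C.k₀ C.one)
    (h₁ : ∀ a, C.Ok C.k₁ a) : ∃ (M : List Instr) (E : ℕ), ∀ (k n : ℕ) (y : List Bool)
      (c : TM2.Cfg Γ Λ σ), (flip bind (TM2.step C.m))^[n] (some ⟨some C.main, C.v₀,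
        Function.update (fun _ => []) C.k₀ (List.replicate (3 * k) C.one)⟩) = some c →
      c.l = none → (c.stk C.k₁).map C.out = y →
      ∃ t ≤ E * (n + k + y.length + 1), Prints (encodeCode M ++ List.replicate k true) y t := by
  classical
  have hstmt : ∀ i, ∀ q ∈ TM2.stmts₁ (C.m i), ∀ v,
      .run q v ∈ C.nodes ∧ ∀ k, .popThen k q v ∈ C.nodes := by
    intro i q hq v
    simp only [nodes, List.mem_append, List.mem_flatMap, Finset.mem_toList, Finset.mem_insert,
      Finset.mem_biUnion]
    exact ⟨.inr ⟨q, .inr ⟨i, Finset.mem_univ _, hq⟩, v, Finset.mem_univ _, by simp⟩,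
      fun k => .inr ⟨q, .inr ⟨i, Finset.mem_univ _, hq⟩, v, Finset.mem_univ _, by simp⟩⟩
  have hhalt : ∀ v, .run .halt v ∈ C.nodes := by
    intro v
    simp only [nodes, List.mem_append, List.mem_flatMap, Finset.mem_toList, Finset.mem_insert]
    exact .inr ⟨.halt, .inl rfl, v, Finset.mem_univ _, by simp⟩
  have hinput : ∀ i, .input i ∈ C.nodes := by
    intro i
    fin_cases i <;> simp [nodes]
  choose D hD using fun i => exists_halts_stepAux (hm i) (hstmt i)
  have hD' : ∀ i, D i ≤ ∑ j, D j := fun i =>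
    Finset.single_le_sum (f := D) (fun _ _ => Nat.zero_le _) (Finset.mem_univ i)
  refine ⟨Act.compile C.B C.act C.nodes, (∑ j, D j) + 11 * (C.B + 2), fun k n y c hc hl hy => ?_⟩
  have hend := halts_exit (C := C) (l := C.nodes) hhalt (fun s => by cases s <;> simp [nodes])
    (fun s b => by cases s <;> cases b <;> simp [nodes])
    (fun s b => by cases s <;> cases b <;> simp [nodes]) (by simp [nodes]) h₁ hy c.var
  have hrun := halts_of_evals (C := C) (l := C.nodes) (y := y) (D := ∑ j, D j)
    (fun i v S hS => ⟨(hD i y v S hS).1, fun T hT => ((hD i y v S hS).2 T hT).mono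
      (Nat.add_le_add_left (hD' i) T)⟩) hc (by
      intro k'
      rcases eq_or_ne k' C.k₀ with rfl | hk
      · simpa using fun _ => h₀
      · simp [hk]) (T := (6 * y.length + 4) * (C.B + 2)) (by rwa [cfgNode, hl])
  obtain ⟨t, ht, hprint⟩ := halts_input (C := C) (l := C.nodes) (y := y) hinput (k := k) (j := 0)
    (s := (initConfig (List.replicate k true)).stk) (by simp [initConfig]) (by simp [initConfig])
    (by
      intro i
      have := C.two_le_st i
      have h0 : C.st i ≠ 0 := by omega
      simp only [initConfig, Function.update_of_ne h0, List.replicate_zero]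
      rcases eq_or_ne i C.k₀ with rfl | hk
      · simp
      · simp [hk]) (T := (6 * y.length + 4) * (C.B + 2) + n * ∑ j, D j) (by simpa [cfgNode] using hrun)
  refine ⟨t, ht.trans ?_, _, _, rfl, ?_⟩
  · generalize (∑ j, D j) = D
    generalize C.B + 2 = B
    nlinarith [Nat.zero_le (k * B), Nat.zero_le (y.length * B), Nat.zero_le (n * B),
      Nat.zero_le (k * D), Nat.zero_le (y.length * D), Nat.zero_le (n * D)]
  · convert hprint
    simp [Act.addr, nodes, initConfig]

theorem initList_stk (tm : FinTM2) (s : List (tm.Γ tm.k₀)) :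
    (initList tm s).stk = Function.update (fun _ => []) tm.k₀ s := by
  funext k
  by_cases h : k = tm.k₀
  · subst h
    simp [initList]
  · simp [initList, h]

theorem haltList_stk (tm : FinTM2) (s : List (tm.Γ tm.k₁)) : (haltList tm s).stk tm.k₁ = s := by
  simp [haltList]

/-- A program that computes `x ↦ A x` on the strings `1 ^ (3 * k)`, given `k` data bits. -/
theorem exists_prints_of_computable {A : List Bool → List Bool}
    (h : TM2ComputableInPolyTime (id : List Bool → List Bool) id A) :
    ∃ (M : List Instr) (E : ℕ), ∀ k, ∃ t,
      t ≤ E * (h.time.eval (3 * k) + k + (A (List.replicate (3 * k) true)).length + 1) ∧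
      Prints (encodeCode M ++ List.replicate k true) (A (List.replicate (3 * k) true)) t := by
  classical
  obtain ⟨B, enc, dec, hB, hG⟩ := exists_enc_dec (K := h.tm.K) (Γ := h.tm.Γ)
    (G := (⋃ i : h.tm.Λ, pushed (h.tm.m i)) ∪ Set.range (fun a : h.tm.Γ h.tm.k₀ => ⟨h.tm.k₀, a⟩) ∪
      Set.range (fun a : h.tm.Γ h.tm.k₁ => ⟨h.tm.k₁, a⟩)) (by
      have : Fintype h.tm.Λ := h.tm.ΛFin
      have : Fintype h.tm.σ := h.tm.σFin
      have : Finite (h.tm.Γ h.tm.k₀) := .of_equiv _ h.inputAlphabet.symm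
      have : Finite (h.tm.Γ h.tm.k₁) := .of_equiv _ h.outputAlphabet.symm
      exact ((Set.finite_iUnion fun i => pushed_finite _).union (Set.finite_range _)).union
        (Set.finite_range _))
  have : Fintype h.tm.K := h.tm.kFin
  have : Fintype h.tm.Λ := h.tm.ΛFin
  have : Fintype h.tm.σ := h.tm.σFin
  obtain ⟨M, E, hM⟩ := Coding.exists_prints (K := h.tm.K) (Γ := h.tm.Γ) (Λ := h.tm.Λ) (σ := h.tm.σ)
    { m := h.tm.m
      main := h.tm.main
      v₀ := h.tm.initialState
      k₀ := h.tm.k₀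
      one := h.inputAlphabet.symm true
      k₁ := h.tm.k₁
      out := h.outputAlphabet
      st := fun k => 2 + Fintype.equivFin _ k
      st_injective := fun i j hij => by simpa [Fin.val_inj] using hij
      two_le_st := fun k => Nat.le_add_right _ _
      enc := enc
      dec := dec
      B := B
      two_le := hB }
    (fun i => Coding.pushOk_of_pushed fun k a ha => hG k a (.inl (.inl (Set.mem_iUnion.2 ⟨i, ha⟩))))
    (hG _ _ (.inl (.inr ⟨_, rfl⟩))) (fun a => hG _ _ (.inr ⟨a, rfl⟩))
  refine ⟨M, E, fun k => ?_⟩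
  obtain ⟨⟨n, hn⟩, hn'⟩ := h.outputsFun (List.replicate (3 * k) true)
  obtain ⟨t, ht, hp⟩ := hM k n (A (List.replicate (3 * k) true)) (haltList h.tm
    ((A (List.replicate (3 * k) true)).map h.outputAlphabet.symm)) (by
      rw [← List.map_replicate, ← initList_stk]
      exact hn) rfl (by
      simp only [haltList_stk, List.map_map]
      simp)
  refine ⟨t, ht.trans (Nat.mul_le_mul_left _ ?_), hp⟩
  have : n ≤ h.time.eval (3 * k) := by simpa using hn'
  omega

/-- A polynomial-time algorithm outputs strings of low complexity on the strings `1 ^ (3 * k)`. -/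
theorem ktRelation_notMem_FP : ktRelation ∉ FP := by
  rintro ⟨-, A, ⟨h⟩, hA⟩
  have hR : ∀ x, ktRelation x (A x) := fun x => hA x (exists_ktRelation x)
  obtain ⟨M, E, hM⟩ := exists_prints_of_computable h
  -- for `k = 2 * j`, the complexity is at most `c + 2 * j + log₂ (P.eval j)`, which should be
  -- less than `3 * j`
  obtain ⟨P, hP⟩ : ∃ P : Polynomial ℕ, ∀ j, P.eval j =
      2 ^ (encodeCode M).length * (E * (h.time.eval (6 * j) + 8 * j + 1)) :=
    ⟨2 ^ (encodeCode M).length * (E * (h.time.comp (6 * .X) + 8 * .X + 1)), fun j => by simp⟩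
  have hlim : ∀ P : Polynomial ℕ, Filter.Tendsto (fun j : ℕ => ((P.eval j : ℕ) : ℝ) / 2 ^ j)
      Filter.atTop (nhds 0) := by
    intro P
    induction P using Polynomial.induction_on' with
    | add P Q hP hQ => simpa [add_div] using hP.add hQ
    | monomial n a =>
      simpa [mul_div_assoc] using
        (tendsto_pow_const_div_const_pow_of_one_lt n (one_lt_two (α := ℝ))).const_mul (a : ℝ)
  obtain ⟨j, hj⟩ := ((hlim P).eventually (gt_mem_nhds one_pos)).exists
  rw [div_lt_one (by positivity), hP] at hj
  obtain ⟨t, ht, hp⟩ := hM (2 * j)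
  obtain ⟨hlen, hKt⟩ := hR (List.replicate (3 * (2 * j)) true)
  rw [List.length_replicate] at hlen
  have h1 : Kt (A (List.replicate (3 * (2 * j)) true)) ≤
      ((((encodeCode M ++ List.replicate (2 * j) true).length : ℝ) + Real.logb 2 t : ℝ) : EReal) :=
    iInf_le_of_le _ (iInf_le_of_le t (iInf_le_of_le hp le_rfl))
  have h2 := EReal.coe_le_coe_iff.1 (hKt.trans h1)
  have ht1 : (1 : ℝ) ≤ t := by exact_mod_cast hp.time_pos
  have h3 : (2 : ℝ) ^ (encodeCode M).length * t < 2 ^ j := by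
    refine lt_of_le_of_lt ?_ hj
    have : t ≤ E * (h.time.eval (6 * j) + 8 * j + 1) := by
      convert ht using 2
      rw [← hlen, show 3 * (2 * j) = 6 * j by ring]
      ring
    exact_mod_cast Nat.mul_le_mul_left _ this
  have h4 := Real.logb_lt_logb (b := 2) (by norm_num) (by positivity) h3
  rw [Real.logb_mul (by positivity) (by positivity), Real.logb_pow, Real.logb_pow,
    Real.logb_self_eq_one (by norm_num)] at h4
  rw [← hlen] at h2
  simp at h2
  linarith

end RelComplexity

theorem mainTheorem4 :
    RelComplexity.ktRelation ∈ RelComplexity.FBPP ∧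
      RelComplexity.ktRelation ∉ RelComplexity.FP ∧
      RelComplexity.FP ≠ RelComplexity.FBPP := by
  refine ⟨RelComplexity.ktRelation_mem_FBPP, RelComplexity.ktRelation_notMem_FP, fun h => ?_⟩
  exact RelComplexity.ktRelation_notMem_FP (h ▸ RelComplexity.ktRelation_mem_FBPP)
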